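/- Conventions. $\log$ is base 2, $[w]=\{1,\dots,w\}$, $U_n$ is uniform on $\{0,1\}^n$, and families are indexed by positive integers $w$; $s,m,a',\epsilon$ are functions of $w$. A $(w,1)$-automaton is a function $Q:[w]\times\{0,1\}\to[w]$; for $q\in[w]$ and $x\in\{0,1\}^m$, $Q^m(q;x)$ is the state reached from $q$ after reading the bits of $x$ in order. $\mathbf Q_{w,1}^m$ is the set of functions $x\mapsto Q^m(q;x)$, each presented by a pair $(Q,q)$; sets $\mathbf A_w\subseteq\mathbf Q_{w,1}^m$ below are given as sets of such pairs. Space is the work-tape space of a deterministic Turing machine with read-only input and write-only output; automata are written as transition tables, and numbers given as inputs are in binary. A sequence $((Q_1,q_1),(Q_2,q_2),\dots)$, with $Q_w$ a $(w,1)$-automaton and $q_w\in[w]$, is uniform if some deterministic algorithm, given $w$, outputs $(Q_w,q_w)$ in space $O(\log w)$. A family $\{\mathbf A_w\}$ covers the uniform setting if for every uniform sequence, $(Q_w,q_w)\in\mathbf A_w$ for all sufficiently large $w$. A family $\mathsf{Gen}_w:\mathbf A_w\times\{0,1\}^{s}\to\{0,1\}^{m}$ is a targeted $\epsilon$-pseudorandom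 generator against $\mathbf Q_{w,1}^m$ in the uniform setting if $\{\mathbf A_w\}$ covers the uniform setting and, for every $w$ and every $(Q,q)\in\mathbf A_w$, the distributions of $Q^m(q;\mathsf{Gen}_w(Q,q,U_s))$ and $Q^m(q;U_m)$ are at total variation distance at most $\epsilon$. A family $\mathsf{Gen}'_w:\{0,1\}^{s}\to\{0,1\}^{a'}$ is an $\epsilon$-simulation advice generator for $\mathbf Q_{w,1}^m$ in the uniform setting if there are a family $\{\mathbf A'_w\}$ covering the uniform setting and a single deterministic algorithm $\mathsf S$, using space logarithmic in its input length, such that for every $w$ and every $(Q,q)\in\mathbf A'_w$ the distributions of $\mathsf S(Q,q,\mathsf{Gen}'_w(U_s))$ and $Q^m(q;U_m)$ are at total variation distance at most $\epsilon$. Either kind of family is efficiently computable if $s$ is space constructible ($s(w)$ is computable from $1^w$ in space $O(s(w))$) and, given $w$ and an argument of the $w$-th generator, its value is computable in deterministic space $O(s(w))$. Proposition. Let $\mu\in[0,1]$ and $\sigma>\eta>0$ be constants. Suppose $\{\mathsf{Gen}_w\}$ is an efficiently computable targeted $\epsilon$-pseudorandom generator against $\mathbf Q_{w,1}^m$ in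 the uniform setting with seed length $s$, where $$s\le O(\log^{1+\sigma}w),\qquad \log(1/\epsilon)=\log^{1+\eta}w,\qquad \log m\ge\log^{\mu}w\quad(w\ge 2).$$ Then there is an efficiently computable $\epsilon$-simulation advice generator $\{\mathsf{Gen}'_w\}$ for $\mathbf Q_{w,1}^m$ in the uniform setting with the same seed length $s$ and output length $a'\le\mathrm{poly}(w)$. -/

import Mathlib

open Filter Asymptotics

namespace SpaceDerand

/-! ### Deterministic space-bounded computation -/

/-- A head movement. -/
inductive Move where
  | left
  | stay
  | right

/-- What a machine with `t` input tapes and `k` work tapes does in one step. -/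
structure Action (t k : ℕ) (State : Type) where
  next : State
  inMove : Fin t → Move
  write : Fin k → Option Bool
  workMove : Fin k → Move
  /-- the bit appended to the write-only output tape, if any -/
  emit : Option Bool

/-- A deterministic offline Turing machine with `t` read-only two-way input tapes, `k` two-way
infinite read-write work tapes over the alphabet `{0, 1, blank}` (the blank is `none`), a
write-only one-way output tape and finitely many control states. The machine halts when the
transition function returns `none`. -/
structure OfflineTM (t : ℕ) where
  k : ℕ
  State : Type
  [fin : Fintype State]
  start : State
  δ : State → (Fin t → Option Bool) → (Fin k → Option Bool) → Option (Action t k State)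

namespace OfflineTM

variable {t : ℕ}

/-- Configurations. Cell `j + 1` of an input tape holds the `j`-th input bit; input heads live on
the cells `0, …, n + 1`, where `n` is the length of the input, and cells `0` and `n + 1` look
blank. -/
structure Cfg (M : OfflineTM t) where
  state : M.State
  inPos : Fin t → ℕ
  tape : Fin M.k → ℤ → Option Bool
  pos : Fin M.k → ℤ
  out : List Bool

/-- The symbol seen at cell `p` of an input tape holding `l`. -/
def readInput (l : List Bool) : ℕ → Option Bool
  | 0 => none
  | p + 1 => l[p]?

/-- Movement of an input head, confined to the cells `0, …, n + 1`. -/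
def moveInput (n : ℕ) : Move → ℕ → ℕ
  | .left, p => p - 1
  | .stay, p => p
  | .right, p => min (p + 1) (n + 1)

/-- Movement of a work head. -/
def moveWork : Move → ℤ → ℤ
  | .left, p => p - 1
  | .stay, p => p
  | .right, p => p + 1

/-- The initial configuration: all work tapes blank, all heads at cell `0`, no output. -/
def init (M : OfflineTM t) : M.Cfg where
  state := M.start
  inPos := fun _ => 0
  tape := fun _ _ => none
  pos := fun _ => 0
  out := []

/-- One step of the machine on the input `inp`; `none` if the machine has halted. -/
def step (M : OfflineTM t) (inp : Fin t → List Bool) (c : M.Cfg) : Option M.Cfg :=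
  (M.δ c.state (fun i => readInput (inp i) (c.inPos i)) (fun i => c.tape i (c.pos i))).map
    fun A =>
      { state := A.next
        inPos := fun i => moveInput (inp i).length (A.inMove i) (c.inPos i)
        tape := fun i => Function.update (c.tape i) (c.pos i) (A.write i)
        pos := fun i => moveWork (A.workMove i) (c.pos i)
        out := c.out ++ A.emit.toList }

/-- On the input `inp` the machine halts with output `o`, and at all times every work head is
within distance `L` of its initial cell. -/
def OutputsInSpace (M : OfflineTM t) (inp : Fin t → List Bool) (o : List Bool) (L : ℕ) : Prop :=
  (∃ c ∈ StateTransition.eval (M.step inp) M.init, c.out = o) ∧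
    ∀ c, StateTransition.Reaches (M.step inp) M.init c → ∀ i, |c.pos i| ≤ (L : ℤ)

end OfflineTM

/-- A single deterministic machine maps the input `inp i` to the output `out i` in space
`O(b i)`, for all `i`. (The `+ 1` only matters where `b i = 0`.) -/
def ComputableInSpace {ι : Type} {t : ℕ} (inp : ι → Fin t → List Bool) (out : ι → List Bool)
    (b : ι → ℕ) : Prop :=
  ∃ (M : OfflineTM t) (C : ℕ), ∀ i, M.OutputsInSpace (inp i) (out i) (C * (b i + 1))

/-! ### Bit strings, automata and their encodings -/

/-- `{0, 1} ^ n`. -/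
abbrev Bits (n : ℕ) : Type := Fin n → Bool

/-- A `(w, 1)`-automaton, with state set `Fin w`. -/
abbrev Automaton (w : ℕ) : Type := Fin w → Bool → Fin w

/-- A pair `(Q, q)` of an automaton and a start state. -/
abbrev Pointed (w : ℕ) : Type := Automaton w × Fin w

/-- The function `x ↦ Q ^ m (q; x)` specified by the pair `(Q, q)`: the state reached from `q`
after reading the bits of `x` in order. -/
def Pointed.fn {w : ℕ} (m : ℕ) (p : Pointed w) (x : Bits m) : Fin w :=
  (List.ofFn x).foldl p.1 p.2

/-- A state of a `w`-state automaton in binary, least significant bit first, in the fixed width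
`Nat.size w`. -/
def encState {w : ℕ} (q : Fin w) : List Bool :=
  List.ofFn fun j : Fin (Nat.size w) => Nat.testBit q j

/-- The transition table of an automaton. -/
def encAutomaton {w : ℕ} (Q : Automaton w) : List Bool :=
  (List.finRange w).flatMap fun i => encState (Q i false) ++ encState (Q i true)

/-! ### Simulators and generators -/

/-- The distribution of `f (U_n)`. -/
noncomputable def law {n : ℕ} {α : Type} (f : Bits n → α) : PMF α :=
  (PMF.uniformOfFintype (Bits n)).map f

/-- The total variation distance between `P` and `P'` is at most `ε`. -/
def TVClose {α : Type} (ε : ℝ) (P P' : PMF α) : Prop :=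
  ∀ E : Set α, |(P.toOuterMeasure E).toReal - (P'.toOuterMeasure E).toReal| ≤ ε

/-- `Sim` is an `ε`-simulator for the functions `{0, 1} ^ m → [w]` specified by the pairs
in `A`. -/
def IsSimulator {w s : ℕ} (ε : ℝ) (m : ℕ) (A : Set (Pointed w)) (Sim : A → Bits s → Fin w) :
    Prop :=
  ∀ f : A, TVClose ε (law (Sim f)) (law (f.1.fn m))

/-- `Gen` is a targeted `ε`-pseudorandom generator against the functions specified by the pairs
in `A`. -/
def IsTargetedPRG {w s m : ℕ} (ε : ℝ) (A : Set (Pointed w)) (Gen : A → Bits s → Bits m) : Prop :=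
  IsSimulator ε m A fun f x => f.1.fn m (Gen f x)

/-- A deterministic logspace algorithm that gets a number of states `w`, an automaton, a start
state and an advice string, and outputs a state: its space is logarithmic in the total length of
its input. -/
def IsLogspaceAlgorithm (S : (w : ℕ+) → Pointed w → List Bool → Fin w) : Prop :=
  ComputableInSpace (ι := (w : ℕ+) × Pointed w × List Bool)
    (fun ⟨w, p, y⟩ => ![Nat.bits w, encAutomaton p.1, encState p.2, y])
    (fun ⟨w, p, y⟩ => encState (S w p y))
    (fun ⟨w, p, y⟩ => Nat.log 2 ((Nat.bits w).length + (encAutomaton p.1).length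
      + (encState p.2).length + y.length))

/-- The family `Gen` is an `ε`-simulation advice generator for the functions specified by the
pairs in `A w`. -/
def IsSimulationAdviceGenerator {s a : ℕ+ → ℕ} (ε : ℕ+ → ℝ) (m : ℕ+ → ℕ)
    (A : (w : ℕ+) → Set (Pointed w)) (Gen : (w : ℕ+) → Bits (s w) → Bits (a w)) : Prop :=
  ∃ S : (w : ℕ+) → Pointed w → List Bool → Fin w, IsLogspaceAlgorithm S ∧
    ∀ w, IsSimulator (ε w) (m w) (A w) fun f x => S w f.1 (List.ofFn (Gen w x))

/-- `s` is space constructible: from `w` in unary, `s w` is computed in binary in space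
`O(s w)`. -/
def SpaceConstructible (s : ℕ+ → ℕ) : Prop :=
  ComputableInSpace (fun w : ℕ+ => ![List.replicate w true]) (fun w => Nat.bits (s w)) s

/-- Efficient computability of a family of targeted generators with seed length `s`, where the
`w`-th generator is defined on `A w`. -/
def EfficientTargeted {s m : ℕ+ → ℕ} (A : (w : ℕ+) → Set (Pointed w))
    (Gen : (w : ℕ+) → A w → Bits (s w) → Bits (m w)) : Prop :=
  SpaceConstructible s ∧
    ComputableInSpace (ι := (w : ℕ+) × A w × Bits (s w))
      (fun ⟨w, p, x⟩ => ![Nat.bits w, encAutomaton p.1.1, encState p.1.2, List.ofFn x])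
      (fun ⟨w, p, x⟩ => List.ofFn (Gen w p x))
      (fun ⟨w, _, _⟩ => s w)

/-- Efficient computability of a family of advice generators with seed length `s`. -/
def EfficientAdvice {s a : ℕ+ → ℕ} (Gen : (w : ℕ+) → Bits (s w) → Bits (a w)) : Prop :=
  SpaceConstructible s ∧
    ComputableInSpace (ι := (w : ℕ+) × Bits (s w))
      (fun ⟨w, x⟩ => ![Nat.bits w, List.ofFn x])
      (fun ⟨w, x⟩ => List.ofFn (Gen w x))
      (fun ⟨w, _⟩ => s w)

/-! ### The uniform setting -/

/-- The sequence `(Q_w, q_w)` is produced from `w` in space `O(log w)`. -/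
def IsUniformSequence (p : (w : ℕ+) → Pointed w) : Prop :=
  ComputableInSpace (fun w : ℕ+ => ![Nat.bits w])
    (fun w => encAutomaton (p w).1 ++ encState (p w).2) (fun w => Nat.log 2 w)

/-- Every uniform sequence is eventually in `A`. -/
def CoversUniform (A : (w : ℕ+) → Set (Pointed w)) : Prop :=
  ∀ p : (w : ℕ+) → Pointed w, IsUniformSequence p → ∀ᶠ w in atTop, p w ∈ A w

end SpaceDerand

namespace SpaceDerand

/-! ### Structured programs over stacks -/

/-! Let `M` compute the given generator in space `O(s)`. The advice generator does not see the pair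
`(Q, q)`, but in the uniform setting few pairs matter. Put `G = w.size.size`, about `log log w`. The
machine that prints a uniform sequence is fixed, so for large `w` its number of work tapes, the base
of its transition table and the number coding that table are all below `G`: it is one of `G ^ 3`
candidates (`exists_rawBit_eq`). For a seed `x`, the advice is a table listing, for every candidate,
the pair it prints on input `w` and the state which that pair reaches on the output of `M` for that
pair and `x`. The simulator looks up its own pair, so its output distribution is exactly that of the
targeted generator, with the same error. Candidates that print nonsense are harmless, as only
entries equal to the actual pair are consulted. The table has polynomial length.

A candidate has at most `G` tapes, each of which is given `s / G` cells on either side of the start;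
the machine sought needs `O(log w)`. So it is enough that `log w * log log w` is small compared with
`s`, and this is forced by the error. The automaton that counts trailing ones up to `w - 1` is
uniform, hence eventually in `A w`. If `m > s`, the event of at least `s + 1` trailing ones has
probability `2 ^ (-(s + 1))`, while under an `s`-bit seed its probability is a multiple of `2 ^
(-s)`. Hence `2 ^ (-(s + 1)) ≤ ε`, that is, `log ^ (1 + η) w ≤ s + 1` (`half_pow_le_of_tvClose`,
`eventually_space_le`).

Two cases remain. If `m ≤ s`, the first `m` bits of the seed are uniform and serve as advice. As `m`
is not assumed computable, it is compared with `s` by counting the bits that `M` outputs for the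
automaton above (`outCount_eq`). If `s` is smaller than the length of `w`, the generator has no room
even for `w`; then the advice is the seed, and the simulator has room to run `M` itself. The three
cases are `simulator_short`, `simulator_prefix` and `simulator_table`.

The rest shows that all this is possible on machines within the stated space. Structured programs
over stacks are compiled to machines (`Runs.path`). `Impl c f` says that a program computes the
number `f` in space `O(b)` from known numbers in registers; it is closed under loops, arithmetic and
digit extraction. In this calculus a machine is simulated by arithmetic on coded configurations, its
output being folded rather than stored (`OfflineTM.OutputsInSpace.fold_eq`, `Sim.Good.implFold`).
Bits of intermediate strings are thus recomputed on demand, and simulations can be nested. -/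

/-- Structured programs for a machine with `t` input tapes whose work tapes are stacks of bits. -/
inductive Prog (t : ℕ) where
  | skip
  | push (r : ℕ) (b : Bool)
  | pop (r : ℕ)
  | move (j : Fin t) (d : Move)
  | emit (b : Bool)
  | seq (p q : Prog t)
  | branch (r : ℕ) (p : Option Bool → Prog t)
  | branchIn (j : Fin t) (p : Option Bool → Prog t)
  | loop (r : ℕ) (c : Option Bool → Bool) (p : Prog t)

/-- The memory of a stack program. -/
@[ext]
structure St (t : ℕ) where
  reg : ℕ → List Bool
  head : Fin t → ℕ
  out : List Bool

variable {t : ℕ}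

/-- Big-step semantics: `p` leads from `s` to `s'`, and no push makes a stack higher than `B`. -/
inductive Runs (inp : Fin t → List Bool) (B : ℕ) : Prog t → St t → St t → Prop
  | skip (s) : Runs inp B .skip s s
  | push (r b s) (h : (s.reg r).length + 1 ≤ B) :
      Runs inp B (.push r b) s { s with reg := Function.update s.reg r (b :: s.reg r) }
  | pop (r s) : Runs inp B (.pop r) s { s with reg := Function.update s.reg r (s.reg r).tail }
  | move (j d s) : Runs inp B (.move j d) s
      { s with head := Function.update s.head j
                (OfflineTM.moveInput (inp j).length d (s.head j)) }
  | emit (b s) : Runs inp B (.emit b) s { s with out := s.out ++ [b] }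
  | seq (p q s s' s'') (hp : Runs inp B p s s') (hq : Runs inp B q s' s'') :
      Runs inp B (.seq p q) s s''
  | branch (r p s s') (h : Runs inp B (p (s.reg r).head?) s s') : Runs inp B (.branch r p) s s'
  | branchIn (j p s s') (h : Runs inp B (p (OfflineTM.readInput (inp j) (s.head j))) s s') :
      Runs inp B (.branchIn j p) s s'
  | loopDone (r c p s) (h : c (s.reg r).head? = false) : Runs inp B (.loop r c p) s s
  | loopStep (r c p s s' send) (h : c (s.reg r).head? = true) (hp : Runs inp B p s s')
      (hl : Runs inp B (.loop r c p) s' send) : Runs inp B (.loop r c p) s send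

/-- All registers mentioned by the program are smaller than `K`. -/
def Prog.RegsLt (K : ℕ) : Prog t → Prop
  | .skip => True
  | .push r _ => r < K
  | .pop r => r < K
  | .move _ _ => True
  | .emit _ => True
  | .seq p q => p.RegsLt K ∧ q.RegsLt K
  | .branch r p => r < K ∧ ∀ o, (p o).RegsLt K
  | .branchIn _ p => ∀ o, (p o).RegsLt K
  | .loop r _ p => r < K ∧ p.RegsLt K

theorem Prog.RegsLt.mono {K K' : ℕ} (h : K ≤ K') : ∀ {p : Prog t}, p.RegsLt K → p.RegsLt K'
  | .skip, _ => trivial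
  | .push _ _, hp => lt_of_lt_of_le hp h
  | .pop _, hp => lt_of_lt_of_le hp h
  | .move _ _, _ => trivial
  | .emit _, _ => trivial
  | .seq _ _, hp => ⟨hp.1.mono h, hp.2.mono h⟩
  | .branch _ _, hp => ⟨lt_of_lt_of_le hp.1 h, fun o => (hp.2 o).mono h⟩
  | .branchIn _ _, hp => fun o => (hp o).mono h
  | .loop _ _ _, hp => ⟨lt_of_lt_of_le hp.1 h, hp.2.mono h⟩

theorem exists_common_regs (p : Option Bool → Prog t) (h : ∀ o, ∃ K, (p o).RegsLt K) :
    ∃ K, ∀ o, (p o).RegsLt K := by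
  choose f hf using h
  refine ⟨max (f none) (max (f (some false)) (f (some true))), fun o => (hf o).mono ?_⟩
  rcases o with _ | _ | _ <;> simp

theorem Prog.exists_regsLt : ∀ p : Prog t, ∃ K, p.RegsLt K
  | .skip => ⟨0, trivial⟩
  | .push r _ => ⟨r + 1, Nat.lt_succ_self r⟩
  | .pop r => ⟨r + 1, Nat.lt_succ_self r⟩
  | .move _ _ => ⟨0, trivial⟩
  | .emit _ => ⟨0, trivial⟩
  | .seq p q => by
      obtain ⟨K, hK⟩ := p.exists_regsLt
      obtain ⟨K', hK'⟩ := q.exists_regsLt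
      exact ⟨max K K', hK.mono (le_max_left _ _), hK'.mono (le_max_right _ _)⟩
  | .branch r p => by
      obtain ⟨K, hK⟩ := exists_common_regs p fun o => (p o).exists_regsLt
      exact ⟨max (r + 1) K, by simp, fun o => (hK o).mono (le_max_right _ _)⟩
  | .branchIn _ p => exists_common_regs p fun o => (p o).exists_regsLt
  | .loop r _ p => by
      obtain ⟨K, hK⟩ := p.exists_regsLt
      exact ⟨max (r + 1) K, by simp, hK.mono (le_max_right _ _)⟩

theorem Runs.mono {inp : Fin t → List Bool} {B B' : ℕ} (hB : B ≤ B') {p : Prog t} {s s' : St t}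
    (h : Runs inp B p s s') : Runs inp B' p s s' := by
  induction h with
  | skip s => exact .skip s
  | push r b s h => exact .push r b s (h.trans hB)
  | pop r s => exact .pop r s
  | move j d s => exact .move j d s
  | emit b s => exact .emit b s
  | seq p q s s' s'' _ _ ih1 ih2 => exact .seq _ _ _ _ _ ih1 ih2
  | branch r p s s' _ ih => exact .branch _ _ _ _ ih
  | branchIn j p s s' _ ih => exact .branchIn _ _ _ _ ih
  | loopDone r c p s h => exact .loopDone _ _ _ _ h
  | loopStep r c p s s' s'' h _ _ ih1 ih2 => exact .loopStep _ _ _ _ _ _ h ih1 ih2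

/-- Stack heights stay below any bound that holds initially and is at least `B`. -/
theorem Runs.length_le {inp : Fin t → List Bool} {B : ℕ} {p : Prog t} {s s' : St t}
    (h : Runs inp B p s s') : ∀ r, (s'.reg r).length ≤ max B (s.reg r).length := by
  induction h with
  | skip s => intro r; simp
  | push r b s h =>
    intro r'
    rcases eq_or_ne r' r with rfl | hr
    · simp only [Function.update_self, List.length_cons]; omega
    · simp [Function.update_of_ne hr]
  | pop r s =>
    intro r'
    rcases eq_or_ne r' r with rfl | hr
    · simp only [Function.update_self, List.length_tail]; omega
    · simp [Function.update_of_ne hr]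
  | move j d s => intro r; simp
  | emit b s => intro r; simp
  | seq p q s s' s'' _ _ ih1 ih2 => intro r; have := ih1 r; have := ih2 r; omega
  | branch r p s s' _ ih => exact ih
  | branchIn j p s s' _ ih => exact ih
  | loopDone r c p s h => intro r; simp
  | loopStep r c p s s' s'' h _ _ ih1 ih2 => intro r; have := ih1 r; have := ih2 r; omega

/-! ### Compilation of programs to machines -/

/-- A finite control with one exit, written `none`. -/
structure Ctl (t K : ℕ) where
  State : Type
  fin : Fintype State
  start : State
  δ : State → (Fin t → Option Bool) → (Fin K → Option Bool) → Action t K (Option State)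

/-- The tapes of a machine. -/
@[ext]
structure Mem (t K : ℕ) where
  inPos : Fin t → ℕ
  tape : Fin K → ℤ → Option Bool
  pos : Fin K → ℤ
  out : List Bool

variable {K : ℕ}

/-- The effect of an action on the tapes. -/
def Mem.act {S : Type} (inp : Fin t → List Bool) (m : Mem t K) (A : Action t K S) : Mem t K where
  inPos := fun i => OfflineTM.moveInput (inp i).length (A.inMove i) (m.inPos i)
  tape := fun i => Function.update (m.tape i) (m.pos i) (A.write i)
  pos := fun i => OfflineTM.moveWork (A.workMove i) (m.pos i)
  out := m.out ++ A.emit.toList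

/-- All work heads are within distance `B` of cell `0`. -/
def Mem.Bounded (B : ℕ) (m : Mem t K) : Prop := ∀ i, |m.pos i| ≤ (B : ℤ)

/-- One step of a finite control. -/
def Ctl.step (M : Ctl t K) (inp : Fin t → List Bool) :
    Option M.State × Mem t K → Option (Option M.State × Mem t K)
  | (none, _) => none
  | (some q, m) =>
    let A := M.δ q (fun i => OfflineTM.readInput (inp i) (m.inPos i)) (fun i => m.tape i (m.pos i))
    some (A.next, m.act inp A)

/-- A run of a finite control, all of whose configurations but the first are bounded. -/
def Ctl.Path (M : Ctl t K) (inp : Fin t → List Bool) (B : ℕ) :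
    Option M.State × Mem t K → Option M.State × Mem t K → Prop :=
  Relation.ReflTransGen fun x y => M.step inp x = some y ∧ y.2.Bounded B

/-- Change the successor state of an action. -/
def Action.mapNext {S S' : Type} (f : S → S') (A : Action t K S) : Action t K S' :=
  { A with next := f A.next }

/-- The map on control states that embeds a control into another one and redirects its exit. -/
def embedState {S S' : Type} (f : S → S') (e : Option S') : Option S → Option S'
  | some q => some (f q)
  | none => e

/-- Sequences, branches and loops copy the transitions of their components and change only where the
exit leads, so this transports runs of components in all three cases. -/
theorem Ctl.Path.embed {M M' : Ctl t K} {inp : Fin t → List Bool} {B : ℕ}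
    (f : M.State → M'.State) (e : Option M'.State)
    (hδ : ∀ q x y, M'.δ (f q) x y = (M.δ q x y).mapNext (embedState f e))
    {x y : Option M.State × Mem t K} (h : M.Path inp B x y) :
    M'.Path inp B (embedState f e x.1, x.2) (embedState f e y.1, y.2) := by
  refine Relation.ReflTransGen.lift
    (fun x : Option M.State × Mem t K => (embedState f e x.1, x.2)) ?_ _ _ h
  rintro ⟨_ | q, m⟩ ⟨q', m'⟩ ⟨h1, h2⟩
  · simp [Ctl.step] at h1
  · simp only [Ctl.step, Option.some.injEq, Prod.mk.injEq] at h1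
    refine ⟨?_, h2⟩
    simp only [embedState, Ctl.step, hδ, Option.some.injEq, Prod.mk.injEq]
    exact ⟨by rw [← h1.1]; rfl, by rw [← h1.2]; rfl⟩

/-- The action that changes nothing but the control state. -/
def idle {S : Type} (next : S) (y : Fin K → Option Bool) : Action t K S :=
  ⟨next, fun _ => .stay, y, fun _ => .stay, none⟩

/-- The symbol on work tape `r`. -/
def topAt (y : Fin K → Option Bool) (r : ℕ) : Option Bool := if h : r < K then y ⟨r, h⟩ else none

/-- Sequential composition of controls. -/
def Ctl.seq (M N : Ctl t K) : Ctl t K where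
  State := M.State ⊕ N.State
  fin := @instFintypeSum _ _ M.fin N.fin
  start := .inl M.start
  δ := fun
    | .inl a, x, y => (M.δ a x y).mapNext (embedState Sum.inl (some (.inr N.start)))
    | .inr a, x, y => (N.δ a x y).mapNext (embedState Sum.inr none)

/-- Branching on a symbol `f x y` that depends on the scanned symbols. -/
def Ctl.branch (f : (Fin t → Option Bool) → (Fin K → Option Bool) → Option Bool)
    (M : Option Bool → Ctl t K) : Ctl t K where
  State := Option (Σ o, (M o).State)
  fin := letI := fun o => (M o).fin; inferInstance
  start := none
  δ := fun
    | none, x, y => idle (some (some ⟨f x y, (M (f x y)).start⟩)) y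
    | some ⟨o, a⟩, x, y => ((M o).δ a x y).mapNext (embedState (fun a => some ⟨o, a⟩) none)

/-- Repetition as long as the scanned work symbols satisfy `f`. -/
def Ctl.loop (f : (Fin K → Option Bool) → Bool) (M : Ctl t K) : Ctl t K where
  State := Option M.State
  fin := @instFintypeOption _ M.fin
  start := none
  δ := fun
    | none, _, y => idle (if f y then some (some M.start) else none) y
    | some a, x, y => (M.δ a x y).mapNext (embedState some (some none))

/-- The finite control that executes a program. -/
def Prog.ctl (K : ℕ) : Prog t → Ctl t K
  | .skip => ⟨Unit, inferInstance, (), fun _ _ y => idle none y⟩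
  -- An action writes before it moves. A push therefore takes two steps: state `false` moves onto
  -- the free cell and state `true` writes there. A pop takes one step and does not move on an empty
  -- stack, whose head sees the blank cell `0`.
  | .push r b => ⟨Bool, inferInstance, false, fun q _ y =>
      if q then { idle none y with write := fun i => if i.val = r then some b else y i }
      else { idle (some true) y with workMove := fun i => if i.val = r then .right else .stay }⟩
  | .pop r => ⟨Unit, inferInstance, (), fun _ _ y =>
      { idle none y with
        write := fun i => if i.val = r then none else y i
        workMove := fun i => if i.val = r ∧ y i ≠ none then .left else .stay }⟩
  | .move j d => ⟨Unit, inferInstance, (), fun _ _ y =>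
      ⟨none, fun i => if i = j then d else .stay, y, fun _ => .stay, none⟩⟩
  | .emit b => ⟨Unit, inferInstance, (), fun _ _ y => { idle none y with emit := some b }⟩
  | .seq p q => (p.ctl K).seq (q.ctl K)
  | .branch r p => .branch (fun _ y => topAt y r) fun o => (p o).ctl K
  | .branchIn j p => .branch (fun x _ => x j) fun o => (p o).ctl K
  | .loop r c p => .loop (fun y => c (topAt y r)) (p.ctl K)

/-- The tape holding a stack: the top of a stack of height `n` is in cell `n`. -/
def stackTape : List Bool → ℤ → Option Bool
  | [] => fun _ => none
  | b :: l => Function.update (stackTape l) (l.length + 1) (some b)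

/-- Needed for popping: erasing the top cell yields the tape of the tail because that tape is blank
there. -/
theorem stackTape_of_lt : ∀ (l : List Bool) (z : ℤ), l.length < z → stackTape l z = none
  | [], _, _ => rfl
  | b :: l, z, h => by
    simp only [List.length_cons, Nat.cast_add, Nat.cast_one] at h
    rw [stackTape, Function.update_of_ne (by omega), stackTape_of_lt l z (by omega)]

theorem stackTape_length (l : List Bool) : stackTape l l.length = l.head? := by
  cases l <;> simp [stackTape]

/-- The tapes that hold the memory of a stack program. -/
def St.mem (K : ℕ) (s : St t) : Mem t K where
  inPos := s.head
  tape := fun i => stackTape (s.reg i)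
  pos := fun i => (s.reg i).length
  out := s.out

theorem St.mem_bounded {s : St t} {B : ℕ} (h : ∀ r, (s.reg r).length ≤ B) :
    (s.mem K).Bounded B := by
  intro i
  simp only [St.mem, Nat.abs_cast]
  exact_mod_cast h i

theorem topAt_mem {s : St t} {r : ℕ} (hr : r < K) :
    topAt (fun i => (s.mem K).tape i ((s.mem K).pos i)) r = (s.reg r).head? := by
  simp [topAt, hr, St.mem, stackTape_length]

theorem Mem.act_idle {S : Type} (inp : Fin t → List Bool) (m : Mem t K) (q : S) :
    m.act inp (idle q fun i => m.tape i (m.pos i)) = m := by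
  ext <;> simp [Mem.act, idle, OfflineTM.moveInput, OfflineTM.moveWork]

theorem Ctl.path_single {M : Ctl t K} {inp : Fin t → List Bool} {B : ℕ} {q : M.State}
    {m m' : Mem t K} {q' : Option M.State}
    (h : M.step inp (some q, m) = some (q', m')) (hm : m'.Bounded B) :
    M.Path inp B (some q, m) (q', m') :=
  Relation.ReflTransGen.single ⟨h, hm⟩

theorem Ctl.Path.seq {M N : Ctl t K} {inp : Fin t → List Bool} {B : ℕ} {m m' m'' : Mem t K}
    (h1 : M.Path inp B (some M.start, m) (none, m'))
    (h2 : N.Path inp B (some N.start, m') (none, m'')) :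
    (M.seq N).Path inp B (some (M.seq N).start, m) (none, m'') :=
  Relation.ReflTransGen.trans
    (h1.embed (M' := M.seq N) (fun a => (Sum.inl a : M.State ⊕ N.State))
      (some (Sum.inr N.start : M.State ⊕ N.State)) fun _ _ _ => rfl)
    (h2.embed (M' := M.seq N) (fun a => (Sum.inr a : M.State ⊕ N.State)) none fun _ _ _ => rfl)

theorem Ctl.Path.branch {f : (Fin t → Option Bool) → (Fin K → Option Bool) → Option Bool}
    {M : Option Bool → Ctl t K} {inp : Fin t → List Bool} {B : ℕ} {m m' : Mem t K}
    (o : Option Bool) (ho : f (fun i => OfflineTM.readInput (inp i) (m.inPos i))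
      (fun i => m.tape i (m.pos i)) = o) (hm : m.Bounded B)
    (h : (M o).Path inp B (some (M o).start, m) (none, m')) :
    (Ctl.branch f M).Path inp B (some (Ctl.branch f M).start, m) (none, m') := by
  subst ho
  refine Relation.ReflTransGen.trans (Ctl.path_single ?_ hm)
    (h.embed (M' := Ctl.branch f M) (fun a => (some ⟨_, a⟩ : Option (Σ o, (M o).State))) none
      fun _ _ _ => rfl)
  simp only [Ctl.step, Ctl.branch, Mem.act_idle]
  rfl

theorem Ctl.path_loop_exit {f : (Fin K → Option Bool) → Bool} {M : Ctl t K}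
    {inp : Fin t → List Bool} {B : ℕ} {m : Mem t K}
    (hf : f (fun i => m.tape i (m.pos i)) = false) (hm : m.Bounded B) :
    (Ctl.loop f M).Path inp B (some (Ctl.loop f M).start, m) (none, m) := by
  refine Ctl.path_single ?_ hm
  simp only [Ctl.step, Ctl.loop, Mem.act_idle, hf]
  rfl

theorem Ctl.Path.loop {f : (Fin K → Option Bool) → Bool} {M : Ctl t K}
    {inp : Fin t → List Bool} {B : ℕ} {m m' m'' : Mem t K}
    (hf : f (fun i => m.tape i (m.pos i)) = true) (hm : m.Bounded B)
    (h : M.Path inp B (some M.start, m) (none, m'))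
    (h' : (Ctl.loop f M).Path inp B (some (Ctl.loop f M).start, m') (none, m'')) :
    (Ctl.loop f M).Path inp B (some (Ctl.loop f M).start, m) (none, m'') := by
  refine Relation.ReflTransGen.trans (Ctl.path_single ?_ hm)
    (Relation.ReflTransGen.trans (h.embed (M' := Ctl.loop f M)
      (fun a => (some a : Option M.State)) (some (none : Option M.State)) fun _ _ _ => rfl) h')
  simp only [Ctl.step, Ctl.loop, Mem.act_idle, hf]
  rfl

/-- Induction on the derivation. The head of a stack of height `n` is on cell `n`, so heights are
head positions, and `Runs.length_le` hands their bound on from one subprogram to the next. -/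
theorem Runs.path {inp : Fin t → List Bool} {B : ℕ} {p : Prog t} {s s' : St t}
    (h : Runs inp B p s s') (hp : p.RegsLt K) (hs : ∀ r, (s.reg r).length ≤ B) :
    (p.ctl K).Path inp B (some (p.ctl K).start, s.mem K) (none, s'.mem K) := by
  induction h with
  | skip s =>
    exact Ctl.path_single (by simp only [Ctl.step, Prog.ctl, Mem.act_idle]; rfl) (St.mem_bounded hs)
  | push r b s h =>
    have hl : ∀ r', ((Function.update s.reg r (b :: s.reg r)) r').length ≤ B := by
      intro r'
      rcases eq_or_ne r' r with rfl | hr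
      · simpa using h
      · simpa [Function.update_of_ne hr] using hs r'
    -- The configuration between the two steps of a push: the head has moved up and nothing has been
    -- written yet.
    let m : Mem t K := { s.mem K with
      pos := fun i => (s.reg i).length + if i.val = r then 1 else 0 }
    have hm : m.Bounded B := by
      intro i
      simp only [m]
      have := hs i
      split_ifs with h1
      · rw [h1]; rw [abs_of_nonneg (by omega)]; exact_mod_cast h
      · simpa using this
    refine Relation.ReflTransGen.trans (b := (some true, m)) (Ctl.path_single ?_ hm)
      (Ctl.path_single ?_ (St.mem_bounded hl))
    · simp only [Ctl.step, Prog.ctl, Option.some.injEq, Prod.mk.injEq]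
      refine ⟨rfl, ?_⟩
      ext i <;> simp [Mem.act, idle, OfflineTM.moveInput, m, St.mem]
      split_ifs <;> simp [OfflineTM.moveWork]
    · simp only [Ctl.step, Prog.ctl, Option.some.injEq, Prod.mk.injEq]
      refine ⟨rfl, ?_⟩
      ext i z <;> simp only [Mem.act, idle, OfflineTM.moveInput, m, St.mem, if_true,
        OfflineTM.moveWork, Option.toList, List.append_nil]
      · rcases eq_or_ne i.val r with h1 | h1
        · simp [h1, stackTape]
        · simp [h1]
      · rcases eq_or_ne i.val r with h1 | h1
        · simp [h1]
        · simp [h1]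
  | pop r s =>
    have hl : ∀ r', ((Function.update s.reg r (s.reg r).tail) r').length ≤ B := by
      intro r'
      rcases eq_or_ne r' r with rfl | hr
      · simp only [Function.update_self, List.length_tail]; have := hs r'; omega
      · simpa [Function.update_of_ne hr] using hs r'
    refine Ctl.path_single ?_ (St.mem_bounded hl)
    simp only [Ctl.step, Prog.ctl, Option.some.injEq, Prod.mk.injEq]
    refine ⟨rfl, ?_⟩
    ext i z <;> simp only [Mem.act, idle, OfflineTM.moveInput, St.mem,
        OfflineTM.moveWork, Option.toList, List.append_nil]
    · rcases eq_or_ne i.val r with h1 | h1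
      · simp only [h1, if_true, Function.update_self]
        cases hreg : s.reg r with
        | nil => simp [stackTape]
        | cons c l =>
          have := stackTape_of_lt l (l.length + 1) (by omega)
          simp [stackTape, ← this]
      · simp [h1]
    · rcases eq_or_ne i.val r with h1 | h1
      · simp only [h1, Function.update_self, stackTape_length]
        cases hreg : s.reg r with
        | nil => simp
        | cons c l => simp
      · simp [h1]
  | move j d s =>
    refine Ctl.path_single ?_ (St.mem_bounded hs)
    simp only [Ctl.step, Prog.ctl, Option.some.injEq, Prod.mk.injEq]
    refine ⟨trivial, ?_⟩
    ext i <;> simp [Mem.act, St.mem, OfflineTM.moveWork]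
    rcases eq_or_ne i j with rfl | h1
    · simp
    · simp [h1, OfflineTM.moveInput]
  | emit b s =>
    refine Ctl.path_single ?_ (St.mem_bounded hs)
    simp only [Ctl.step, Prog.ctl, Option.some.injEq, Prod.mk.injEq]
    refine ⟨rfl, ?_⟩
    ext i <;> simp [Mem.act, idle, St.mem, OfflineTM.moveWork, OfflineTM.moveInput]
  | seq p q s s' s'' h1 _ ih1 ih2 =>
    exact (ih1 hp.1 hs).seq
      (ih2 hp.2 fun r => (h1.length_le r).trans (max_le le_rfl (hs r)))
  | branch r p s s' _ ih =>
    exact Ctl.Path.branch _ (topAt_mem hp.1) (St.mem_bounded hs) (ih (hp.2 _) hs)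
  | branchIn j p s s' _ ih =>
    exact Ctl.Path.branch _ rfl (St.mem_bounded hs) (ih (hp _) hs)
  | loopDone r c p s h =>
    exact Ctl.path_loop_exit (by rw [topAt_mem hp.1, h]) (St.mem_bounded hs)
  | loopStep r c p s s' s'' h h1 _ ih1 ih2 =>
    exact Ctl.Path.loop (by rw [topAt_mem hp.1, h]) (St.mem_bounded hs) (ih1 hp.2 hs)
      (ih2 hp fun r => (h1.length_le r).trans (max_le le_rfl (hs r)))

/-- The machine with a given finite control. -/
def Ctl.toTM (M : Ctl t K) : OfflineTM t where
  k := K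
  State := Option M.State
  fin := @instFintypeOption _ M.fin
  start := some M.start
  δ := fun q x y => q.map fun q => M.δ q x y

/-- Configurations of `M.toTM` as pairs. -/
def Ctl.cfg (M : Ctl t K) (x : Option M.State × Mem t K) : M.toTM.Cfg :=
  ⟨x.1, x.2.inPos, x.2.tape, x.2.pos, x.2.out⟩

theorem Ctl.step_cfg (M : Ctl t K) (inp : Fin t → List Bool) (x : Option M.State × Mem t K) :
    M.toTM.step inp (M.cfg x) = (M.step inp x).map M.cfg := by
  rcases x with ⟨_ | q, m⟩ <;> rfl

/-- The machine is deterministic, so every configuration reachable from the initial one lies on the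
given path and inherits its bound. -/
theorem Ctl.Path.outputsInSpace {M : Ctl t K} {inp : Fin t → List Bool} {B : ℕ} {m : Mem t K}
    (h : M.Path inp B (some M.start, (⟨fun _ => [], fun _ => 0, []⟩ : St t).mem K) (none, m)) :
    M.toTM.OutputsInSpace inp m.out B := by
  have key : ∀ x : Option M.State × Mem t K, x.2.Bounded B → M.Path inp B x (none, m) →
      StateTransition.Reaches (M.toTM.step inp) (M.cfg x) (M.cfg (none, m)) ∧
      ∀ c, StateTransition.Reaches (M.toTM.step inp) (M.cfg x) c → ∀ i, |c.pos i| ≤ (B : ℤ) := by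
    intro x hx hp
    induction hp using Relation.ReflTransGen.head_induction_on with
    | refl =>
      refine ⟨.refl, fun c hc => ?_⟩
      rcases Relation.ReflTransGen.cases_head hc with rfl | ⟨d, hd, -⟩
      · exact hx
      · rw [Ctl.step_cfg] at hd; simp [Ctl.step] at hd
    | @head x y h1 _ ih =>
      obtain ⟨ih1, ih2⟩ := ih h1.2
      have hstep : M.toTM.step inp (M.cfg x) = some (M.cfg y) := by
        rw [Ctl.step_cfg, h1.1]; rfl
      refine ⟨.head hstep ih1, fun c hc => ?_⟩
      rcases Relation.ReflTransGen.cases_head hc with rfl | ⟨d, hd, hdc⟩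
      · exact hx
      · have : d = M.cfg y := Option.mem_unique hd hstep
        exact ih2 c (this ▸ hdc)
  obtain ⟨h1, h2⟩ := key _ (St.mem_bounded (by simp)) h
  have hinit : M.toTM.init = M.cfg (some M.start,
      (⟨fun _ => [], fun _ => 0, []⟩ : St t).mem K) := rfl
  refine ⟨⟨M.cfg (none, m), ?_, rfl⟩, hinit ▸ h2⟩
  rw [StateTransition.mem_eval, hinit]
  exact ⟨h1, rfl⟩

/-- A program that runs in space `O(b)` gives a machine. -/
theorem ComputableInSpace.of_runs {ι : Type} {inp : ι → Fin t → List Bool} {out : ι → List Bool}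
    {b : ι → ℕ} (p : Prog t) (C : ℕ)
    (h : ∀ i, ∃ s : St t, Runs (inp i) (C * (b i + 1)) p ⟨fun _ => [], fun _ => 0, []⟩ s ∧
      s.out = out i) : ComputableInSpace inp out b := by
  obtain ⟨K, hK⟩ := p.exists_regsLt
  refine ⟨(p.ctl K).toTM, C, fun i => ?_⟩
  obtain ⟨s, hs, ho⟩ := h i
  rw [← ho]
  exact (hs.path hK (by simp)).outputsInSpace

/-! ### Numbers on stacks -/

/-- The successor in bijective base 2 (digits `false = 1` and `true = 2`, least significant
first). -/
def incL : List Bool → List Bool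
  | [] => [false]
  | false :: l => true :: l
  | true :: l => false :: incL l

/-- The predecessor in bijective base 2. -/
def decL : List Bool → List Bool
  | [] => []
  | true :: l => false :: l
  | false :: l => if l = [] then [] else true :: decL l

/-- The value of a string in bijective base 2. -/
def valL : List Bool → ℕ
  | [] => 0
  | false :: l => 2 * valL l + 1
  | true :: l => 2 * valL l + 2

/-- A number in bijective base 2. -/
def enc : ℕ → List Bool
  | 0 => []
  | n + 1 => incL (enc n)

theorem incL_ne_nil (l : List Bool) : incL l ≠ [] := by
  rcases l with _ | ⟨_ | _, l⟩ <;> simp [incL]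

theorem decL_incL : ∀ l, decL (incL l) = l
  | [] => rfl
  | false :: l => rfl
  | true :: l => by simp [incL, decL, incL_ne_nil, decL_incL l]

theorem decL_enc (n : ℕ) : decL (enc n) = enc (n - 1) := by
  cases n with
  | zero => rfl
  | succ n => simp [enc, decL_incL]

/-- The reason for bijective base 2: representations are unique, zero is the empty stack, and
testing for zero is testing for emptiness. -/
theorem enc_eq_nil {n : ℕ} : enc n = [] ↔ n = 0 := by
  cases n with
  | zero => simp [enc]
  | succ n => simp [enc, incL_ne_nil]

theorem valL_incL : ∀ l, valL (incL l) = valL l + 1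
  | [] => rfl
  | false :: l => rfl
  | true :: l => by simp only [incL, valL, valL_incL l]; ring

theorem valL_enc (n : ℕ) : valL (enc n) = n := by
  induction n with
  | zero => rfl
  | succ n ih => rw [enc, valL_incL, ih]

/-- The smallest value of a string of length `n` is `2 ^ n - 1`, all digits being 1. This turns
bounds on numbers into bounds on space. -/
theorem two_pow_length_le : ∀ l : List Bool, 2 ^ l.length ≤ valL l + 1
  | [] => le_rfl
  | false :: l => by have := two_pow_length_le l; simp only [List.length_cons, valL, pow_succ]; omega
  | true :: l => by have := two_pow_length_le l; simp only [List.length_cons, valL, pow_succ]; omega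

theorem length_enc_le {n B : ℕ} (h : n ≤ 2 ^ B) : (enc n).length ≤ B + 1 := by
  have h1 := two_pow_length_le (enc n)
  rw [valL_enc] at h1
  by_contra h2
  have : 2 ^ (B + 2) ≤ 2 ^ (enc n).length := Nat.pow_le_pow_right (by norm_num) (by omega)
  have h3 : 1 ≤ 2 ^ B := Nat.one_le_two_pow
  rw [pow_add] at this
  omega

/-! ### Programs for registers -/

variable {t : ℕ}

/-- Replace the contents of a register. -/
def St.set (s : St t) (r : ℕ) (l : List Bool) : St t := { s with reg := Function.update s.reg r l }

@[simp] theorem St.set_reg (s : St t) (r : ℕ) (l : List Bool) (r' : ℕ) :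
    (s.set r l).reg r' = if r' = r then l else s.reg r' := by
  simp [St.set, Function.update_apply]

@[simp] theorem St.set_head (s : St t) (r : ℕ) (l : List Bool) : (s.set r l).head = s.head := rfl

@[simp] theorem St.set_out (s : St t) (r : ℕ) (l : List Bool) : (s.set r l).out = s.out := rfl

theorem St.ext_reg {s s' : St t} (h1 : ∀ r, s.reg r = s'.reg r) (h2 : s.head = s'.head)
    (h3 : s.out = s'.out) : s = s' := St.ext (funext h1) h2 h3

theorem St.set_eq_self {s : St t} {r : ℕ} {l : List Bool} (h : s.reg r = l) : s.set r l = s :=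
  St.ext_reg (fun r' => by rw [St.set_reg]; split_ifs with h1 <;> simp_all) rfl rfl

section

variable {inp : Fin t → List Bool} {B : ℕ}

theorem Runs.push' {r : ℕ} {b : Bool} {s s' : St t} (h : (s.reg r).length + 1 ≤ B)
    (hs : s' = s.set r (b :: s.reg r)) : Runs inp B (.push r b) s s' := hs ▸ Runs.push r b s h

theorem Runs.pop' {r : ℕ} {s s' : St t} (hs : s' = s.set r (s.reg r).tail) :
    Runs inp B (.pop r) s s' := hs ▸ Runs.pop r s

theorem Runs.cast {p : Prog t} {s s' s'' : St t} (h : Runs inp B p s s') (e : s' = s'') :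
    Runs inp B p s s'' := e ▸ h

/-- Empty a register. -/
def Prog.clear (r : ℕ) : Prog t := .loop r Option.isSome (.pop r)

theorem Runs.clear (r : ℕ) (s : St t) : Runs inp B (.clear r) s (s.set r []) := by
  induction h : s.reg r generalizing s with
  | nil => rw [St.set_eq_self h]; exact .loopDone _ _ _ _ (by simp [h])
  | cons b l ih =>
    refine .loopStep _ _ _ _ (s.set r l) _ (by simp [h]) (.pop' (by simp [h])) ?_
    refine (ih (s.set r l) (by simp)).cast (St.ext_reg (fun r' => ?_) rfl rfl)
    simp only [St.set_reg]; split_ifs <;> rfl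

/-- Move the contents of a register to another one, reversing their order. -/
def Prog.pour (a b : ℕ) : Prog t :=
  .loop a Option.isSome (.seq (.branch a fun o => .push b (o.getD false)) (.pop a))

theorem Runs.pour {a b : ℕ} (hab : a ≠ b) (s : St t)
    (hB : (s.reg a).length + (s.reg b).length ≤ B) :
    Runs inp B (.pour a b) s ((s.set a []).set b ((s.reg a).reverse ++ s.reg b)) := by
  induction h : s.reg a generalizing s with
  | nil =>
    refine (Runs.loopDone a _ _ s (by simp [h])).cast (St.ext_reg (fun r => ?_) rfl rfl)
    simp only [St.set_reg]; split_ifs <;> simp_all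
  | cons x l ih =>
    rw [h, List.length_cons] at hB
    refine .loopStep _ _ _ _ ((s.set b (x :: s.reg b)).set a l) _ (by simp [h])
      (.seq _ _ _ (s.set b (x :: s.reg b)) _ (.branch _ _ _ _ (.push' (by omega) ?_)) (.pop' ?_)) ?_
    · simp [h]
    · simp [hab, h]
    · refine (ih ((s.set b (x :: s.reg b)).set a l) ?_ (by simp)).cast
        (St.ext_reg (fun r => ?_) rfl rfl)
      · simp [Ne.symm hab]; omega
      · simp only [St.set_reg, if_neg (Ne.symm hab)]
        split_ifs <;> simp_all

/-- Replace register `b` by register `a` and empty `a`, using the empty register `u`. -/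
def Prog.transfer (a b u : ℕ) : Prog t := .seq (.clear b) (.seq (.pour a u) (.pour u b))

theorem Runs.transfer {a b u : ℕ} (hab : a ≠ b) (hau : a ≠ u) (hbu : b ≠ u) (s : St t)
    (hu : s.reg u = []) (hB : (s.reg a).length ≤ B) :
    Runs inp B (.transfer a b u) s ((s.set b (s.reg a)).set a []) := by
  refine .seq _ _ _ _ _ (Runs.clear b s) (.seq _ _ _ _ _ (Runs.pour hau _ ?_)
    ((Runs.pour hbu.symm _ ?_).cast (St.ext_reg (fun r => ?_) rfl rfl)))
  · simp [hab, hbu.symm, hu, hB]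
  · simp [hab, hbu, hbu.symm, hab.symm, hu, hB]
  · simp only [St.set_reg, if_neg hab, if_neg hbu.symm, hu, if_neg hbu, if_neg hab.symm]
    by_cases h1 : r = b <;> by_cases h2 : r = u <;> by_cases h3 : r = a <;>
      simp_all

/-- Move register `u` to both `a` and `b`, reversing the order. -/
def Prog.pour₂ (u a b : ℕ) : Prog t :=
  .loop u Option.isSome (.seq (.branch u fun o => .push a (o.getD false))
    (.seq (.branch u fun o => .push b (o.getD false)) (.pop u)))

theorem Runs.pour₂ {u a b : ℕ} (hua : u ≠ a) (hub : u ≠ b) (hab : a ≠ b) (s : St t)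
    (hA : (s.reg u).length + (s.reg a).length ≤ B)
    (hB : (s.reg u).length + (s.reg b).length ≤ B) :
    Runs inp B (.pour₂ u a b) s (((s.set u []).set a ((s.reg u).reverse ++ s.reg a)).set b
      ((s.reg u).reverse ++ s.reg b)) := by
  induction h : s.reg u generalizing s with
  | nil =>
    refine (Runs.loopDone u _ _ s (by simp [h])).cast (St.ext_reg (fun r => ?_) rfl rfl)
    simp only [St.set_reg]; split_ifs <;> simp_all
  | cons x l ih =>
    rw [h, List.length_cons] at hB hA
    refine .loopStep _ _ _ _ (((s.set a (x :: s.reg a)).set b (x :: s.reg b)).set u l) _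
      (by simp [h])
      (.seq _ _ _ (s.set a (x :: s.reg a)) _ (.branch _ _ _ _ (.push' (by omega) ?_))
        (.seq _ _ _ ((s.set a (x :: s.reg a)).set b (x :: s.reg b)) _
          (.branch _ _ _ _ (.push' ?_ ?_)) (.pop' ?_))) ?_
    · simp [h]
    · simp [hab.symm]; omega
    · simp [h, hab.symm, hua]
    · simp [hua, hub, h]
    · refine (ih (((s.set a (x :: s.reg a)).set b (x :: s.reg b)).set u l) ?_ ?_ (by simp)).cast
        (St.ext_reg (fun r => ?_) rfl rfl)
      · simp [hua.symm, hab]; omega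
      · simp [hub.symm]; omega
      · simp only [St.set_reg, if_neg hua.symm, if_neg hub.symm, if_neg hab]
        split_ifs <;> simp_all

/-- Replace register `b` by register `a`, using the empty register `u`. -/
def Prog.copy (a b u : ℕ) : Prog t := .seq (.clear b) (.seq (.pour a u) (.pour₂ u a b))

theorem Runs.copy {a b u : ℕ} (hab : a ≠ b) (hau : a ≠ u) (hbu : b ≠ u) (s : St t)
    (hu : s.reg u = []) (hB : (s.reg a).length ≤ B) :
    Runs inp B (.copy a b u) s (s.set b (s.reg a)) := by
  refine .seq _ _ _ _ _ (Runs.clear b s) (.seq _ _ _ _ _ (Runs.pour hau _ ?_)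
    ((Runs.pour₂ hau.symm hbu.symm hab _ ?_ ?_).cast (St.ext_reg (fun r => ?_) rfl rfl)))
  · simp [hab, hbu.symm, hu, hB]
  · simp [hab, hau, hbu.symm, hu, hB]
  · simp [hab, hbu, hbu.symm, hab.symm, hu, hB]
  · simp only [St.set_reg, if_neg hab, if_neg hau, if_neg hbu.symm, hu, if_neg hbu,
      if_neg hab.symm]
    by_cases h1 : r = b <;> by_cases h2 : r = u <;> by_cases h3 : r = a <;>
      simp_all

/-- Add one to register `r`, using the empty register `u`. -/
def Prog.inc (r u : ℕ) : Prog t :=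
  .seq (.loop r (· == some true) (.seq (.push u false) (.pop r)))
    (.seq (.branch r fun o => if o = none then .push r false else .seq (.pop r) (.push r true))
      (.pour u r))

theorem Runs.inc {r u : ℕ} (hru : r ≠ u) (s : St t) (hu : s.reg u = [])
    (hB : (s.reg r).length + 1 ≤ B) :
    Runs inp B (.inc r u) s (s.set r (incL (s.reg r))) := by
  suffices H : ∀ (l : List Bool) (n : ℕ), l.length + n + 1 ≤ B →
      Runs inp B (.inc r u) ((s.set r l).set u (List.replicate n false))
        (s.set r (List.replicate n false ++ incL l)) by
    have := H (s.reg r) 0 (by simpa using hB)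
    rwa [List.replicate_zero, List.nil_append, St.set_eq_self (r := r) rfl,
      St.set_eq_self hu] at this
  intro l
  have fin : ∀ (n : ℕ) (l' : List Bool), l'.length + n ≤ B → Runs inp B (.pour u r)
      ((s.set r l').set u (List.replicate n false))
      (s.set r (List.replicate n false ++ l')) := by
    intro n l' h
    refine (Runs.pour hru.symm _ (by simp [hru]; omega)).cast (St.ext_reg (fun x => ?_) rfl rfl)
    simp only [St.set_reg, if_neg hru]
    split_ifs <;> simp_all
  induction l with
  | nil =>
    intro n hn
    refine .seq _ _ _ _ _ (.loopDone _ _ _ _ (by simp [hru]))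
      (.seq _ _ _ ((s.set r [false]).set u (List.replicate n false)) _
        (.branch _ _ _ _ ?_) (fin n [false] (by simpa [add_comm] using hn)))
    simp only [St.set_reg, if_neg hru, List.head?_nil, if_true]
    refine .push' (by simp [hru]; omega) (St.ext_reg (fun x => ?_) rfl rfl)
    simp only [St.set_reg, if_neg hru]
    split_ifs <;> simp_all
  | cons b l ih =>
    intro n hn
    rw [List.length_cons] at hn
    cases b with
    | false =>
      refine .seq _ _ _ _ _ (.loopDone _ _ _ _ (by simp [hru]))
        (.seq _ _ _ ((s.set r (true :: l)).set u (List.replicate n false)) _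
          (.branch _ _ _ _ ?_) (fin n (true :: l) (by simp; omega)))
      simp only [St.set_reg, if_neg hru, if_true, List.head?_cons, reduceCtorEq, if_false]
      refine .seq _ _ _ ((s.set r l).set u (List.replicate n false)) _
        (.pop' (St.ext_reg (fun x => ?_) rfl rfl))
        (.push' (by simp [hru]; omega) (St.ext_reg (fun x => ?_) rfl rfl))
      all_goals
        simp only [St.set_reg, if_neg hru]
        split_ifs <;> simp_all
    | true =>
      have h1 := ih (n + 1) (by omega)
      have e : List.replicate (n + 1) false ++ incL l = List.replicate n false ++ incL (true :: l) := by
        rw [incL, List.replicate_succ', List.append_assoc]; rfl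
      rw [e] at h1
      -- The induction hypothesis gives a run of the whole program; one more round is put in front
      -- of its loop.
      cases h1 with
      | seq _ _ _ s' _ hp hq =>
      refine .seq _ _ _ s' _ (.loopStep _ _ _ _ ((s.set r l).set u (List.replicate (n + 1) false)) _
        (by simp [hru]) (.seq _ _ _ ((s.set r (true :: l)).set u (List.replicate (n + 1) false)) _
          (.push' (by simp; omega) (St.ext_reg (fun x => ?_) rfl rfl))
          (.pop' (St.ext_reg (fun x => ?_) rfl rfl))) hp) hq
      all_goals
        simp only [St.set_reg, if_neg hru]
        split_ifs <;> simp_all [List.replicate_succ]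

/-- Subtract one from register `r`, using the empty register `u`. -/
def Prog.dec (r u : ℕ) : Prog t :=
  .seq (.loop r (· == some false) (.seq (.push u true) (.pop r)))
    (.seq (.branch r fun o => if o = none then .pop u else .seq (.pop r) (.push r false))
      (.pour u r))

theorem Runs.dec {r u : ℕ} (hru : r ≠ u) (s : St t) (hu : s.reg u = [])
    (hB : (s.reg r).length ≤ B) :
    Runs inp B (.dec r u) s (s.set r (decL (s.reg r))) := by
  suffices H : ∀ (l : List Bool) (n : ℕ), l.length + n ≤ B →
      Runs inp B (.dec r u) ((s.set r l).set u (List.replicate n true))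
        (s.set r (if l = [] then List.replicate (n - 1) true else
          List.replicate n true ++ decL l)) by
    have := H (s.reg r) 0 (by simpa using hB)
    rw [List.replicate_zero, List.nil_append, St.set_eq_self (r := r) rfl,
      St.set_eq_self hu] at this
    refine this.cast ?_
    split_ifs with h
    · rw [h]; rfl
    · rfl
  intro l
  have fin : ∀ (n : ℕ) (l' : List Bool), l'.length + n ≤ B → Runs inp B (.pour u r)
      ((s.set r l').set u (List.replicate n true))
      (s.set r (List.replicate n true ++ l')) := by
    intro n l' h
    refine (Runs.pour hru.symm _ (by simp [hru]; omega)).cast (St.ext_reg (fun x => ?_) rfl rfl)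
    simp only [St.set_reg, if_neg hru]
    split_ifs <;> simp_all
  induction l with
  | nil =>
    intro n hn
    refine .seq _ _ _ _ _ (.loopDone _ _ _ _ (by simp [hru]))
      (.seq _ _ _ ((s.set r []).set u (List.replicate (n - 1) true)) _
        (.branch _ _ _ _ ?_) ((fin (n - 1) [] (by simp at hn ⊢; omega)).cast (by simp)))
    simp only [St.set_reg, if_neg hru, List.head?_nil, if_true]
    refine .pop' (St.ext_reg (fun x => ?_) rfl rfl)
    simp only [St.set_reg]
    split_ifs <;> simp_all
  | cons b l ih =>
    intro n hn
    rw [List.length_cons] at hn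
    cases b with
    | true =>
      refine .seq _ _ _ _ _ (.loopDone _ _ _ _ (by simp [hru]))
        (.seq _ _ _ ((s.set r (false :: l)).set u (List.replicate n true)) _
          (.branch _ _ _ _ ?_) ((fin n (false :: l) (by simp; omega)).cast (by simp [decL])))
      simp only [St.set_reg, if_neg hru, if_true, List.head?_cons, reduceCtorEq, if_false]
      refine .seq _ _ _ ((s.set r l).set u (List.replicate n true)) _
        (.pop' (St.ext_reg (fun x => ?_) rfl rfl))
        (.push' (by simp [hru]; omega) (St.ext_reg (fun x => ?_) rfl rfl))
      all_goals
        simp only [St.set_reg, if_neg hru]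
        split_ifs <;> simp_all
    | false =>
      have h1 := ih (n + 1) (by omega)
      have e : (if l = [] then List.replicate (n + 1 - 1) true else
          List.replicate (n + 1) true ++ decL l) =
          List.replicate n true ++ decL (false :: l) := by
        rw [decL]
        split_ifs
        · simp
        · rw [List.replicate_succ', List.append_assoc]; rfl
      rw [e] at h1
      rw [if_neg (List.cons_ne_nil _ _)]
      cases h1 with
      | seq _ _ _ s' _ hp hq =>
      refine .seq _ _ _ s' _ (.loopStep _ _ _ _ ((s.set r l).set u (List.replicate (n + 1) true)) _
        (by simp [hru]) (.seq _ _ _ ((s.set r (false :: l)).set u (List.replicate (n + 1) true)) _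
          (.push' (by simp; omega) (St.ext_reg (fun x => ?_) rfl rfl))
          (.pop' (St.ext_reg (fun x => ?_) rfl rfl))) hp) hq
      all_goals
        simp only [St.set_reg, if_neg hru]
        split_ifs <;> simp_all [List.replicate_succ]

end

/-! ### Functions that are implementable in bounded space -/

variable {t : ℕ}

/-- A context: for each index an input and a space bound, and a set of functions whose values are
held in registers. -/
structure Ctx (t : ℕ) (Γ : Type) where
  inp : Γ → Fin t → List Bool
  b : Γ → ℕ
  K : Set (Γ → ℕ)

variable {Γ Γ' Γ'' : Type}

/-- `f` is bounded by `2 ^ O(b)`. -/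
def Bdd (c : Ctx t Γ) (f : Γ → ℕ) : Prop := ∃ C, ∀ γ, f γ ≤ 2 ^ (C * (c.b γ + 1))

/-- The values of the known functions at `γ` are in the registers assigned by `a`, the registers
from `N` on are empty, and all input heads are in their initial position. -/
structure Ctx.Ready (c : Ctx t Γ) (a : (Γ → ℕ) → ℕ) (N : ℕ) (γ : Γ) (s : St t) : Prop where
  known : ∀ g ∈ c.K, s.reg (a g) = enc (g γ)
  empty : ∀ r, N ≤ r → s.reg r = []
  head : s.head = fun _ => 0

/-- A program computes `f` into register `o`, whatever the register assignment. -/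
def Impl (c : Ctx t Γ) (f : Γ → ℕ) : Prop :=
  Bdd c f ∧ ∀ (a : (Γ → ℕ) → ℕ) (N o : ℕ), (∀ g ∈ c.K, a g < N) → o < N →
    ∃ (p : Prog t) (C : ℕ), ∀ γ s, c.Ready a N γ s →
      Runs (c.inp γ) (C * (c.b γ + 1)) p s (s.set o (enc (f γ)))

/-- `c'` extends `c` along the index map `π`. -/
structure Ctx.Ext (c' : Ctx t Γ') (c : Ctx t Γ) (π : Γ' → Γ) : Prop where
  inp : ∀ x, c'.inp x = c.inp (π x)
  b : ∀ x, c'.b x = c.b (π x)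
  K : ∀ g ∈ c.K, (fun x => g (π x)) ∈ c'.K

theorem Ctx.Ext.refl (c : Ctx t Γ) : c.Ext c id := ⟨fun _ => rfl, fun _ => rfl, fun _ h => h⟩

theorem Ctx.Ext.trans {c'' : Ctx t Γ''} {c' : Ctx t Γ'} {c : Ctx t Γ} {π' : Γ'' → Γ'} {π : Γ' → Γ}
    (h' : c''.Ext c' π') (h : c'.Ext c π) : c''.Ext c fun x => π (π' x) :=
  ⟨fun x => (h'.inp x).trans (h.inp _), fun x => (h'.b x).trans (h.b _),
    fun g hg => h'.K _ (h.K g hg)⟩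

theorem Bdd.ext {c : Ctx t Γ} {f : Γ → ℕ} (h : Bdd c f) {c' : Ctx t Γ'} {π : Γ' → Γ}
    (e : c'.Ext c π) : Bdd c' fun x => f (π x) := by
  obtain ⟨C, hC⟩ := h
  exact ⟨C, fun x => by rw [e.b]; exact hC _⟩

/-- A register assignment for the larger context restricts to one for the smaller. Loop bodies and
branches live in extended contexts, and this makes everything computable outside available inside.
-/
theorem Impl.ext {c : Ctx t Γ} {f : Γ → ℕ} (h : Impl c f) {c' : Ctx t Γ'} {π : Γ' → Γ}
    (e : c'.Ext c π) : Impl c' fun x => f (π x) := by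
  refine ⟨h.1.ext e, fun a N o ha ho => ?_⟩
  obtain ⟨p, C, hp⟩ := h.2 (fun g => a fun x => g (π x)) N o (fun g hg => ha _ (e.K g hg)) ho
  refine ⟨p, C, fun x s hs => ?_⟩
  rw [e.inp, e.b]
  exact hp (π x) s ⟨fun g hg => hs.known _ (e.K g hg), hs.empty, hs.head⟩

theorem Impl.bdd {c : Ctx t Γ} {f : Γ → ℕ} (h : Impl c f) : Bdd c f := h.1

theorem Impl.congr {c : Ctx t Γ} {f g : Γ → ℕ} (h : Impl c f) (e : ∀ γ, g γ = f γ) : Impl c g := by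
  rwa [funext e]

/-- The context obtained by pulling back along `π` and adding known functions. -/
def Ctx.pull (c : Ctx t Γ) (π : Γ' → Γ) (K : Set (Γ' → ℕ)) : Ctx t Γ' where
  inp := fun x => c.inp (π x)
  b := fun x => c.b (π x)
  K := (fun g x => g (π x)) '' c.K ∪ K

theorem Ctx.pull_ext (c : Ctx t Γ) (π : Γ' → Γ) (K : Set (Γ' → ℕ)) : (c.pull π K).Ext c π :=
  ⟨fun _ => rfl, fun _ => rfl, fun g hg => Or.inl ⟨g, hg, rfl⟩⟩

/-- Different known functions may become equal after pulling back, or equal to an added one. Their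
registers then hold the same value, so any of them may be chosen. -/
theorem Ctx.exists_assignment (c : Ctx t Γ) (π : Γ' → Γ) (K : Set (Γ' → ℕ)) (a : (Γ → ℕ) → ℕ)
    (a₁ : (Γ' → ℕ) → ℕ) (N : ℕ) (ha : ∀ g ∈ c.K, a g < N) (ha₁ : ∀ g ∈ K, a₁ g < N) :
    ∃ a' : (Γ' → ℕ) → ℕ, (∀ g ∈ (c.pull π K).K, a' g < N) ∧
      ∀ x (s : St t), (∀ g ∈ c.K, s.reg (a g) = enc (g (π x))) →
        (∀ g ∈ K, s.reg (a₁ g) = enc (g x)) → ∀ g ∈ (c.pull π K).K, s.reg (a' g) = enc (g x) := by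
  classical
  refine ⟨fun h => if H : ∃ g ∈ c.K, (fun x => g (π x)) = h then a H.choose else a₁ h, ?_, ?_⟩
  · rintro g hg
    by_cases H : ∃ f ∈ c.K, (fun x => f (π x)) = g
    · simp only [H, dif_pos]; exact ha _ H.choose_spec.1
    · simp only [H, dif_neg, not_false_eq_true]
      exact ha₁ _ (hg.resolve_left H)
  · intro x s h1 h2 g hg
    by_cases H : ∃ f ∈ c.K, (fun x => f (π x)) = g
    · simp only [H, dif_pos]
      rw [h1 _ H.choose_spec.1]
      exact congrArg enc (congrFun H.choose_spec.2 x)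
    · simp only [H, dif_neg, not_false_eq_true]
      exact h2 _ (hg.resolve_left H)

section

variable {c : Ctx t Γ} {f g : Γ → ℕ}

theorem Ctx.Ready.mono {a : (Γ → ℕ) → ℕ} {N N' : ℕ} {γ : Γ} {s : St t} (h : c.Ready a N γ s)
    (hN : N ≤ N') : c.Ready a N' γ s :=
  ⟨h.known, fun r hr => h.empty r (hN.trans hr), h.head⟩

/-! #### Bounds -/

theorem Bdd.mono (h : Bdd c f) (hg : ∀ γ, g γ ≤ f γ) : Bdd c g := by
  obtain ⟨C, hC⟩ := h
  exact ⟨C, fun γ => (hg γ).trans (hC γ)⟩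

theorem bdd_const (c : Ctx t Γ) (n : ℕ) : Bdd c fun _ => n := by
  refine ⟨n, fun γ => n.lt_two_pow_self.le.trans (Nat.pow_le_pow_right (by norm_num) ?_)⟩
  exact Nat.le_mul_of_pos_right _ (Nat.succ_pos _)

theorem Bdd.mul (hf : Bdd c f) (hg : Bdd c g) : Bdd c fun γ => f γ * g γ := by
  obtain ⟨C, hC⟩ := hf
  obtain ⟨D, hD⟩ := hg
  refine ⟨C + D, fun γ => ?_⟩
  rw [add_mul, pow_add]
  exact Nat.mul_le_mul (hC γ) (hD γ)

theorem Bdd.add (hf : Bdd c f) (hg : Bdd c g) : Bdd c fun γ => f γ + g γ := by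
  obtain ⟨C, hC⟩ := hf
  obtain ⟨D, hD⟩ := hg
  refine ⟨C + D + 1, fun γ => ?_⟩
  have h1 : 2 ^ (C * (c.b γ + 1)) ≤ 2 ^ ((C + D) * (c.b γ + 1)) :=
    Nat.pow_le_pow_right (by norm_num) (Nat.mul_le_mul_right _ (by omega))
  have h2 : 2 ^ (D * (c.b γ + 1)) ≤ 2 ^ ((C + D) * (c.b γ + 1)) :=
    Nat.pow_le_pow_right (by norm_num) (Nat.mul_le_mul_right _ (by omega))
  have h3 : 2 ^ ((C + D) * (c.b γ + 1) + 1) ≤ 2 ^ ((C + D + 1) * (c.b γ + 1)) :=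
    Nat.pow_le_pow_right (by norm_num) (by nlinarith)
  rw [pow_succ] at h3
  have := hC γ
  have := hD γ
  change f γ + g γ ≤ _
  omega

theorem Bdd.exists_length (h : Bdd c f) :
    ∃ C, ∀ γ, (enc (f γ)).length + 1 ≤ C * (c.b γ + 1) := by
  obtain ⟨C, hC⟩ := h
  refine ⟨C + 2, fun γ => ?_⟩
  have := length_enc_le (hC γ)
  nlinarith

theorem mul_bound_le {C D n : ℕ} (h : C ≤ D) : C * (n + 1) ≤ D * (n + 1) :=
  Nat.mul_le_mul_right _ h

/-! #### Basic functions -/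

theorem Impl.zero : Impl c fun _ => 0 :=
  ⟨bdd_const c 0, fun _ _ o _ _ => ⟨.clear o, 0, fun _ s _ => Runs.clear o s⟩⟩

theorem Impl.succ (h : Impl c f) : Impl c fun γ => f γ + 1 := by
  refine ⟨h.bdd.add (bdd_const c 1), fun a N o ha ho => ?_⟩
  obtain ⟨p, C, hp⟩ := h.2 a N o ha ho
  obtain ⟨D, hD⟩ := h.bdd.exists_length
  refine ⟨.seq p (.inc o N), C + D, fun γ s hs => ?_⟩
  refine .seq _ _ _ _ _ ((hp γ s hs).mono (mul_bound_le (by omega)))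
    ((Runs.inc ho.ne _ ?_ ?_).cast ?_)
  · rw [St.set_reg, if_neg ho.ne', hs.empty N le_rfl]
  · simpa using (hD γ).trans (mul_bound_le (by omega))
  · refine St.ext_reg (fun r => ?_) rfl rfl
    simp only [St.set_reg, if_true]
    split_ifs <;> rfl

theorem Impl.pred (h : Impl c f) : Impl c fun γ => f γ - 1 := by
  refine ⟨h.bdd.mono fun _ => Nat.sub_le _ _, fun a N o ha ho => ?_⟩
  obtain ⟨p, C, hp⟩ := h.2 a N o ha ho
  obtain ⟨D, hD⟩ := h.bdd.exists_length
  refine ⟨.seq p (.dec o N), C + D, fun γ s hs => ?_⟩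
  refine .seq _ _ _ _ _ ((hp γ s hs).mono (mul_bound_le (by omega)))
    ((Runs.dec ho.ne _ ?_ ?_).cast ?_)
  · rw [St.set_reg, if_neg ho.ne', hs.empty N le_rfl]
  · simpa using (Nat.le_of_succ_le (hD γ)).trans (mul_bound_le (by omega))
  · refine St.ext_reg (fun r => ?_) rfl rfl
    simp only [St.set_reg, if_true, decL_enc]
    split_ifs <;> rfl

theorem Impl.const (n : ℕ) : Impl c fun _ => n := by
  induction n with
  | zero => exact .zero
  | succ n ih => exact ih.succ

theorem Impl.var (hf : f ∈ c.K) (hb : Bdd c f) : Impl c f := by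
  refine ⟨hb, fun a N o ha ho => ?_⟩
  obtain ⟨D, hD⟩ := hb.exists_length
  have := ha f hf
  by_cases h : a f = o
  · exact ⟨.skip, 0, fun γ s hs => (Runs.skip s).cast (St.set_eq_self (h ▸ hs.known f hf)).symm⟩
  · refine ⟨.copy (a f) o N, D, fun γ s hs => ?_⟩
    rw [← hs.known f hf]
    refine Runs.copy h this.ne ho.ne s (hs.empty N le_rfl) ?_
    rw [hs.known f hf]
    exact Nat.le_of_succ_le (hD γ)

/-- Each branch has to be implementable only over the indices where it is taken. This matters where
a branch respects the space bound only under its condition, as in `Impl.simVal` and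
`Impl.adviceLen`. -/
theorem Impl.ite {p : Γ → ℕ} (hp : Impl c p)
    (hf : ∀ {Γ' : Type} (c' : Ctx t Γ') (π : Γ' → Γ), c'.Ext c π → (∀ x, p (π x) ≠ 0) →
      Impl c' fun x => f (π x))
    (hg : ∀ {Γ' : Type} (c' : Ctx t Γ') (π : Γ' → Γ), c'.Ext c π → (∀ x, p (π x) = 0) →
      Impl c' fun x => g (π x)) :
    Impl c fun γ => if p γ = 0 then g γ else f γ := by
  have hf := hf (c.pull (fun x : {γ // p γ ≠ 0} => x.1) ∅) _ (c.pull_ext _ _) fun x => x.2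
  have hg := hg (c.pull (fun x : {γ // p γ = 0} => x.1) ∅) _ (c.pull_ext _ _) fun x => x.2
  constructor
  · obtain ⟨C, hC⟩ := hf.bdd
    obtain ⟨D, hD⟩ := hg.bdd
    refine ⟨C + D, fun γ => ?_⟩
    beta_reduce
    split_ifs with h
    · exact (hD ⟨γ, h⟩).trans (Nat.pow_le_pow_right (by norm_num) (mul_bound_le (by omega)))
    · exact (hC ⟨γ, h⟩).trans (Nat.pow_le_pow_right (by norm_num) (mul_bound_le (by omega)))
  · intro a N o ha ho
    obtain ⟨a1, ha1, h1⟩ := c.exists_assignment (fun x : {γ // p γ ≠ 0} => x.1) ∅ a (fun _ => 0) N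
      ha (by simp)
    obtain ⟨a2, ha2, h2⟩ := c.exists_assignment (fun x : {γ // p γ = 0} => x.1) ∅ a (fun _ => 0) N
      ha (by simp)
    obtain ⟨P, C, hP⟩ := hp.2 a (N + 1) N (fun g hg => (ha g hg).trans (Nat.lt_succ_self _))
      (Nat.lt_succ_self _)
    obtain ⟨P1, C1, hP1⟩ := hf.2 a1 N o ha1 ho
    obtain ⟨P2, C2, hP2⟩ := hg.2 a2 N o ha2 ho
    refine ⟨.seq P (.branch N fun o => if o = none then P2 else .seq (.clear N) P1), C + C1 + C2,
      fun γ s hs => ?_⟩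
    refine .seq _ _ _ _ _ ((hP γ s (hs.mono (by omega))).mono (mul_bound_le (by omega)))
      (.branch _ _ _ _ ?_)
    have hN := hs.empty N le_rfl
    beta_reduce
    by_cases h : p γ = 0
    · rw [if_pos h]
      simp only [h, enc, St.set_eq_self hN, hN, List.head?_nil, if_true]
      exact (hP2 ⟨γ, h⟩ s ⟨h2 ⟨γ, h⟩ s hs.known (by simp), hs.empty, hs.head⟩).mono
        (mul_bound_le (by omega))
    · rw [if_neg h]
      have h' : enc (p γ) ≠ [] := fun e => h (enc_eq_nil.1 e)
      simp only [St.set_reg, if_true, List.head?_eq_none_iff, h', if_false]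
      refine .seq _ _ _ s _ ((Runs.clear N _).cast (St.ext_reg (fun r => ?_) rfl rfl))
        ((hP1 ⟨γ, h⟩ s ⟨h1 ⟨γ, h⟩ s hs.known (by simp), hs.empty, hs.head⟩).mono
          (mul_bound_le (by omega)))
      simp only [St.set_reg]
      split_ifs with h3
      · rw [h3, hN]
      · rfl

/-! #### Blocks of registers -/

/-- Replace the contents of the registers `M, …, M + n - 1`. -/
def St.setMany (s : St t) (M n : ℕ) (v : ℕ → List Bool) : St t :=
  { s with reg := fun r => if M ≤ r ∧ r < M + n then v (r - M) else s.reg r }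

theorem Ctx.Ready.setMany {a : (Γ → ℕ) → ℕ} {N N' M n : ℕ} {γ : Γ} {s : St t}
    (h : c.Ready a N γ s) (ha : ∀ g ∈ c.K, a g < M) (hM : N ≤ N') (hN' : M + n ≤ N')
    (v : ℕ → List Bool) : c.Ready a N' γ (s.setMany M n v) := by
  refine ⟨fun g hg => ?_, fun r hr => ?_, h.head⟩
  · have := ha g hg
    simp only [St.setMany]
    rw [if_neg (by omega), h.known g hg]
  · simp only [St.setMany]
    rw [if_neg (by omega), h.empty r (by omega)]

theorem exists_tuple_program {F : ℕ → Γ → ℕ} {n : ℕ} (hF : ∀ j < n, Impl c (F j))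
    {a : (Γ → ℕ) → ℕ} {M N : ℕ} (ha : ∀ g ∈ c.K, a g < M) (hN : M + n ≤ N) :
    ∃ (p : Prog t) (C : ℕ), ∀ γ s, c.Ready a N γ s →
      Runs (c.inp γ) (C * (c.b γ + 1)) p s (s.setMany M n fun j => enc (F j γ)) := by
  induction n with
  | zero =>
    refine ⟨.skip, 0, fun γ s _ => (Runs.skip s).cast (St.ext_reg (fun r => ?_) rfl rfl)⟩
    simp only [St.setMany]
    rw [if_neg (by omega)]
  | succ n ih =>
    obtain ⟨p, C, hp⟩ := ih (fun j hj => hF j (by omega)) (by omega)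
    obtain ⟨q, D, hq⟩ := (hF n (by omega)).2 a N (M + n) (fun g hg => by have := ha g hg; omega)
      (by omega)
    refine ⟨.seq p q, C + D, fun γ s hs => .seq _ _ _ _ _
      ((hp γ s hs).mono (mul_bound_le (by omega)))
      (((hq γ _ (hs.setMany ha le_rfl (by omega) _)).mono (mul_bound_le (by omega))).cast
        (St.ext_reg (fun r => ?_) rfl rfl))⟩
    simp only [St.setMany, St.set_reg]
    by_cases h : r = M + n
    · rw [if_pos h, if_pos (by omega), h, Nat.add_sub_cancel_left]
    · rw [if_neg h]
      by_cases h' : M ≤ r ∧ r < M + n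
      · rw [if_pos h', if_pos (by omega)]
      · rw [if_neg h', if_neg (by omega)]

/-- Transfer the registers `M + n, …, M + 2 * n - 1` to `M, …, M + n - 1`. -/
def Prog.transferMany (M k n u : ℕ) : Prog t :=
  match n with
  | 0 => .skip
  | n + 1 => .seq (Prog.transferMany M k n u) (.transfer (M + k + n) (M + n) u)

theorem Runs.transferMany {inp : Fin t → List Bool} {B : ℕ} {M k n u : ℕ} (hu : M + k + n ≤ u)
    (hk : n ≤ k) (s : St t) (hs : s.reg u = [])
    (hB : ∀ j < n, (s.reg (M + k + j)).length ≤ B) :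
    Runs inp B (.transferMany M k n u) s
      ((s.setMany M n fun j => s.reg (M + k + j)).setMany (M + k) n fun _ => []) := by
  induction n with
  | zero =>
    refine (Runs.skip s).cast (St.ext_reg (fun r => ?_) rfl rfl)
    simp only [St.setMany]
    rw [if_neg (by omega), if_neg (by omega)]
  | succ n ih =>
    refine .seq _ _ _ _ _ (ih (by omega) (by omega) fun j hj => hB j (by omega))
      ((Runs.transfer (by omega) (by omega) (by omega) _ ?_ ?_).cast
        (St.ext_reg (fun r => ?_) rfl rfl))
    · simp only [St.setMany]
      rw [if_neg (by omega), if_neg (by omega), hs]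
    · simp only [St.setMany]
      rw [if_neg (by omega), if_neg (by omega)]
      exact hB n (by omega)
    · simp only [St.setMany, St.set_reg]
      rw [if_neg (c := M + k ≤ M + k + n ∧ M + k + n < M + k + n) (by omega),
        if_neg (c := M ≤ M + k + n ∧ M + k + n < M + n) (by omega)]
      by_cases h1 : r = M + k + n
      · rw [if_pos h1, if_pos (by omega)]
      · rw [if_neg h1]
        by_cases h2 : r = M + n
        · rw [if_pos h2, if_neg (by omega), if_pos (by omega), h2, Nat.add_sub_cancel_left]
        · rw [if_neg h2]
          by_cases h3 : M + k ≤ r ∧ r < M + k + n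
          · rw [if_pos h3, if_pos (by omega)]
          · rw [if_neg h3]
            by_cases h4 : M ≤ r ∧ r < M + n
            · rw [if_pos h4, if_neg (by omega), if_pos (by omega)]
            · rw [if_neg h4, if_neg (by omega), if_neg (by omega)]

/-- Empty the registers `M, …, M + n - 1`. -/
def Prog.clearMany (M n : ℕ) : Prog t :=
  match n with
  | 0 => .skip
  | n + 1 => .seq (Prog.clearMany M n) (.clear (M + n))

theorem Runs.clearMany {inp : Fin t → List Bool} {B : ℕ} (M n : ℕ) (s : St t) :
    Runs inp B (.clearMany M n) s (s.setMany M n fun _ => []) := by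
  induction n with
  | zero =>
    refine (Runs.skip s).cast (St.ext_reg (fun r => ?_) rfl rfl)
    simp only [St.setMany]
    rw [if_neg (by omega)]
  | succ n ih =>
    refine .seq _ _ _ _ _ ih ((Runs.clear _ _).cast (St.ext_reg (fun r => ?_) rfl rfl))
    simp only [St.setMany, St.set_reg]
    by_cases h : r = M + n
    · rw [if_pos h, if_pos (by omega)]
    · rw [if_neg h]
      by_cases h' : M ≤ r ∧ r < M + n
      · rw [if_pos h', if_pos (by omega)]
      · rw [if_neg h', if_neg (by omega)]

/-! #### Loops -/

theorem exists_uniform_bound {n : ℕ} {P : ℕ → ℕ → Prop} (hP : ∀ j C D, C ≤ D → P j C → P j D)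
    (h : ∀ j < n, ∃ C, P j C) : ∃ C, ∀ j < n, P j C := by
  induction n with
  | zero => exact ⟨0, by simp⟩
  | succ n ih =>
    obtain ⟨C, hC⟩ := ih fun j hj => h j (by omega)
    obtain ⟨D, hD⟩ := h n (by omega)
    refine ⟨max C D, fun j hj => ?_⟩
    rcases Nat.lt_succ_iff_lt_or_eq.1 hj with h1 | rfl
    · exact hP _ _ _ (le_max_left _ _) (hC j h1)
    · exact hP _ _ _ (le_max_right _ _) hD

/-- The loop rule: the variables `F 0, …, F (n - 1)` are updated simultaneously until `F 0`
becomes zero, after `τ` rounds. -/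
theorem Impl.while {F : ℕ → Γ → ℕ → ℕ} {n : ℕ} {τ : Γ → ℕ} (hn : 0 < n)
    (h0 : ∀ j < n, Impl c fun γ => F j γ 0)
    (hstep : ∀ {Γ' : Type} (c' : Ctx t Γ') (π : Γ' → Γ) (k : Γ' → ℕ), c'.Ext c π →
      (∀ x, k x < τ (π x)) → (∀ j < n, Impl c' fun x => F j (π x) (k x)) →
      ∀ j < n, Impl c' fun x => F j (π x) (k x + 1))
    (hB : ∀ j < n, ∃ C, ∀ γ, ∀ k ≤ τ γ, F j γ k ≤ 2 ^ (C * (c.b γ + 1)))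
    (hlt : ∀ γ, ∀ k < τ γ, F 0 γ k ≠ 0) (hτ : ∀ γ, F 0 γ (τ γ) = 0) :
    ∀ j < n, Impl c fun γ => F j γ (τ γ) := by
  intro j hj
  refine ⟨(hB j hj).imp fun C hC γ => hC γ _ le_rfl, fun a N o ha ho => ?_⟩
  have haN : ∀ g ∈ c.K, a g < N + n := fun g hg => (ha g hg).trans_le (by omega)
  -- the context of the loop body
  let Γ₁ := {x : Γ × ℕ // x.2 < τ x.1}
  let ν : ℕ → Γ₁ → ℕ := fun j x => F j x.1.1 x.1.2
  let π : Γ₁ → Γ := fun x => x.1.1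
  let K₁ : Set (Γ₁ → ℕ) := {g | ∃ j < n, ν j = g}
  let c₁ := c.pull π K₁
  have hvar : ∀ j < n, Impl c₁ (ν j) := fun j hj => .var (Or.inr ⟨j, hj, rfl⟩) <| by
    obtain ⟨C, hC⟩ := hB j hj
    exact ⟨C, fun x => hC _ _ x.2.le⟩
  -- The step hypothesis is used once, in the generic context whose indices are the pairs `(γ, k)`
  -- with `k < τ γ`. The round number `k` has no register of its own, so neither it nor `τ` needs to
  -- be computable.
  have hbody := hstep c₁ π (fun x => x.1.2) (c.pull_ext _ _) (fun x => x.2) hvar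
  classical
  let a₁ : (Γ₁ → ℕ) → ℕ := fun g => if H : ∃ j < n, ν j = g then N + H.choose else 0
  have ha₁ : ∀ g ∈ K₁, a₁ g < N + n := fun g hg => by
    simp only [a₁]
    rw [dif_pos (show ∃ j < n, ν j = g from hg)]
    have := hg.choose_spec.1
    omega
  obtain ⟨a', ha', hready⟩ := c.exists_assignment π K₁ a a₁ (N + n) haN ha₁
  obtain ⟨p₀, C₀, hp₀⟩ := exists_tuple_program h0 ha (N := N + n) le_rfl
  -- The new values go to a second block of registers and are moved over afterwards, so that every
  -- update reads the old values.
  obtain ⟨p₁, C₁, hp₁⟩ := exists_tuple_program hbody ha' (N := N + n + n) le_rfl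
  obtain ⟨D, hD⟩ : ∃ D, ∀ j < n, ∀ γ, ∀ k ≤ τ γ, F j γ k ≤ 2 ^ (D * (c.b γ + 1)) :=
    exists_uniform_bound (fun j C D hCD h γ k hk => (h γ k hk).trans
      (Nat.pow_le_pow_right (by norm_num) (mul_bound_le hCD))) hB
  have hlen : ∀ j < n, ∀ γ, ∀ k ≤ τ γ, (enc (F j γ k)).length ≤
      (C₀ + C₁ + D + 1) * (c.b γ + 1) := by
    intro j hj γ k hk
    have := length_enc_le (hD j hj γ k hk)
    nlinarith
  refine ⟨.seq p₀ (.seq (.loop N Option.isSome (.seq p₁ (.transferMany N n n (N + n + n))))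
    (.seq (.transfer (N + j) o (N + n)) (.clearMany N n))), C₀ + C₁ + D + 1, fun γ s hs => ?_⟩
  have hloop : ∀ k' k, k + k' = τ γ → Runs (c.inp γ) ((C₀ + C₁ + D + 1) * (c.b γ + 1))
      (.loop N Option.isSome (.seq p₁ (.transferMany N n n (N + n + n))))
      (s.setMany N n fun j => enc (F j γ k)) (s.setMany N n fun j => enc (F j γ (τ γ))) := by
    intro k'
    induction k' with
    | zero =>
      intro k hk
      obtain rfl : k = τ γ := hk
      refine .loopDone _ _ _ _ ?_
      simp only [St.setMany]
      rw [if_pos (by omega), Nat.sub_self, hτ]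
      rfl
    | succ k' ih =>
      intro k hk
      have hkτ : k < τ γ := by omega
      refine .loopStep _ _ _ _ _ _ ?_ (.seq _ _ _ _ _
        ((hp₁ ⟨(γ, k), hkτ⟩ (s.setMany N n fun j => enc (F j γ k)) ⟨?_, ?_, hs.head⟩).mono
          (mul_bound_le (C := C₁) (by omega)))
        ((Runs.transferMany (by omega) (by omega) _ ?_ ?_).cast ?_)) (ih (k + 1) (by omega))
      · simp only [St.setMany]
        rw [if_pos (by omega), Nat.sub_self]
        have : enc (F 0 γ k) ≠ [] := fun e => hlt γ k hkτ (enc_eq_nil.1 e)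
        rcases h : enc (F 0 γ k) with _ | _
        · exact absurd h this
        · rfl
      · refine hready ⟨(γ, k), hkτ⟩ _ (fun g hg => ?_) fun g hg => ?_
        · have := ha g hg
          simp only [St.setMany]
          rw [if_neg (by omega)]
          exact hs.known g hg
        · have h1 := hg.choose_spec.1
          have h2 := hg.choose_spec.2
          simp only [a₁]
          rw [dif_pos (show ∃ j < n, ν j = g from hg)]
          simp only [St.setMany]
          rw [if_pos (by omega), Nat.add_sub_cancel_left]
          exact congrArg enc (congrFun h2 ⟨(γ, k), hkτ⟩)
      · intro r hr
        simp only [St.setMany]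
        rw [if_neg (by omega), hs.empty r (by omega)]
      · simp only [St.setMany]
        rw [if_neg (by omega), if_neg (by omega), hs.empty _ (by omega)]
      · intro j hj
        simp only [St.setMany]
        rw [if_pos (by omega), Nat.add_sub_cancel_left]
        exact hlen j hj γ (k + 1) hkτ
      · refine St.ext_reg (fun r => ?_) rfl rfl
        simp only [St.setMany]
        by_cases h1 : N + n ≤ r ∧ r < N + n + n
        · rw [if_pos h1, if_neg (by omega), hs.empty r (by omega)]
        · rw [if_neg h1]
          by_cases h2 : N ≤ r ∧ r < N + n
          · rw [if_pos h2, if_pos h2, if_pos (by omega), Nat.add_sub_cancel_left]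
          · rw [if_neg h2, if_neg h2, if_neg h1, if_neg h2]
  refine .seq _ _ _ _ _ ((hp₀ γ s (hs.mono (by omega))).mono (mul_bound_le (by omega)))
    (.seq _ _ _ _ _ (hloop (τ γ) 0 (by omega)) (.seq _ _ _ _ _
      (Runs.transfer (by omega) (by omega) (by omega) _ ?_ ?_)
      ((Runs.clearMany _ _ _).cast (St.ext_reg (fun r => ?_) rfl rfl))))
  · simp only [St.setMany]
    rw [if_neg (by omega), hs.empty _ (by omega)]
  · simp only [St.setMany]
    rw [if_pos (by omega), Nat.add_sub_cancel_left]
    exact hlen j hj γ _ le_rfl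
  · simp only [St.setMany, St.set_reg]
    rw [if_pos (c := N ≤ N + j ∧ N + j < N + n) (by omega), Nat.add_sub_cancel_left]
    by_cases h1 : N ≤ r ∧ r < N + n
    · rw [if_pos h1, if_neg (by omega), hs.empty r (by omega)]
    · rw [if_neg h1, if_neg (by omega)]
      by_cases h2 : r = o
      · rw [if_pos h2, if_pos h2]
      · rw [if_neg h2, if_neg h2, if_neg h1]

/-! #### Input and output -/

/-- The number of a tape symbol. -/
def symNum : Option Bool → ℕ
  | none => 0
  | some false => 1
  | some true => 2

/-- Store a symbol in the empty register `o`. -/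
def Prog.setSym (o u : ℕ) (x : Option Bool) : Prog t :=
  match x with
  | none => .skip
  | some false => .inc o u
  | some true => .seq (.inc o u) (.inc o u)

theorem Runs.setSym {inp : Fin t → List Bool} {B o u : ℕ} (hou : o ≠ u) (hB : 2 ≤ B) (x : Option Bool)
    (s : St t) (ho : s.reg o = []) (hu : s.reg u = []) :
    Runs inp B (.setSym o u x) s (s.set o (enc (symNum x))) := by
  rcases x with _ | _ | _
  · exact (Runs.skip s).cast (St.set_eq_self ho).symm
  · exact (Runs.inc hou s hu (by simp [ho]; omega)).cast (by rw [ho]; rfl)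
  · refine .seq _ _ _ _ _ (Runs.inc hou s hu (by simp [ho]; omega))
      ((Runs.inc hou _ (by simp [hou.symm, hu]) (by simp [ho, incL]; omega)).cast
        (St.ext_reg (fun r => ?_) rfl rfl))
    simp only [St.set_reg, if_true, ho]
    split_ifs <;> rfl

/-- Move an input head as often as register `r` says. -/
def Prog.moveBy (j : Fin t) (d : Move) (r u : ℕ) : Prog t :=
  .loop r Option.isSome (.seq (.dec r u) (.move j d))

theorem Runs.moveBy {inp : Fin t → List Bool} {B r u : ℕ} (hru : r ≠ u) (j : Fin t) (d : Move) (n : ℕ)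
    (s : St t) (hr : s.reg r = enc n) (hu : s.reg u = []) (hB : ∀ k ≤ n, (enc k).length ≤ B) :
    Runs inp B (.moveBy j d r u) s { s.set r [] with
      head := Function.update s.head j
        ((OfflineTM.moveInput (inp j).length d)^[n] (s.head j)) } := by
  induction n generalizing s with
  | zero =>
    refine (Runs.loopDone r _ _ s (by rw [hr]; rfl)).cast (St.ext_reg (fun r' => ?_) ?_ rfl)
    · change _ = (s.set r []).reg r'
      rw [St.set_eq_self (l := []) hr]
    · simp
  | succ n ih =>
    refine .loopStep _ _ _ _ _ _ ?_ (.seq _ _ _ _ _ (Runs.dec hru s hu ?_) (.move _ _ _))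
      ((ih _ ?_ ?_ fun k hk => hB k (by omega)).cast (St.ext_reg (fun r' => ?_) ?_ rfl))
    · rw [hr]
      have : enc (n + 1) ≠ [] := fun e => by simp [enc_eq_nil] at e
      rcases h : enc (n + 1) with _ | _
      · exact absurd h this
      · rfl
    · rw [hr]; exact hB _ le_rfl
    · simp [hr, decL_enc]
    · simp [hru.symm, hu]
    · simp only [St.set, Function.update_apply]
      split_ifs <;> rfl
    · simp

theorem iterate_moveInput_right (n k : ℕ) :
    (OfflineTM.moveInput n .right)^[k] 0 = min k (n + 1) := by
  induction k with
  | zero => simp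
  | succ k ih => rw [Function.iterate_succ_apply', ih]; simp only [OfflineTM.moveInput]; omega

theorem iterate_moveInput_left (n k p : ℕ) :
    (OfflineTM.moveInput n .left)^[k] p = p - k := by
  induction k with
  | zero => simp
  | succ k ih => rw [Function.iterate_succ_apply', ih]; simp only [OfflineTM.moveInput]; omega

theorem readInput_min (l : List Bool) (k : ℕ) :
    OfflineTM.readInput l (min k (l.length + 1)) = OfflineTM.readInput l k := by
  rcases le_total k (l.length + 1) with h | h
  · rw [min_eq_left h]
  · rw [min_eq_right h]
    obtain ⟨k, rfl⟩ : ∃ k', k = k' + 1 := ⟨k - 1, by omega⟩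
    simp only [OfflineTM.readInput]
    rw [List.getElem?_eq_none (by omega), List.getElem?_eq_none (by omega)]

/-- The head walks to the wanted cell and back. On a short input it stops after the last bit, where
it sees a blank as it would farther out, and going back by the full count still ends in cell `0`. -/
theorem Impl.read (j : Fin t) (h : Impl c f) :
    Impl c fun γ => symNum (OfflineTM.readInput (c.inp γ j) (f γ)) := by
  constructor
  · refine (bdd_const c 2).mono fun γ => ?_
    rcases OfflineTM.readInput (c.inp γ j) (f γ) with _ | _ | _ <;> simp [symNum]
  intro a N o ha ho
  -- Two copies of the position, one consumed on the way out and one on the way back.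
  obtain ⟨p, C, hp⟩ := exists_tuple_program (F := fun _ => f) (n := 2) (fun _ _ => h) ha
    (N := N + 2) le_rfl
  obtain ⟨D, hD⟩ := h.bdd
  refine ⟨.seq p (.seq (.moveBy j .right N (N + 2)) (.seq (.clear o)
    (.seq (.branchIn j fun x => .setSym o (N + 2) x) (.moveBy j .left (N + 1) (N + 2))))),
    C + D + 2, fun γ s hs => ?_⟩
  have hlen : ∀ k ≤ f γ, (enc k).length ≤ (C + D + 2) * (c.b γ + 1) := by
    intro k hk
    have := length_enc_le (hk.trans (hD γ))
    nlinarith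
  refine .seq _ _ _ _ _ ((hp γ s (hs.mono (by omega))).mono (mul_bound_le (by omega)))
    (.seq _ _ _ _ _ (Runs.moveBy (by omega) j .right (f γ) _ ?_ ?_ hlen)
      (.seq _ _ _ _ _ (Runs.clear o _) (.seq _ _ _ _ _ (.branchIn _ _ _ _
        (Runs.setSym (by omega) (by nlinarith) _ _ ?_ ?_))
        ((Runs.moveBy (by omega) j .left (f γ) _ ?_ ?_ hlen).cast ?_))))
  · simp only [St.setMany]
    rw [if_pos (by omega)]
  · simp only [St.setMany]
    rw [if_neg (by omega), hs.empty _ (by omega)]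
  · simp
  · simp only [St.setMany, St.set, Function.update_apply]
    rw [if_neg (by omega), if_neg (by omega), if_neg (by omega), hs.empty _ (by omega)]
  · simp only [St.setMany, St.set, Function.update_apply]
    rw [if_neg (by omega), if_neg (by omega), if_neg (by omega), if_pos (by omega)]
  · simp only [St.setMany, St.set, Function.update_apply]
    rw [if_neg (by omega), if_neg (by omega), if_neg (by omega), if_neg (by omega),
      hs.empty _ (by omega)]
  · refine St.ext_reg (fun r => ?_) ?_ rfl
    · simp only [St.setMany, St.set, Function.update_apply, if_true, hs.head,
        iterate_moveInput_right, readInput_min]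
      by_cases h1 : r = o
      · rw [if_pos h1, if_neg (by omega), if_pos h1]
      · rw [if_neg h1]
        by_cases h2 : r = N + 1
        · rw [if_pos h2, if_neg h1, hs.empty _ (by omega)]
        · rw [if_neg h2, if_neg h1, if_neg h1]
          by_cases h3 : r = N
          · rw [if_pos h3, hs.empty _ (by omega)]
          · rw [if_neg h3, if_neg (by omega)]
    · funext i
      simp only [St.setMany, St.set, Function.update_apply, if_true, hs.head,
        iterate_moveInput_right, iterate_moveInput_left]
      split_ifs
      · omega
      · rfl

/-- The output rule: a string is computable if its length and its bits are. -/
theorem Impl.computable {ι : Type} {inp : ι → Fin t → List Bool} {b : ι → ℕ}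
    {out : ι → List Bool} {len : ι → ℕ} {bit : ι → ℕ → ℕ}
    (hlen : Impl ⟨inp, b, ∅⟩ len)
    (hbit : ∀ {Γ' : Type} (c' : Ctx t Γ') (π : Γ' → ι) (k : Γ' → ℕ), c'.Ext ⟨inp, b, ∅⟩ π →
      Impl c' k → (∀ x, k x < len (π x)) → Impl c' fun x => bit (π x) (k x))
    (hout : ∀ i, out i = (List.range (len i)).map fun k => decide (bit i k ≠ 0)) :
    ComputableInSpace inp out b := by
  let Γ₁ := {x : ι × ℕ // x.2 < len x.1}
  let c₁ : Ctx t Γ₁ := ⟨fun x => inp x.1.1, fun x => b x.1.1, {fun x => x.1.2}⟩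
  obtain ⟨D, hD⟩ := hlen.bdd
  have hk : Impl c₁ fun x => x.1.2 := .var rfl ⟨D, fun x => x.2.le.trans (hD x.1.1)⟩
  have hb := hbit c₁ (fun x => x.1.1) _ ⟨fun _ => rfl, fun _ => rfl, by simp⟩ hk fun x => x.2
  obtain ⟨p, C, hp⟩ := hlen.2 (fun _ => 0) 1 0 (by simp) (by simp)
  obtain ⟨q, C', hq⟩ := hb.2 (fun _ => 1) 3 2 (by simp) (by simp)
  -- Register `0` counts the bits still to be emitted, `1` holds the position, `2` receives the bit,
  -- and the registers from `3` on are scratch.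
  refine .of_runs (.seq p (.loop 0 Option.isSome (.seq q (.seq
    (.branch 2 fun o => if o = none then .emit false else .emit true)
      (.seq (.clear 2) (.seq (.inc 1 3) (.dec 0 3))))))) (C + C' + D + 2) fun i => ?_
  have hl : ∀ k ≤ len i, (enc k).length + 1 ≤ (C + C' + D + 2) * (b i + 1) := by
    intro k hk
    have := length_enc_le (hk.trans (hD i))
    simp only at this
    nlinarith
  let s : ℕ → ℕ → St t := fun n k => ⟨fun r => if r = 0 then enc n else if r = 1 then enc k else [],
    fun _ => 0, (List.range k).map fun k => decide (bit i k ≠ 0)⟩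
  have hloop : ∀ n k, k + n = len i → Runs (inp i) ((C + C' + D + 2) * (b i + 1))
      (.loop 0 Option.isSome (.seq q (.seq
        (.branch 2 fun o => if o = none then .emit false else .emit true)
        (.seq (.clear 2) (.seq (.inc 1 3) (.dec 0 3)))))) (s n k) (s 0 (len i)) := by
    intro n
    induction n with
    | zero =>
      intro k hk
      obtain rfl : k = len i := hk
      exact .loopDone _ _ _ _ rfl
    | succ n ih =>
      intro k hk
      have hki : k < len i := by omega
      let s₁ : St t := { (s (n + 1) k).set 2 (enc (bit i k)) with
        out := (List.range (k + 1)).map fun k => decide (bit i k ≠ 0) }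
      refine .loopStep _ _ _ _ (s n (k + 1)) _ ?_ (.seq _ _ _ _ _
        ((hq ⟨(i, k), hki⟩ (s (n + 1) k) ⟨?_, ?_, rfl⟩).mono (mul_bound_le (by omega)))
        (.seq _ _ _ s₁ _ (.branch _ _ _ _ ?_) (.seq _ _ _ _ _ (Runs.clear 2 _)
          (.seq _ _ _ _ _ (Runs.inc (by omega) _ ?_ ?_) ((Runs.dec (by omega) _ ?_ ?_).cast
            (St.ext_reg (fun r => ?_) rfl rfl)))))) (ih (k + 1) (by omega))
      · have : enc (n + 1) ≠ [] := fun e => by simp [enc_eq_nil] at e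
        rcases h : enc (n + 1) with _ | _
        · exact absurd h this
        · simp [s, h]
      · intro g hg
        obtain rfl : g = fun x => x.1.2 := hg
        simp [s]
      · intro r hr
        simp only [s]
        rw [if_neg (by omega), if_neg (by omega)]
      · have e : s₁ = { (s (n + 1) k).set 2 (enc (bit i k)) with
            out := ((s (n + 1) k).set 2 (enc (bit i k))).out ++ [decide (bit i k ≠ 0)] } := by
          simp [s₁, s, List.range_succ]
        rw [e]
        simp only [St.set_reg, if_true, List.head?_eq_none_iff, enc_eq_nil]
        split_ifs with h
        · exact (Runs.emit false _).cast (by simp [h])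
        · exact (Runs.emit true _).cast (by simp [h])
      · simp [s₁, s]
      · simpa [s₁, s] using hl k hki.le
      · simp [s₁, s]
      · simpa [s₁, s] using Nat.le_of_succ_le (hl (n + 1) (by omega))
      · simp only [s₁, St.set_reg, s]
        by_cases h0 : r = 0
        · simp [h0, decL_enc]
        by_cases h1 : r = 1
        · simp [h1, enc]
        by_cases h2 : r = 2 <;> simp [h0, h1, h2]
  refine ⟨s 0 (len i), .seq _ _ _ (s (len i) 0) _
    (((hp i ⟨fun _ => [], fun _ => 0, []⟩ ⟨by simp, fun _ _ => rfl, rfl⟩).mono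
      (mul_bound_le (by omega))).cast (St.ext_reg (fun r => ?_) rfl rfl)) (hloop _ 0 (by omega)),
    (hout i).symm⟩
  simp only [St.set_reg, s, enc]
  split_ifs <;> rfl

end

/-! ### Arithmetic in bounded space -/

variable {t : ℕ} {Γ : Type} {c : Ctx t Γ} {f g h : Γ → ℕ}

/-- `F γ k` is implementable in `γ` and `k`, where `k` is subject to the condition `P`. -/
def Fam (c : Ctx t Γ) (P : Γ → ℕ → Prop) (F : Γ → ℕ → ℕ) : Prop :=
  ∀ ⦃Γ' : Type⦄ (c' : Ctx t Γ') (π : Γ' → Γ) (k : Γ' → ℕ), c'.Ext c π → Impl c' k →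
    (∀ x, P (π x) (k x)) → Impl c' fun x => F (π x) (k x)

/-- `F γ k l` is implementable in `γ`, `k` and `l`. -/
def Fam₂ (c : Ctx t Γ) (F : Γ → ℕ → ℕ → ℕ) : Prop :=
  ∀ ⦃Γ' : Type⦄ (c' : Ctx t Γ') (π : Γ' → Γ) (k l : Γ' → ℕ), c'.Ext c π → Impl c' k → Impl c' l →
    Impl c' fun x => F (π x) (k x) (l x)

/-- A simultaneous recursion of length `τ`. -/
theorem Impl.for {F : ℕ → Γ → ℕ → ℕ} {n : ℕ} {τ : Γ → ℕ} (hτ : Impl c τ)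
    (h0 : ∀ j < n, Impl c fun γ => F j γ 0)
    (hstep : ∀ {Γ' : Type} (c' : Ctx t Γ') (π : Γ' → Γ) (k : Γ' → ℕ), c'.Ext c π → Impl c' k →
      (∀ x, k x < τ (π x)) → (∀ j < n, Impl c' fun x => F j (π x) (k x)) →
      ∀ j < n, Impl c' fun x => F j (π x) (k x + 1))
    (hB : ∀ j < n, ∃ C, ∀ γ, ∀ k ≤ τ γ, F j γ k ≤ 2 ^ (C * (c.b γ + 1))) :
    ∀ j < n, Impl c fun γ => F j γ (τ γ) := by
  -- Variable `0` counts down and controls the loop; variable `1` is the round number, which makes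
  -- `k` available to the body.
  let G : ℕ → Γ → ℕ → ℕ
    | 0, γ, k => τ γ - k
    | 1, _, k => k
    | j + 2, γ, k => F j γ k
  have H : ∀ j < n + 2, Impl c fun γ => G j γ (τ γ) := by
    refine Impl.while (by omega) ?_ ?_ ?_ ?_ ?_
    · rintro (_ | _ | j) hj
      · exact hτ
      · exact .zero
      · exact h0 j (by omega)
    · intro Γ' c' π k e hk hG
      rintro (_ | _ | j) hj
      · exact ((hG 0 (by omega)).pred).congr fun x => by simp only [G]; omega
      · exact (hG 1 (by omega)).succ
      · exact hstep c' π k e (hG 1 (by omega)) hk (fun j hj => hG (j + 2) (by omega)) j (by omega)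
    · obtain ⟨C, hC⟩ := hτ.bdd
      rintro (_ | _ | j) hj
      · exact ⟨C, fun γ k _ => (Nat.sub_le _ _).trans (hC γ)⟩
      · exact ⟨C, fun γ k hk => hk.trans (hC γ)⟩
      · exact hB j (by omega)
    · intro γ k hk
      simp only [G]
      omega
    · intro γ
      simp [G]
  exact fun j hj => H (j + 2) (by omega)

/-- A recursion of length `τ`. -/
theorem Impl.rec {F : Γ → ℕ → ℕ} {τ : Γ → ℕ} (hτ : Impl c τ) (h0 : Impl c fun γ => F γ 0)
    (hstep : ∀ {Γ' : Type} (c' : Ctx t Γ') (π : Γ' → Γ) (k : Γ' → ℕ), c'.Ext c π → Impl c' k →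
      (∀ x, k x < τ (π x)) → (Impl c' fun x => F (π x) (k x)) →
      Impl c' fun x => F (π x) (k x + 1))
    (hB : ∃ C, ∀ γ, ∀ k ≤ τ γ, F γ k ≤ 2 ^ (C * (c.b γ + 1))) :
    Impl c fun γ => F γ (τ γ) :=
  Impl.for (F := fun _ => F) (n := 1) hτ (fun _ _ => h0)
    (fun c' π k e hk hl hF _ _ => hstep c' π k e hk hl (hF 0 (by omega))) (fun _ _ => hB) 0
    (by omega)

theorem Impl.add (hf : Impl c f) (hg : Impl c g) : Impl c fun γ => f γ + g γ := by
  refine Impl.rec (F := fun γ k => f γ + k) hg hf (fun c' π k _ _ _ h => h.succ) ?_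
  obtain ⟨C, hC⟩ := hf.bdd.add hg.bdd
  exact ⟨C, fun γ k hk => le_trans (by beta_reduce; omega) (hC γ)⟩

theorem Impl.sub (hf : Impl c f) (hg : Impl c g) : Impl c fun γ => f γ - g γ := by
  refine Impl.rec (F := fun γ k => f γ - k) hg hf (fun c' π k _ _ _ h => h.pred) ?_
  obtain ⟨C, hC⟩ := hf.bdd
  exact ⟨C, fun γ k hk => (Nat.sub_le _ _).trans (hC γ)⟩

theorem Impl.mul (hf : Impl c f) (hg : Impl c g) : Impl c fun γ => f γ * g γ := by
  refine Impl.rec (F := fun γ k => f γ * k) hg .zero (fun c' π k e _ _ h => h.add (hf.ext e)) ?_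
  obtain ⟨C, hC⟩ := hf.bdd.mul hg.bdd
  exact ⟨C, fun γ k hk => (Nat.mul_le_mul_left _ hk).trans (hC γ)⟩

/-! #### Decidable conditions -/

/-- A condition is decidable in bounded space. -/
def ImplP (c : Ctx t Γ) (p : Γ → Prop) : Prop := ∃ f, Impl c f ∧ ∀ γ, f γ ≠ 0 ↔ p γ

section Conditions

variable {p q : Γ → Prop}

theorem ImplP.congr (hp : ImplP c p) (h : ∀ γ, q γ ↔ p γ) : ImplP c q := by
  rwa [funext fun γ => propext (h γ)]

theorem Impl.ifRestrict [∀ γ, Decidable (p γ)] (hp : ImplP c p)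
    (hf : ∀ {Γ' : Type} (c' : Ctx t Γ') (π : Γ' → Γ), c'.Ext c π → (∀ x, p (π x)) →
      Impl c' fun x => f (π x))
    (hg : ∀ {Γ' : Type} (c' : Ctx t Γ') (π : Γ' → Γ), c'.Ext c π → (∀ x, ¬ p (π x)) →
      Impl c' fun x => g (π x)) :
    Impl c fun γ => if p γ then f γ else g γ := by
  obtain ⟨φ, h1, h2⟩ := hp
  refine (Impl.ite h1 (fun c' π e h => hf c' π e fun x => (h2 _).1 (h x))
    (fun c' π e h => hg c' π e fun x hx => (h2 _).2 hx (h x))).congr fun γ => ?_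
  by_cases h : p γ
  · rw [if_pos h, if_neg ((h2 γ).2 h)]
  · rw [if_neg h, if_pos (not_not.1 fun h' => h ((h2 γ).1 h'))]

theorem Impl.if [∀ γ, Decidable (p γ)] (hp : ImplP c p) (hf : Impl c f) (hg : Impl c g) :
    Impl c fun γ => if p γ then f γ else g γ :=
  .ifRestrict hp (fun _ _ e _ => hf.ext e) fun _ _ e _ => hg.ext e

theorem Impl.lt (hf : Impl c f) (hg : Impl c g) : ImplP c fun γ => f γ < g γ :=
  ⟨_, hg.sub hf, fun γ => by omega⟩

theorem Impl.le (hf : Impl c f) (hg : Impl c g) : ImplP c fun γ => f γ ≤ g γ :=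
  ⟨_, hg.succ.sub hf, fun γ => by omega⟩

theorem ImplP.not (hp : ImplP c p) : ImplP c fun γ => ¬ p γ := by
  obtain ⟨φ, h1, h2⟩ := hp
  refine ⟨_, (Impl.const 1).sub h1, fun γ => ?_⟩
  beta_reduce
  rw [← h2 γ]
  omega

theorem ImplP.and (hp : ImplP c p) (hq : ImplP c q) : ImplP c fun γ => p γ ∧ q γ := by
  obtain ⟨φ, h1, h2⟩ := hp
  obtain ⟨ψ, h3, h4⟩ := hq
  refine ⟨_, h1.mul h3, fun γ => ?_⟩
  beta_reduce
  rw [← h2 γ, ← h4 γ, mul_ne_zero_iff]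

theorem Impl.eq (hf : Impl c f) (hg : Impl c g) : ImplP c fun γ => f γ = g γ :=
  ((hf.le hg).and (hg.le hf)).congr fun _ => le_antisymm_iff

theorem Impl.ind [∀ γ, Decidable (p γ)] (hp : ImplP c p) : Impl c fun γ => if p γ then 1 else 0 :=
  .if hp (.const 1) (.const 0)

end Conditions

theorem Impl.min (hf : Impl c f) (hg : Impl c g) : Impl c fun γ => min (f γ) (g γ) :=
  (Impl.if (hf.le hg) hf hg).congr fun _ => rfl

/-! #### Division, powers and sums -/

/-- Division by counting up to the dividend. For `n = 0` the condition never holds, in agreement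
with `k / 0 = 0` and `k % 0 = k`. -/
theorem succ_div_mod (k n : ℕ) : (k + 1) / n = (if k % n + 1 = n then k / n + 1 else k / n) ∧
    (k + 1) % n = (if k % n + 1 = n then 0 else k % n + 1) := by
  rcases Nat.eq_zero_or_pos n with rfl | hn
  · simp
  have h1 := Nat.div_add_mod k n
  have h2 := Nat.mod_lt k hn
  have h3 := Nat.div_add_mod (k + 1) n
  have h4 := Nat.mod_lt (k + 1) hn
  split_ifs with h
  · have e : k + 1 = n * (k / n + 1) := by rw [mul_add]; omega
    rw [e, Nat.mul_div_cancel_left _ hn, Nat.mul_mod_right]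
    exact ⟨rfl, rfl⟩
  · have e : k + 1 = n * (k / n) + (k % n + 1) := by omega
    rw [e, Nat.mul_add_div hn, Nat.mul_add_mod,
      Nat.div_eq_of_lt (show k % n + 1 < n by omega), Nat.mod_eq_of_lt (show k % n + 1 < n by omega)]
    exact ⟨by simp, rfl⟩

theorem Impl.divMod (hf : Impl c f) (hg : Impl c g) :
    (Impl c fun γ => f γ / g γ) ∧ Impl c fun γ => f γ % g γ := by
  let F : ℕ → Γ → ℕ → ℕ := fun j γ k => if j = 0 then k / g γ else k % g γ
  have H : ∀ j < 2, Impl c fun γ => F j γ (f γ) := by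
    refine Impl.for hf ?_ ?_ ?_
    · intro j _
      exact Impl.zero.congr fun γ => by simp [F]
    · intro Γ' c' π k e hk _ hF
      have hd : Impl c' fun x => k x / g (π x) := hF 0 (by omega)
      have hm : Impl c' fun x => k x % g (π x) := hF 1 (by omega)
      have hp := hm.succ.eq (hg.ext e)
      intro j hj
      rcases Nat.lt_succ_iff_lt_or_eq.1 hj with h | rfl
      · obtain rfl : j = 0 := by omega
        exact (Impl.if hp hd.succ hd).congr fun x => (succ_div_mod _ _).1
      · exact (Impl.if hp .zero hm.succ).congr fun x => (succ_div_mod _ _).2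
    · obtain ⟨C, hC⟩ := hf.bdd
      intro j _
      refine ⟨C, fun γ k hk => le_trans ?_ (hk.trans (hC γ))⟩
      simp only [F]
      split_ifs
      · exact Nat.div_le_self _ _
      · exact Nat.mod_le _ _
  exact ⟨H 0 (by omega), H 1 (by omega)⟩

theorem Impl.div (hf : Impl c f) (hg : Impl c g) : Impl c fun γ => f γ / g γ := (hf.divMod hg).1

theorem Impl.mod (hf : Impl c f) (hg : Impl c g) : Impl c fun γ => f γ % g γ := (hf.divMod hg).2

/-- The summand `1` is there for the base `0`, where `a ^ 0` can exceed `a ^ n`. -/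
theorem pow_le_add_one {a k n : ℕ} (h : k ≤ n) : a ^ k ≤ a ^ n + 1 := by
  rcases Nat.eq_zero_or_pos a with rfl | ha
  · rcases Nat.eq_zero_or_pos k with rfl | hk
    · simp
    · simp [hk.ne']
  · exact (Nat.pow_le_pow_right ha h).trans (Nat.le_succ _)

theorem Impl.pow (hf : Impl c f) (hg : Impl c g) (hB : Bdd c fun γ => f γ ^ g γ) :
    Impl c fun γ => f γ ^ g γ := by
  refine Impl.rec (F := fun γ k => f γ ^ k) hg (.const 1)
    (fun c' π k e _ _ h => h.mul (hf.ext e)) ?_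
  obtain ⟨C, hC⟩ := hB.add (bdd_const c 1)
  exact ⟨C, fun γ k hk => (pow_le_add_one hk).trans (hC γ)⟩

theorem Impl.sum {n : Γ → ℕ} {F : Γ → ℕ → ℕ} (hn : Impl c n) (hF : Fam c (fun γ k => k < n γ) F)
    (hB : Bdd c fun γ => ∑ k ∈ Finset.range (n γ), F γ k) :
    Impl c fun γ => ∑ k ∈ Finset.range (n γ), F γ k := by
  refine Impl.rec (F := fun γ n => ∑ k ∈ Finset.range n, F γ k) hn .zero
    (fun c' π k e hk hl h => (h.add (hF c' π k e hk hl)).congr fun x =>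
      Finset.sum_range_succ _ _) ?_
  obtain ⟨C, hC⟩ := hB
  refine ⟨C, fun γ k hk => (Finset.sum_le_sum_of_subset ?_).trans (hC γ)⟩
  exact Finset.range_subset_range.2 hk

theorem ImplP.ball {n : Γ → ℕ} {P : Γ → ℕ → Prop} (hn : Impl c n)
    (hP : ∀ {Γ' : Type} (c' : Ctx t Γ') (π : Γ' → Γ) (k : Γ' → ℕ), c'.Ext c π → Impl c' k →
      (∀ x, k x < n (π x)) → ImplP c' fun x => P (π x) (k x)) :
    ImplP c fun γ => ∀ k < n γ, P γ k := by
  classical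
  have H : Impl c fun γ => ∑ k ∈ Finset.range (n γ), if ¬ P γ k then 1 else 0 := by
    refine Impl.sum hn (fun _ c' π k e hk hl => Impl.ind (hP c' π k e hk hl).not) ?_
    refine hn.bdd.mono fun γ => (Finset.sum_le_sum (g := fun _ => 1) fun k _ => ?_).trans (by simp)
    split_ifs <;> simp
  refine ImplP.congr (ImplP.not ⟨_, H, fun _ => Iff.rfl⟩) fun γ => ?_
  simp [Finset.sum_eq_zero_iff]

/-- The digit of `n` at place `y` in base `B`. -/
def dig (B n y : ℕ) : ℕ := n / B ^ y % B

theorem dig_le (B n y : ℕ) : dig B n y ≤ n := (Nat.mod_le _ _).trans (Nat.div_le_self _ _)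

theorem Impl.dig (hf : Impl c f) (hg : Impl c g) (hh : Impl c h) :
    Impl c fun γ => dig (f γ) (g γ) (h γ) := by
  refine Impl.mod (Impl.rec (F := fun γ k => g γ / f γ ^ k) hh (hg.congr fun γ => by simp)
    (fun c' π k e _ _ h => (h.div (hf.ext e)).congr fun x => ?_) ?_) hf
  · rw [Nat.div_div_eq_div_mul, pow_succ]
  · obtain ⟨C, hC⟩ := hg.bdd
    exact ⟨C, fun γ k hk => (Nat.div_le_self _ _).trans (hC γ)⟩

/-- The number with digits `g 0, …, g (n - 1)` in base `B`. -/
def undig (B n : ℕ) (g : ℕ → ℕ) : ℕ := ∑ x ∈ Finset.range n, g x * B ^ x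

theorem undig_lt {B n : ℕ} {g : ℕ → ℕ} (h : ∀ x < n, g x < B) : undig B n g < B ^ n := by
  induction n with
  | zero => simp [undig]
  | succ n ih =>
    have h1 := ih fun x hx => h x (by omega)
    have h2 := h n (by omega)
    rw [undig, Finset.sum_range_succ, ← undig, pow_succ]
    nlinarith [Nat.mul_le_mul_right (B ^ n) h2]

theorem dig_undig {B n : ℕ} {g : ℕ → ℕ} (h : ∀ x < n, g x < B) {y : ℕ} (hy : y < n) :
    dig B (undig B n g) y = g y := by
  induction n generalizing g y with
  | zero => omega
  | succ n ih =>
    have hB : 0 < B := (Nat.zero_le _).trans_lt (h 0 (by omega))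
    have e : undig B (n + 1) g = g 0 + B * undig B n fun x => g (x + 1) := by
      rw [undig, Finset.sum_range_succ', undig, Finset.mul_sum, add_comm]
      congr 1
      · simp
      · exact Finset.sum_congr rfl fun x _ => by rw [pow_succ]; ring
    rcases y with _ | y
    · rw [dig, e, pow_zero, Nat.div_one, Nat.add_mul_mod_self_left, Nat.mod_eq_of_lt (h 0 (by omega))]
    · have := ih (g := fun x => g (x + 1)) (fun x hx => h (x + 1) (by omega)) (y := y) (by omega)
      rw [← this, dig, dig, e, pow_succ', ← Nat.div_div_eq_div_mul, Nat.add_mul_div_left _ _ hB,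
        Nat.div_eq_of_lt (h 0 (by omega)), Nat.zero_add]

theorem Impl.undig {n : Γ → ℕ} {F : Γ → ℕ → ℕ} (hf : Impl c f) (hn : Impl c n)
    (hF : Fam c (fun γ k => k < n γ) F) (hlt : ∀ γ, ∀ k < n γ, F γ k < f γ)
    (hB : Bdd c fun γ => f γ ^ n γ) : Impl c fun γ => undig (f γ) (n γ) (F γ) := by
  refine Impl.sum hn (fun _ c' π k e hk hl => (hF c' π k e hk hl).mul
    ((hf.ext e).pow hk ?_)) (hB.mono fun γ => (undig_lt (hlt γ)).le)
  exact ((hB.add (bdd_const c 1)).ext e).mono fun x => pow_le_add_one (hl x).le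

/-! #### Input -/

theorem symNum_le (x : Option Bool) : symNum x ≤ 2 := by
  rcases x with _ | _ | _ <;> simp [symNum]

theorem symNum_readInput_ne_zero {l : List Bool} {k : ℕ} :
    symNum (OfflineTM.readInput l (k + 1)) ≠ 0 ↔ k < l.length := by
  simp only [OfflineTM.readInput]
  rcases lt_or_ge k l.length with h | h
  · rw [List.getElem?_eq_getElem h]
    cases l[k] <;> simp [symNum, h]
  · rw [List.getElem?_eq_none h]
    simp [symNum, h]

/-- The number of rounds is what is to be found, so the loop is controlled by the scanned symbol and
ends at the first blank. -/
theorem Impl.inputLength (j : Fin t) (hB : Bdd c fun γ => (c.inp γ j).length) :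
    Impl c fun γ => (c.inp γ j).length := by
  let F : ℕ → Γ → ℕ → ℕ := fun i γ k =>
    if i = 0 then symNum (OfflineTM.readInput (c.inp γ j) (k + 1)) else k
  refine Impl.while (F := F) (n := 2) (τ := fun γ => (c.inp γ j).length) (by omega)
    ?_ ?_ ?_ ?_ ?_ 1 (by omega)
  · intro i hi
    rcases Nat.lt_succ_iff_lt_or_eq.1 hi with h | rfl
    · obtain rfl : i = 0 := by omega
      exact Impl.read j (.const 1)
    · exact .zero
  · intro Γ' c' π k e _ hF i hi
    have hk : Impl c' k := hF 1 (by omega)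
    rcases Nat.lt_succ_iff_lt_or_eq.1 hi with h | rfl
    · obtain rfl : i = 0 := by omega
      exact (hk.succ.succ.read j).congr fun x => by simp only [F, e.inp, if_true]
    · exact hk.succ
  · intro i hi
    rcases Nat.lt_succ_iff_lt_or_eq.1 hi with h | rfl
    · obtain rfl : i = 0 := by omega
      obtain ⟨C, hC⟩ := bdd_const c 2
      exact ⟨C, fun γ k _ => (symNum_le _).trans (hC γ)⟩
    · obtain ⟨C, hC⟩ := hB
      exact ⟨C, fun γ k hk => hk.trans (hC γ)⟩
  · intro γ k hk
    exact symNum_readInput_ne_zero.2 hk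
  · intro γ
    exact not_not.1 fun h => lt_irrefl _ (symNum_readInput_ne_zero.1 h)

/-! ### Numerical simulation of machines -/

/-- The data of a numerical simulation: the number `k` of work tapes, a transition table given by
the base-`d` digits of `i`, the number `W` of represented cells of each work tape, a bound `P` for
the head positions, and the symbols `rd j p` on the input tapes. -/
structure Sim where
  k : ℕ
  d : ℕ
  i : ℕ
  W : ℕ
  P : ℕ
  rd : ℕ → ℕ → ℕ

/-- A numerical configuration: the state, the contents of the work tapes in base 3, and the head
positions in base `P`. -/
@[ext]
structure SimSt where
  q : ℕ
  T : ℕ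
  X : ℕ

namespace Sim

variable (S : Sim) (t : ℕ) (x : SimSt)

/-- The position of a head; the first `t` heads are input heads. -/
def pos (h : ℕ) : ℕ := dig S.P x.X h

/-- The symbol scanned by a head. -/
def sym (h : ℕ) : ℕ :=
  if h < t then S.rd h (S.pos x h) else dig 3 x.T ((h - t) * S.W + S.pos x h)

/-- The row of the transition table. -/
def idx : ℕ := x.q * 3 ^ (t + S.k) + undig 3 (t + S.k) (S.sym t x)

/-- An entry of the transition table: `0` for the next state (or halting), `1` for the emitted
symbol, and `2 + 2 * h` and `3 + 2 * h` for the movement and the written symbol of head `h`. -/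
def field (e : ℕ) : ℕ := dig S.d S.i (1 + (S.idx t x * (2 * (t + S.k) + 2) + e))

/-- The new position of a head. -/
def newPos (h : ℕ) : ℕ :=
  -- The cutoff at `P - 1` does nothing in a faithful simulation; it keeps positions bounded for
  -- data that describe no machine or one that leaves its space. An input head that reads a blank
  -- outside cell `0` is at the right end and does not move right.
  min (if S.field t x (2 + 2 * h) = 1 then S.pos x h - 1
    else if S.field t x (2 + 2 * h) = 2 then
      (if h < t ∧ 0 < S.pos x h ∧ S.rd h (S.pos x h) = 0 then S.pos x h else S.pos x h + 1)
    else S.pos x h) (S.P - 1)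

/-- The new symbol in a work cell. -/
def newCell (z : ℕ) : ℕ :=
  if z % S.W = S.pos x (t + z / S.W) then min (S.field t x (3 + 2 * (t + z / S.W))) 2
  else dig 3 x.T z

/-- The configuration after a step that does not halt. -/
def succ : SimSt where
  q := S.field t x 0 - 1
  T := undig 3 (S.k * S.W) (S.newCell t x)
  X := undig S.P (t + S.k) (S.newPos t x)

/-- The initial configuration. -/
def start : SimSt where
  q := dig S.d S.i 0
  T := 0
  X := undig S.P (t + S.k) fun h => if h < t then 0 else S.W / 2

/-- The configuration after `n` steps, and the value of a fold over the output so far. -/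
def run (g : ℕ → ℕ → ℕ) (a₀ : ℕ) : ℕ → SimSt × ℕ
  | 0 => (S.start t, a₀)
  | n + 1 =>
    let y := run g a₀ n
    if S.field t y.1 0 = 0 then y
    else (S.succ t y.1, if S.field t y.1 1 = 0 then y.2 else g y.2 (S.field t y.1 1 - 1))

/-- A number of steps after which a halting simulation has halted. -/
def steps : ℕ := S.d * 3 ^ (S.k * S.W) * S.P ^ (t + S.k)

/-- The value of a fold over the whole output. -/
def fold (g : ℕ → ℕ → ℕ) (a₀ : ℕ) : ℕ := (S.run t g a₀ (S.steps t)).2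

end Sim

/-! #### Encoding machines -/

/-- The symbol with a given number. -/
def numSym : ℕ → Option Bool
  | 0 => none
  | 1 => some false
  | _ => some true

@[simp] theorem numSym_symNum (x : Option Bool) : numSym (symNum x) = x := by
  rcases x with _ | _ | _ <;> rfl

/-- The number of a movement. -/
def moveNum : Move → ℕ
  | .stay => 0
  | .left => 1
  | .right => 2

theorem moveNum_le (m : Move) : moveNum m ≤ 2 := by cases m <;> simp [moveNum]

/-- A function on input heads and a function on work heads, as a function of numbers. -/
def joinHeads {α : Type} {t k : ℕ} (d : α) (x : Fin t → α) (y : Fin k → α) (h : ℕ) : α :=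
  if h1 : h < t then x ⟨h, h1⟩ else if h2 : h - t < k then y ⟨h - t, h2⟩ else d

theorem joinHeads_left {α : Type} {t k : ℕ} {d : α} {x : Fin t → α} {y : Fin k → α} {h : ℕ}
    (h1 : h < t) : joinHeads d x y h = x ⟨h, h1⟩ := by simp [joinHeads, h1]

theorem joinHeads_right {α : Type} {t k : ℕ} {d : α} {x : Fin t → α} {y : Fin k → α} (h : ℕ)
    (h1 : h < k) : joinHeads d x y (t + h) = y ⟨h, h1⟩ := by simp [joinHeads, h1]

section Encoding

variable {t k : ℕ} {Q : Type} (e : Q → ℕ)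

/-- The table entries of an action. -/
def actionField (A : Option (Action t k Q)) (j : ℕ) : ℕ :=
  match A with
  | none => 0
  | some A =>
    if j = 0 then e A.next + 1
    else if j = 1 then symNum A.emit
    else if j % 2 = 0 then moveNum (joinHeads .stay A.inMove A.workMove ((j - 2) / 2))
    else symNum (joinHeads none (fun _ : Fin t => none) A.write ((j - 2) / 2))

/-- Explains the base `numStates + 3` of the code: an entry is a state number plus one or a number
up to `2`. -/
theorem actionField_lt {n : ℕ} (he : ∀ q, e q < n) (A : Option (Action t k Q)) (j : ℕ) :
    actionField e A j < n + 3 := by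
  rcases A with _ | A
  · simp [actionField]
  · simp only [actionField]
    have := he A.next
    have := symNum_le A.emit
    have := moveNum_le (joinHeads .stay A.inMove A.workMove ((j - 2) / 2))
    have := symNum_le (joinHeads none (fun _ : Fin t => none) A.write ((j - 2) / 2))
    split_ifs <;> omega

end Encoding

namespace OfflineTM

variable {t : ℕ} (M : OfflineTM t)

/-- A numbering of the states. -/
noncomputable def stateNum (q : M.State) : ℕ :=
  letI := M.fin
  (Fintype.equivFin M.State q).val

/-- The number of states. -/
def numStates : ℕ :=
  letI := M.fin
  Fintype.card M.State

theorem stateNum_lt (q : M.State) : M.stateNum q < M.numStates := Fin.is_lt _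

theorem stateNum_injective : Function.Injective M.stateNum := by
  let := M.fin
  intro a b h
  exact (Fintype.equivFin M.State).injective (Fin.ext h)

open Classical in
/-- The state with a given number. -/
noncomputable def numState (n : ℕ) : M.State :=
  if h : ∃ q, M.stateNum q = n then h.choose else M.start

@[simp] theorem numState_stateNum (q : M.State) : M.numState (M.stateNum q) = q := by
  have h : ∃ q', M.stateNum q' = M.stateNum q := ⟨q, rfl⟩
  rw [numState, dif_pos h]
  exact M.stateNum_injective h.choose_spec

/-- The transition table. -/
noncomputable def table (j : ℕ) : ℕ :=
  if j = 0 then M.stateNum M.start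
  else
    let j := j - 1
    let r := j / (2 * (t + M.k) + 2)
    actionField M.stateNum (M.δ (M.numState (r / 3 ^ (t + M.k)))
      (fun h => numSym (dig 3 (r % 3 ^ (t + M.k)) h))
      (fun h => numSym (dig 3 (r % 3 ^ (t + M.k)) (t + h)))) (j % (2 * (t + M.k) + 2))

/-- The length of the transition table. -/
def tableLen : ℕ := 1 + M.numStates * 3 ^ (t + M.k) * (2 * (t + M.k) + 2)

/-- The transition table as a number. -/
noncomputable def code : ℕ := undig (M.numStates + 3) M.tableLen M.table

theorem dig_code {j : ℕ} (hj : j < M.tableLen) : dig (M.numStates + 3) M.code j = M.table j := by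
  refine dig_undig (fun j _ => ?_) hj
  simp only [table]
  split_ifs
  · have := M.stateNum_lt M.start
    omega
  · exact actionField_lt _ M.stateNum_lt _ _

variable {M}

theorem table_row (q : M.State) (x : Fin t → Option Bool) (y : Fin M.k → Option Bool) {e : ℕ}
    (he : e < 2 * (t + M.k) + 2) :
    dig (M.numStates + 3) M.code (1 + ((M.stateNum q * 3 ^ (t + M.k) +
      undig 3 (t + M.k) (fun h => symNum (joinHeads none x y h))) * (2 * (t + M.k) + 2) + e)) =
      actionField M.stateNum (M.δ q x y) e := by
  set R := undig 3 (t + M.k) (fun h => symNum (joinHeads none x y h)) with hR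
  have h3 : ∀ h < t + M.k, symNum (joinHeads none x y h) < 3 := fun h _ =>
    Nat.lt_succ_of_le (symNum_le _)
  have hlt : R < 3 ^ (t + M.k) := undig_lt h3
  have hq := M.stateNum_lt q
  have hF : 0 < 2 * (t + M.k) + 2 := by omega
  have hP : 0 < 3 ^ (t + M.k) := by positivity
  have e1 : ((M.stateNum q * 3 ^ (t + M.k) + R) * (2 * (t + M.k) + 2) + e) /
      (2 * (t + M.k) + 2) = M.stateNum q * 3 ^ (t + M.k) + R := by
    rw [mul_comm, Nat.mul_add_div hF, Nat.div_eq_of_lt he, add_zero]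
  have e2 : ((M.stateNum q * 3 ^ (t + M.k) + R) * (2 * (t + M.k) + 2) + e) %
      (2 * (t + M.k) + 2) = e := by
    rw [mul_comm, Nat.mul_add_mod, Nat.mod_eq_of_lt he]
  have e3 : (M.stateNum q * 3 ^ (t + M.k) + R) / 3 ^ (t + M.k) = M.stateNum q := by
    rw [mul_comm, Nat.mul_add_div hP, Nat.div_eq_of_lt hlt, add_zero]
  have e4 : (M.stateNum q * 3 ^ (t + M.k) + R) % 3 ^ (t + M.k) = R := by
    rw [mul_comm, Nat.mul_add_mod, Nat.mod_eq_of_lt hlt]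
  rw [dig_code]
  · simp only [table]
    rw [if_neg (by omega), Nat.add_sub_cancel_left, e1, e2, e3, e4, numState_stateNum]
    congr 2
    · funext h
      rw [hR, dig_undig h3 (by omega), numSym_symNum, joinHeads_left h.2]
    · funext h
      rw [hR, dig_undig h3 (by omega), numSym_symNum, joinHeads_right _ h.2]
  · rw [tableLen]
    have h1 : M.stateNum q * 3 ^ (t + M.k) + R + 1 ≤ M.numStates * 3 ^ (t + M.k) := by
      calc _ ≤ (M.stateNum q + 1) * 3 ^ (t + M.k) := by rw [add_mul, one_mul]; omega
        _ ≤ _ := Nat.mul_le_mul_right _ hq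
    have h2 := Nat.mul_le_mul_right (2 * (t + M.k) + 2) h1
    rw [add_mul _ 1, one_mul] at h2
    omega

/-- The number of the symbol in a represented work cell. -/
def cellNum (M : OfflineTM t) (L : ℕ) (c : M.Cfg) (z : ℕ) : ℕ :=
  if h : z / (2 * L + 1) < M.k then
    symNum (c.tape ⟨z / (2 * L + 1), h⟩ ((z % (2 * L + 1) : ℕ) - (L : ℤ)))
  else 0

/-- The numerical position of a head. -/
def posNum (M : OfflineTM t) (L : ℕ) (c : M.Cfg) (h : ℕ) : ℕ :=
  joinHeads 0 c.inPos (fun i => (c.pos i + L).toNat) h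

/-- The numerical configuration of a configuration. -/
noncomputable def encCfg (M : OfflineTM t) (L P : ℕ) (c : M.Cfg) : SimSt where
  q := M.stateNum c.state
  T := undig 3 (M.k * (2 * L + 1)) (M.cellNum L c)
  X := undig P (t + M.k) (M.posNum L c)

/-- The heads are within the represented parts of the tapes. -/
structure Within (M : OfflineTM t) (inp : Fin t → List Bool) (L : ℕ) (c : M.Cfg) : Prop where
  inPos : ∀ j, c.inPos j ≤ (inp j).length + 1
  pos : ∀ i, |c.pos i| ≤ (L : ℤ)

/-! ### Numerical steps mirror machine steps -/

section Step

variable {inp : Fin t → List Bool} {L : ℕ} {c c' : M.Cfg} {S : Sim}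

/-- The simulation data fit the machine, its input and its space bound. -/
structure Fits (M : OfflineTM t) (inp : Fin t → List Bool) (L : ℕ) (S : Sim) : Prop where
  k : S.k = M.k
  d : S.d = M.numStates + 3
  i : S.i = M.code
  W : S.W = 2 * L + 1
  P : ∀ j, (inp j).length + 1 < S.P
  P' : 2 * L < S.P
  rd : ∀ (j : Fin t) p, S.rd j p = symNum (readInput (inp j) p)

theorem posNum_lt (hS : M.Fits inp L S) (hc : M.Within inp L c) (h : ℕ) :
    M.posNum L c h < S.P := by
  have hP := hS.P'
  rw [posNum, joinHeads]
  split_ifs with h1 h2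
  · exact (hc.inPos _).trans_lt (hS.P _)
  · have := abs_le.1 (hc.pos ⟨h - t, h2⟩)
    omega
  · omega

theorem pos_encCfg (hS : M.Fits inp L S) (hc : M.Within inp L c) {h : ℕ} (hh : h < t + M.k) :
    S.pos (M.encCfg L S.P c) h = M.posNum L c h :=
  dig_undig (fun h _ => posNum_lt hS hc h) hh

theorem cellNum_lt (c : M.Cfg) (z : ℕ) : M.cellNum L c z < 3 := by
  rw [cellNum]
  split_ifs
  · exact Nat.lt_succ_of_le (symNum_le _)
  · norm_num

theorem dig_encCfg_T {P z : ℕ} (hz : z < M.k * (2 * L + 1)) :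
    dig 3 (M.encCfg L P c).T z = M.cellNum L c z :=
  dig_undig (fun z _ => cellNum_lt c z) hz

theorem sym_encCfg (hS : M.Fits inp L S) (hc : M.Within inp L c) {h : ℕ} (hh : h < t + M.k) :
    S.sym t (M.encCfg L S.P c) h = symNum (joinHeads none
      (fun i => readInput (inp i) (c.inPos i)) (fun i => c.tape i (c.pos i)) h) := by
  rw [Sim.sym, pos_encCfg hS hc hh]
  split_ifs with h1
  · rw [joinHeads_left h1, posNum, joinHeads_left h1]
    exact hS.rd ⟨h, h1⟩ _
  · obtain ⟨i, rfl⟩ : ∃ i, h = t + i := ⟨h - t, by omega⟩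
    have hi : i < M.k := by omega
    have hb := abs_le.1 (hc.pos ⟨i, hi⟩)
    obtain ⟨p, hp⟩ : ∃ p : ℕ, c.pos ⟨i, hi⟩ + L = p := ⟨_, (Int.toNat_of_nonneg (by omega)).symm⟩
    have hp' : p < 2 * L + 1 := by omega
    rw [joinHeads_right i hi, posNum, joinHeads_right i hi, hp, Int.toNat_natCast,
      Nat.add_sub_cancel_left, hS.W, dig_encCfg_T]
    · have e1 : (i * (2 * L + 1) + p) / (2 * L + 1) = i := by
        rw [mul_comm, Nat.mul_add_div (by omega), Nat.div_eq_of_lt hp', add_zero]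
      have e2 : (i * (2 * L + 1) + p) % (2 * L + 1) = p := by
        rw [mul_comm, Nat.mul_add_mod, Nat.mod_eq_of_lt hp']
      simp only [cellNum, e1, e2]
      rw [dif_pos hi]
      congr 2
      omega
    · calc i * (2 * L + 1) + p < (i + 1) * (2 * L + 1) := by rw [add_mul, one_mul]; omega
        _ ≤ _ := Nat.mul_le_mul_right _ hi

/-- The transition taken in a configuration. -/
def trans (M : OfflineTM t) (inp : Fin t → List Bool) (c : M.Cfg) : Option (Action t M.k M.State) :=
  M.δ c.state (fun i => readInput (inp i) (c.inPos i)) (fun i => c.tape i (c.pos i))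

theorem undig_congr {B n : ℕ} {f g : ℕ → ℕ} (h : ∀ x < n, f x = g x) :
    undig B n f = undig B n g :=
  Finset.sum_congr rfl fun x hx => by rw [h x (Finset.mem_range.1 hx)]

theorem field_encCfg (hS : M.Fits inp L S) (hc : M.Within inp L c) {e : ℕ}
    (he : e < 2 * (t + M.k) + 2) :
    S.field t (M.encCfg L S.P c) e = actionField M.stateNum (M.trans inp c) e := by
  rw [Sim.field, Sim.idx, hS.k, hS.d, hS.i,
    undig_congr (fun h hh => sym_encCfg hS hc hh)]
  exact table_row _ _ _ he

theorem field_zero_encCfg (hS : M.Fits inp L S) (hc : M.Within inp L c) :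
    S.field t (M.encCfg L S.P c) 0 = 0 ↔ M.step inp c = none := by
  rw [field_encCfg hS hc (by omega), step, Option.map_eq_none_iff, ← trans]
  rcases M.trans inp c with _ | A <;> simp [actionField]

theorem Within.step (hc : M.Within inp L c) (h : M.step inp c = some c')
    (hp : ∀ i, |c'.pos i| ≤ (L : ℤ)) : M.Within inp L c' := by
  refine ⟨fun j => ?_, hp⟩
  rw [OfflineTM.step, Option.map_eq_some_iff] at h
  obtain ⟨A, -, rfl⟩ := h
  have := hc.inPos j
  simp only
  cases A.inMove j <;> simp only [moveInput] <;> omega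

theorem newPos_encCfg (hS : M.Fits inp L S) (hc : M.Within inp L c) (h : M.step inp c = some c')
    (hc' : M.Within inp L c') {a : ℕ} (ha : a < t + M.k) :
    S.newPos t (M.encCfg L S.P c) a = M.posNum L c' a := by
  have hlt := posNum_lt hS hc' a
  rw [OfflineTM.step, Option.map_eq_some_iff] at h
  obtain ⟨A, hA, rfl⟩ := h
  rw [Sim.newPos, field_encCfg hS hc (by omega), pos_encCfg hS hc ha, trans, hA]
  have e1 : actionField M.stateNum (some A) (2 + 2 * a) =
      moveNum (joinHeads .stay A.inMove A.workMove a) := by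
    simp only [actionField]
    rw [if_neg (by omega), if_neg (by omega), if_pos (by omega)]
    congr 2
    omega
  rw [e1]
  suffices H : (if moveNum (joinHeads .stay A.inMove A.workMove a) = 1 then M.posNum L c a - 1
      else if moveNum (joinHeads .stay A.inMove A.workMove a) = 2 then
        (if a < t ∧ 0 < M.posNum L c a ∧ S.rd a (M.posNum L c a) = 0 then M.posNum L c a
          else M.posNum L c a + 1)
      else M.posNum L c a) = M.posNum L
        { state := A.next
          inPos := fun i => moveInput (inp i).length (A.inMove i) (c.inPos i)
          tape := fun i => Function.update (c.tape i) (c.pos i) (A.write i)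
          pos := fun i => moveWork (A.workMove i) (c.pos i)
          out := c.out ++ A.emit.toList } a by
    rw [H]
    exact min_eq_left (by omega)
  rcases lt_or_ge a t with h1 | h1
  · have hin := hc.inPos ⟨a, h1⟩
    have hr : ∀ p, S.rd a p = symNum (readInput (inp ⟨a, h1⟩) p) := hS.rd ⟨a, h1⟩
    simp only [posNum, joinHeads_left h1, hr]
    cases A.inMove ⟨a, h1⟩ with
    | left => simp [moveNum, moveInput]
    | stay => simp [moveNum, moveInput]
    | right =>
      simp only [moveNum, moveInput, h1, true_and]
      rcases hq : c.inPos ⟨a, h1⟩ with _ | q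
      · simp
      · rw [hq] at hin
        have hz : symNum (readInput (inp ⟨a, h1⟩) (q + 1)) = 0 ↔ ¬ q < (inp ⟨a, h1⟩).length := by
          rw [← symNum_readInput_ne_zero, not_not]
        simp only [hz]
        split_ifs <;> omega
  · obtain ⟨i, rfl⟩ : ∃ i, a = t + i := ⟨a - t, by omega⟩
    have hi : i < M.k := by omega
    have hb := abs_le.1 (hc.pos ⟨i, hi⟩)
    have hb' := abs_le.1 (hc'.pos ⟨i, hi⟩)
    simp only [posNum, joinHeads_right i hi] at hb' ⊢
    cases hm : A.workMove ⟨i, hi⟩ with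
    | left => simp only [hm, moveNum, moveWork] at hb' ⊢; simp; omega
    | stay => simp [moveNum, moveWork]
    | right => simp only [hm, moveNum, moveWork] at hb' ⊢; simp; omega

theorem newCell_encCfg (hS : M.Fits inp L S) (hc : M.Within inp L c) (h : M.step inp c = some c')
    {z : ℕ} (hz : z < M.k * (2 * L + 1)) :
    S.newCell t (M.encCfg L S.P c) z = M.cellNum L c' z := by
  rw [OfflineTM.step, Option.map_eq_some_iff] at h
  obtain ⟨A, hA, rfl⟩ := h
  have hi : z / (2 * L + 1) < M.k := (Nat.div_lt_iff_lt_mul (by omega)).2 hz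
  have hm : z % (2 * L + 1) < 2 * L + 1 := Nat.mod_lt _ (by omega)
  rw [Sim.newCell, hS.W, pos_encCfg hS hc (by omega), dig_encCfg_T hz,
    field_encCfg hS hc (by omega), trans, hA, posNum, joinHeads_right _ hi, cellNum, cellNum,
    dif_pos hi, dif_pos hi]
  have hb := abs_le.1 (hc.pos ⟨z / (2 * L + 1), hi⟩)
  have e1 : actionField M.stateNum (some A) (3 + 2 * (t + z / (2 * L + 1))) =
      symNum (A.write ⟨z / (2 * L + 1), hi⟩) := by
    simp only [actionField]
    rw [if_neg (by omega), if_neg (by omega), if_neg (by omega)]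
    have : (3 + 2 * (t + z / (2 * L + 1)) - 2) / 2 = t + z / (2 * L + 1) := by omega
    rw [this, joinHeads_right _ hi]
  rw [e1, min_eq_left (symNum_le _)]
  simp only [Function.update_apply]
  split_ifs with h1 h2 h2
  · rfl
  · omega
  · omega
  · rfl

theorem succ_encCfg (hS : M.Fits inp L S) (hc : M.Within inp L c) (h : M.step inp c = some c')
    (hc' : M.Within inp L c') : S.succ t (M.encCfg L S.P c) = M.encCfg L S.P c' := by
  ext
  · simp only [Sim.succ, encCfg]
    rw [← encCfg, field_encCfg hS hc (by omega)]
    rw [OfflineTM.step, Option.map_eq_some_iff] at h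
    obtain ⟨A, hA, rfl⟩ := h
    rw [trans, hA]
    simp [actionField]
  · simp only [Sim.succ]
    rw [hS.k, hS.W]
    exact undig_congr fun z hz => newCell_encCfg hS hc h hz
  · simp only [Sim.succ]
    rw [hS.k]
    exact undig_congr fun a ha => newPos_encCfg hS hc h hc' ha

theorem start_encCfg (hS : M.Fits inp L S) : S.start t = M.encCfg L S.P M.init := by
  ext
  · simp only [Sim.start, encCfg, init]
    rw [hS.d, hS.i, dig_code _ (by rw [tableLen]; omega)]
    simp [table]
  · simp only [Sim.start, encCfg]
    refine (Finset.sum_eq_zero fun z _ => ?_).symm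
    simp [cellNum, init, symNum]
  · simp only [Sim.start, encCfg]
    rw [hS.k, hS.W]
    refine undig_congr fun a ha => ?_
    have : (2 * L + 1) / 2 = L := by omega
    rw [this]
    split_ifs with h1
    · rw [posNum, joinHeads_left h1]; rfl
    · obtain ⟨i, rfl⟩ : ∃ i, a = t + i := ⟨a - t, by omega⟩
      rw [posNum, joinHeads_right i (by omega)]
      simp [init]

/-- The configuration after `n` steps. -/
def cfgAt (M : OfflineTM t) (inp : Fin t → List Bool) : ℕ → M.Cfg
  | 0 => M.init
  | n + 1 => (M.step inp (M.cfgAt inp n)).getD (M.cfgAt inp n)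

theorem reaches_cfgAt (n : ℕ) : StateTransition.Reaches (M.step inp) M.init (M.cfgAt inp n) := by
  induction n with
  | zero => exact .refl
  | succ n ih =>
    rw [cfgAt]
    rcases h : M.step inp (M.cfgAt inp n) with _ | c
    · exact ih
    · exact ih.tail h

theorem exists_cfgAt (h : StateTransition.Reaches (M.step inp) M.init c) :
    ∃ n, M.cfgAt inp n = c := by
  induction h with
  | refl => exact ⟨0, rfl⟩
  | tail _ h ih =>
    obtain ⟨n, rfl⟩ := ih
    refine ⟨n + 1, ?_⟩
    rw [cfgAt, Option.mem_def.1 h]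
    rfl

theorem cfgAt_of_halted {n m : ℕ} (h : M.step inp (M.cfgAt inp n) = none) (hm : n ≤ m) :
    M.cfgAt inp m = M.cfgAt inp n := by
  induction m, hm using Nat.le_induction with
  | base => rfl
  | succ m _ ih => rw [cfgAt, ih, h]; rfl

theorem within_cfgAt (hb : ∀ c, StateTransition.Reaches (M.step inp) M.init c →
    ∀ i, |c.pos i| ≤ (L : ℤ)) (n : ℕ) : M.Within inp L (M.cfgAt inp n) := by
  induction n with
  | zero => exact ⟨fun j => Nat.zero_le _, hb _ .refl⟩
  | succ n ih =>
    have h1 := hb _ (M.reaches_cfgAt (inp := inp) (n + 1))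
    rw [cfgAt] at h1 ⊢
    rcases h : M.step inp (M.cfgAt inp n) with _ | c
    · exact ih
    · rw [h] at h1
      exact ih.step h h1

/-- The output can be much longer than the available space, so the simulation carries only the value
of a fold over the bits emitted so far. -/
theorem run_eq (hS : M.Fits inp L S) (hb : ∀ c, StateTransition.Reaches (M.step inp) M.init c →
    ∀ i, |c.pos i| ≤ (L : ℤ)) (g : ℕ → ℕ → ℕ) (a₀ n : ℕ) :
    S.run t g a₀ n = (M.encCfg L S.P (M.cfgAt inp n),
      (M.cfgAt inp n).out.foldl (fun a b => g a b.toNat) a₀) := by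
  induction n with
  | zero => rw [Sim.run, start_encCfg hS]; rfl
  | succ n ih =>
    have h0 := within_cfgAt hb n
    have h1 := within_cfgAt hb (n + 1)
    rw [cfgAt] at h1 ⊢
    simp only [Sim.run, ih]
    rcases h : M.step inp (M.cfgAt inp n) with _ | c
    · rw [if_pos ((field_zero_encCfg hS h0).2 h)]
      rfl
    · rw [h, Option.getD_some] at h1
      have hne : ¬ S.field t (M.encCfg L S.P (M.cfgAt inp n)) 0 = 0 := fun h' => by
        rw [field_zero_encCfg hS h0, h] at h'
        cases h'
      rw [if_neg hne,
        succ_encCfg hS h0 h h1, Option.getD_some, field_encCfg hS h0 (by omega)]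
      rw [OfflineTM.step, Option.map_eq_some_iff] at h
      obtain ⟨A, hA, rfl⟩ := h
      rw [trans, hA]
      simp only [actionField, Prod.mk.injEq, true_and, List.foldl_append]
      rcases A.emit with _ | _ | _ <;> simp [symNum]

theorem encCfg_mem (hS : M.Fits inp L S) (hc : M.Within inp L c) :
    ((M.encCfg L S.P c).q, (M.encCfg L S.P c).T, (M.encCfg L S.P c).X) ∈
      Finset.range S.d ×ˢ Finset.range (3 ^ (S.k * S.W)) ×ˢ Finset.range (S.P ^ (t + S.k)) := by
  simp only [Finset.mem_product, Finset.mem_range, hS.d, hS.k, hS.W]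
  refine ⟨?_, undig_lt fun z _ => cellNum_lt c z, undig_lt fun h _ => posNum_lt hS hc h⟩
  have := M.stateNum_lt c.state
  simp only [encCfg]
  omega

/-- Pigeonhole: among the first `steps + 1` configurations two have the same code if the run is that
long. The run then repeats, and the first halting time could be moved forward. -/
theorem exists_halted_lt (hS : M.Fits inp L S)
    (hb : ∀ c, StateTransition.Reaches (M.step inp) M.init c → ∀ i, |c.pos i| ≤ (L : ℤ))
    (hh : ∃ n, M.step inp (M.cfgAt inp n) = none) :
    ∃ n < S.steps t, M.step inp (M.cfgAt inp n) = none := by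
  classical
  refine ⟨Nat.find hh, ?_, Nat.find_spec hh⟩
  by_contra hlt
  push Not at hlt
  -- By `run_eq` the code of a configuration determines the next code; the output, which is not part
  -- of the code, plays no role.
  have hshift : ∀ a b, M.encCfg L S.P (M.cfgAt inp a) = M.encCfg L S.P (M.cfgAt inp b) →
      ∀ j, M.encCfg L S.P (M.cfgAt inp (a + j)) = M.encCfg L S.P (M.cfgAt inp (b + j)) := by
    intro a b hab j
    induction j with
    | zero => exact hab
    | succ j ih =>
      have h1 := congrArg Prod.fst (run_eq hS hb (fun a _ => a) 0 (a + j + 1))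
      have h2 := congrArg Prod.fst (run_eq hS hb (fun a _ => a) 0 (b + j + 1))
      simp only [Sim.run, run_eq hS hb] at h1 h2
      rw [← add_assoc, ← add_assoc, ← h1, ← h2, ih]
      split_ifs <;> first | exact ih | rfl
  obtain ⟨a, ha, b, hb', hab, heq⟩ := Finset.exists_ne_map_eq_of_card_lt_of_maps_to
    (s := Finset.range (S.steps t + 1))
    (f := fun n => ((M.encCfg L S.P (M.cfgAt inp n)).q, (M.encCfg L S.P (M.cfgAt inp n)).T,
      (M.encCfg L S.P (M.cfgAt inp n)).X))
    (t := Finset.range S.d ×ˢ Finset.range (3 ^ (S.k * S.W)) ×ˢ Finset.range (S.P ^ (t + S.k)))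
    (by
      simp only [Finset.card_product, Finset.card_range, Sim.steps]
      rw [mul_assoc]
      exact Nat.lt_succ_self _)
    (fun n _ => encCfg_mem hS (within_cfgAt hb n))
  wlog hlt' : a < b generalizing a b
  · exact this b hb' a ha hab.symm heq.symm (by omega)
  rw [Finset.mem_range] at ha hb'
  simp only [Prod.mk.injEq] at heq
  -- Cutting out the segment from `a` to `b` gives a halted configuration before the first halting
  -- time.
  have h1 := hshift a b (SimSt.ext heq.1 heq.2.1 heq.2.2) (Nat.find hh - b)
  rw [Nat.add_sub_cancel' (by omega)] at h1
  have h2 := (field_zero_encCfg hS (within_cfgAt hb (Nat.find hh))).2 (Nat.find_spec hh)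
  rw [← h1, field_zero_encCfg hS (within_cfgAt hb _)] at h2
  exact Nat.find_min hh (by omega) h2

/-- The numerical simulation computes folds over the output of the machine. -/
theorem OutputsInSpace.fold_eq {o : List Bool} (h : M.OutputsInSpace inp o L)
    (hS : M.Fits inp L S) (g : ℕ → ℕ → ℕ) (a₀ : ℕ) :
    S.fold t g a₀ = o.foldl (fun a b => g a b.toNat) a₀ := by
  obtain ⟨⟨c, hc, rfl⟩, hb⟩ := h
  obtain ⟨h1, h2⟩ := StateTransition.mem_eval.1 hc
  obtain ⟨n, rfl⟩ := exists_cfgAt h1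
  obtain ⟨m, hm, hm'⟩ := exists_halted_lt hS hb ⟨n, h2⟩
  rw [Sim.fold, run_eq hS hb, cfgAt_of_halted hm' hm.le]
  rcases le_total n m with h | h
  · rw [cfgAt_of_halted h2 h]
  · rw [cfgAt_of_halted hm' h]

theorem OutputsInSpace.mono {o : List Bool} {L' : ℕ} (h : M.OutputsInSpace inp o L)
    (hL : L ≤ L') : M.OutputsInSpace inp o L' :=
  ⟨h.1, fun c hc i => (h.2 c hc i).trans (by exact_mod_cast hL)⟩

end Step

end OfflineTM

/-! ### The simulation in bounded space -/

variable {t n : ℕ} {Γ Γ' : Type} {c : Ctx t Γ} {c' : Ctx t Γ'} {π : Γ' → Γ}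

theorem Fam₂.ext {F : Γ → ℕ → ℕ → ℕ} (h : Fam₂ c F) (e : c'.Ext c π) :
    Fam₂ c' fun x => F (π x) :=
  fun _ c'' π' k l e' hk hl => h c'' (fun x => π (π' x)) k l (e'.trans e) hk hl

theorem Fam₂.apply {F : Γ → ℕ → ℕ → ℕ} (h : Fam₂ c F) {k l : Γ → ℕ} (hk : Impl c k)
    (hl : Impl c l) : Impl c fun γ => F γ (k γ) (l γ) :=
  h c id k l (.refl c) hk hl

/-- A family of simulations, with `n` input tapes, whose data are implementable. -/
structure Sim.Good (c : Ctx t Γ) (n : ℕ) (S : Γ → Sim) : Prop where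
  k : Impl c fun γ => (S γ).k
  d : Impl c fun γ => (S γ).d
  i : Impl c fun γ => (S γ).i
  W : Impl c fun γ => (S γ).W
  P : Impl c fun γ => (S γ).P
  rd : Fam₂ c fun γ => (S γ).rd
  rd_le : ∀ γ j p, (S γ).rd j p ≤ 2
  pos_P : ∀ γ, (S γ).W / 2 < (S γ).P
  bdd_sym : Bdd c fun γ => 3 ^ (n + (S γ).k)
  bdd_T : Bdd c fun γ => 3 ^ ((S γ).k * (S γ).W)
  bdd_X : Bdd c fun γ => (S γ).P ^ (n + (S γ).k)

theorem Sim.Good.ext {S : Γ → Sim} (h : Sim.Good c n S) (e : c'.Ext c π) :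
    Sim.Good c' n fun x => S (π x) where
  k := h.k.ext e
  d := h.d.ext e
  i := h.i.ext e
  W := h.W.ext e
  P := h.P.ext e
  rd := h.rd.ext e
  rd_le := fun _ => h.rd_le _
  pos_P := fun _ => h.pos_P _
  bdd_sym := h.bdd_sym.ext e
  bdd_T := h.bdd_T.ext e
  bdd_X := h.bdd_X.ext e

/-- A family of numerical configurations is implementable. -/
structure ImplSt (c : Ctx t Γ) (x : Γ → SimSt) : Prop where
  q : Impl c fun γ => (x γ).q
  T : Impl c fun γ => (x γ).T
  X : Impl c fun γ => (x γ).X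

theorem ImplSt.ext {x : Γ → SimSt} (h : ImplSt c x) (e : c'.Ext c π) :
    ImplSt c' fun y => x (π y) :=
  ⟨h.q.ext e, h.T.ext e, h.X.ext e⟩

namespace Sim.Good

variable {S : Γ → Sim} {x : Γ → SimSt} {h : Γ → ℕ}

theorem implPos (hS : Sim.Good c n S) (hx : ImplSt c x) (hh : Impl c h) :
    Impl c fun γ => (S γ).pos (x γ) (h γ) :=
  hS.P.dig hx.X hh

theorem implSym (hS : Sim.Good c n S) (hx : ImplSt c x) (hh : Impl c h) :
    Impl c fun γ => (S γ).sym n (x γ) (h γ) :=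
  .if (hh.lt (.const n)) (hS.rd.apply hh (hS.implPos hx hh))
    ((Impl.const 3).dig hx.T (((hh.sub (.const n)).mul hS.W).add (hS.implPos hx hh)))

theorem sym_lt (hS : Sim.Good c n S) (γ : Γ) (y : SimSt) (a : ℕ) : (S γ).sym n y a < 3 := by
  rw [Sim.sym]
  split_ifs
  · exact Nat.lt_succ_of_le (hS.rd_le _ _ _)
  · exact Nat.mod_lt _ (by norm_num)

theorem implIdx (hS : Sim.Good c n S) (hx : ImplSt c x) :
    Impl c fun γ => (S γ).idx n (x γ) :=
  (hx.q.mul ((Impl.const 3).pow ((Impl.const n).add hS.k) hS.bdd_sym)).add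
    (Impl.undig (.const 3) ((Impl.const n).add hS.k)
      (fun _ _ _ _ e hk _ => (hS.ext e).implSym (hx.ext e) hk) (fun γ _ _ => hS.sym_lt γ _ _)
      hS.bdd_sym)

theorem implField (hS : Sim.Good c n S) (hx : ImplSt c x) (hh : Impl c h) :
    Impl c fun γ => (S γ).field n (x γ) (h γ) :=
  hS.d.dig hS.i ((Impl.const 1).add (((hS.implIdx hx).mul
    (((Impl.const 2).mul ((Impl.const n).add hS.k)).add (.const 2))).add hh))

theorem implNewPos (hS : Sim.Good c n S) (hx : ImplSt c x) (hh : Impl c h) :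
    Impl c fun γ => (S γ).newPos n (x γ) (h γ) := by
  have hp := hS.implPos hx hh
  have hf := hS.implField hx ((Impl.const 2).add ((Impl.const 2).mul hh))
  exact Impl.min (.if (hf.eq (.const 1)) hp.pred (.if (hf.eq (.const 2))
    (.if ((hh.lt (.const n)).and (((Impl.const 0).lt hp).and ((hS.rd.apply hh hp).eq (.const 0))))
      hp hp.succ) hp)) hS.P.pred

theorem implNewCell (hS : Sim.Good c n S) (hx : ImplSt c x) (hh : Impl c h) :
    Impl c fun γ => (S γ).newCell n (x γ) (h γ) := by
  have ha := (Impl.const n).add (hh.div hS.W)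
  exact .if ((hh.mod hS.W).eq (hS.implPos hx ha))
    (Impl.min (hS.implField hx ((Impl.const 3).add ((Impl.const 2).mul ha))) (.const 2))
    ((Impl.const 3).dig hx.T hh)

theorem newPos_lt (hS : Sim.Good c n S) (γ : Γ) (y : SimSt) (a : ℕ) :
    (S γ).newPos n y a < (S γ).P := by
  have := hS.pos_P γ
  rw [Sim.newPos]
  omega

theorem newCell_lt (γ : Γ) (y : SimSt) (a : ℕ) : (S γ).newCell n y a < 3 := by
  rw [Sim.newCell]
  split_ifs
  · omega
  · exact Nat.mod_lt _ (by norm_num)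

theorem implSucc (hS : Sim.Good c n S) (hx : ImplSt c x) :
    ImplSt c fun γ => (S γ).succ n (x γ) where
  q := (hS.implField hx (.const 0)).pred
  T := Impl.undig (.const 3) (hS.k.mul hS.W)
    (fun _ _ _ _ e hk _ => (hS.ext e).implNewCell (hx.ext e) hk) (fun γ _ _ => newCell_lt γ _ _)
    hS.bdd_T
  X := Impl.undig hS.P ((Impl.const n).add hS.k)
    (fun _ _ _ _ e hk _ => (hS.ext e).implNewPos (hx.ext e) hk) (fun γ _ _ => hS.newPos_lt γ _ _)
    hS.bdd_X

theorem implStart (hS : Sim.Good c n S) : ImplSt c fun γ => (S γ).start n where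
  q := hS.d.dig hS.i (.const 0)
  T := .zero
  X := by
    refine Impl.undig hS.P ((Impl.const n).add hS.k) (fun _ _ _ _ e hk _ =>
      .if (hk.lt (.const n)) .zero ((hS.W.ext e).div (.const 2))) (fun γ k _ => ?_) hS.bdd_X
    have := hS.pos_P γ
    split_ifs <;> omega

theorem implSteps (hS : Sim.Good c n S) : Impl c fun γ => (S γ).steps n :=
  (hS.d.mul ((Impl.const 3).pow (hS.k.mul hS.W) hS.bdd_T)).mul
    (hS.P.pow ((Impl.const n).add hS.k) hS.bdd_X)

/-- No machine behind `S` is assumed. Digits and cutoffs bound the coded configuration for arbitrary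
data, and `Z` bounds the accumulated value; this is what permits running candidates that are not
known to be meaningful. -/
theorem implFold (hS : Sim.Good c n S) {g : Γ → ℕ → ℕ → ℕ} {a₀ Z : Γ → ℕ} (hg : Fam₂ c g)
    (ha : Impl c a₀) (hZ : Bdd c Z) (hgZ : ∀ γ a b, g γ a b ≤ Z γ) :
    Impl c fun γ => (S γ).fold n (g γ) (a₀ γ) := by
  let F : ℕ → Γ → ℕ → ℕ
    | 0, γ, m => ((S γ).run n (g γ) (a₀ γ) m).1.q
    | 1, γ, m => ((S γ).run n (g γ) (a₀ γ) m).1.T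
    | 2, γ, m => ((S γ).run n (g γ) (a₀ γ) m).1.X
    | _, γ, m => ((S γ).run n (g γ) (a₀ γ) m).2
  refine Impl.for (F := F) (n := 4) hS.implSteps ?_ ?_ ?_ 3 (by omega)
  · have h := hS.implStart
    rintro (_ | _ | _ | j) hj
    exacts [h.q, h.T, h.X, ha]
  · intro Γ' c' π k e hk _ hF
    let y : Γ' → SimSt × ℕ := fun x => (S (π x)).run n (g (π x)) (a₀ (π x)) (k x)
    have hy : ImplSt c' fun x => (y x).1 :=
      ⟨hF 0 (by omega), hF 1 (by omega), hF 2 (by omega)⟩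
    have ha' : Impl c' fun x => (y x).2 := hF 3 (by omega)
    have hs := (hS.ext e).implSucc hy
    have h0 := ((hS.ext e).implField hy (.const 0)).eq (.const 0)
    have h1 := (hS.ext e).implField hy (.const 1)
    rintro (_ | _ | _ | j) hj
    · refine (Impl.if h0 hy.q hs.q).congr fun x => ?_
      simp only [F, Sim.run, y]
      split_ifs <;> rfl
    · refine (Impl.if h0 hy.T hs.T).congr fun x => ?_
      simp only [F, Sim.run, y]
      split_ifs <;> rfl
    · refine (Impl.if h0 hy.X hs.X).congr fun x => ?_
      simp only [F, Sim.run, y]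
      split_ifs <;> rfl
    · refine (Impl.if h0 ha' (.if (h1.eq (.const 0)) ha'
        ((hg.ext e).apply ha' h1.pred))).congr fun x => ?_
      simp only [F, Sim.run, y]
      split_ifs <;> rfl
  · have hq : ∀ γ m, ((S γ).run n (g γ) (a₀ γ) m).1.q ≤ (S γ).i := by
      intro γ m
      induction m with
      | zero => exact dig_le _ _ _
      | succ m ih =>
        simp only [Sim.run]
        split_ifs
        · exact ih
        all_goals exact (Nat.sub_le _ _).trans (dig_le _ _ _)
    have hT : ∀ γ m, ((S γ).run n (g γ) (a₀ γ) m).1.T ≤ 3 ^ ((S γ).k * (S γ).W) := by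
      intro γ m
      induction m with
      | zero => exact Nat.zero_le _
      | succ m ih =>
        simp only [Sim.run]
        split_ifs
        · exact ih
        all_goals exact (undig_lt fun z _ => newCell_lt γ _ z).le
    have hX : ∀ γ m, ((S γ).run n (g γ) (a₀ γ) m).1.X ≤ (S γ).P ^ (n + (S γ).k) := by
      intro γ m
      induction m with
      | zero =>
        refine (undig_lt fun z _ => ?_).le
        have := hS.pos_P γ
        split_ifs <;> omega
      | succ m ih =>
        simp only [Sim.run]
        split_ifs
        · exact ih
        all_goals exact (undig_lt fun z _ => hS.newPos_lt γ _ z).le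
    have hA : ∀ γ m, ((S γ).run n (g γ) (a₀ γ) m).2 ≤ a₀ γ + Z γ := by
      intro γ m
      induction m with
      | zero => exact Nat.le_add_right _ _
      | succ m ih =>
        simp only [Sim.run]
        split_ifs
        · exact ih
        · exact ih
        · exact (hgZ _ _ _).trans (Nat.le_add_left _ _)
    rintro (_ | _ | _ | j) hj
    · obtain ⟨C, hC⟩ := hS.i.bdd
      exact ⟨C, fun γ m _ => (hq γ m).trans (hC γ)⟩
    · obtain ⟨C, hC⟩ := hS.bdd_T
      exact ⟨C, fun γ m _ => (hT γ m).trans (hC γ)⟩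
    · obtain ⟨C, hC⟩ := hS.bdd_X
      exact ⟨C, fun γ m _ => (hX γ m).trans (hC γ)⟩
    · obtain ⟨C, hC⟩ := ha.bdd.add hZ
      exact ⟨C, fun γ m _ => (hA γ m).trans (hC γ)⟩

end Sim.Good

/-! ### Bit strings as functions of numbers -/

/-- The bit of a string at a position, as a number; `0` beyond the end. -/
def bitAt (l : List Bool) (j : ℕ) : ℕ := (l.getD j false).toNat

theorem bitAt_le (l : List Bool) (j : ℕ) : bitAt l j ≤ 1 := Bool.toNat_le _

theorem symNum_readInput_succ (l : List Bool) (j : ℕ) :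
    symNum (OfflineTM.readInput l (j + 1)) = if j < l.length then bitAt l j + 1 else 0 := by
  simp only [OfflineTM.readInput, bitAt]
  split_ifs with h
  · rw [List.getElem?_eq_getElem h, List.getD_eq_getElem _ _ h]
    cases l[j] <;> rfl
  · rw [List.getElem?_eq_none (by omega)]
    rfl

theorem symNum_readInput_succ_sub (l : List Bool) (j : ℕ) :
    symNum (OfflineTM.readInput l (j + 1)) - 1 = bitAt l j := by
  rw [symNum_readInput_succ]
  split_ifs with h
  · rfl
  · rw [bitAt, List.getD_eq_default _ _ (by omega)]
    rfl

/-- An input tape with given bits. -/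
def virtualTape (n : ℕ) (rb : ℕ → ℕ) (p : ℕ) : ℕ := if 0 < p ∧ p ≤ n then rb (p - 1) + 1 else 0

theorem virtualTape_eq {l : List Bool} {n : ℕ} {rb : ℕ → ℕ} (hl : l.length = n)
    (h : ∀ j < n, rb j = bitAt l j) (p : ℕ) :
    virtualTape n rb p = symNum (OfflineTM.readInput l p) := by
  rcases p with _ | p
  · simp [virtualTape, OfflineTM.readInput, symNum]
  · rw [symNum_readInput_succ, virtualTape, hl]
    by_cases hp : p < n
    · rw [if_pos (by omega), if_pos hp, Nat.add_sub_cancel, h p hp]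
    · rw [if_neg (by omega), if_neg hp]

/-- The number written in `n` bits from a given position on. -/
def numAt (rb : ℕ → ℕ) (off n : ℕ) : ℕ := undig 2 n fun j => rb (off + j)

theorem numAt_lt {rb : ℕ → ℕ} (h : ∀ j, rb j ≤ 1) (off n : ℕ) : numAt rb off n < 2 ^ n :=
  undig_lt fun _ _ => Nat.lt_succ_of_le (h _)

theorem undig_dig_two (n s : ℕ) : undig 2 s (dig 2 n) = n % 2 ^ s := by
  induction s with
  | zero => simp [undig, Nat.mod_one]
  | succ s ih =>
    rw [undig, Finset.sum_range_succ, ← undig, ih, Nat.mod_pow_succ, dig, mul_comm]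

theorem toNat_testBit (n j : ℕ) : (n.testBit j).toNat = dig 2 n j := by
  rw [Nat.testBit_eq_decide_div_mod_eq, dig]
  rcases Nat.mod_two_eq_zero_or_one (n / 2 ^ j) with h | h <;> simp [h]

theorem numAt_eq {rb : ℕ → ℕ} {off s n : ℕ} (hn : n < 2 ^ s)
    (h : ∀ j < s, rb (off + j) = dig 2 n j) : numAt rb off s = n := by
  rw [numAt, OfflineTM.undig_congr h, undig_dig_two, Nat.mod_eq_of_lt hn]

theorem bitAt_ofFn {n : ℕ} (x : Fin n → Bool) {j : ℕ} (hj : j < n) :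
    bitAt (List.ofFn x) j = (x ⟨j, hj⟩).toNat := by
  rw [bitAt, List.getD_eq_getElem _ _ (by simpa using hj)]
  simp

theorem bitAt_append_left {l l' : List Bool} {j : ℕ} (h : j < l.length) :
    bitAt (l ++ l') j = bitAt l j := by
  rw [bitAt, bitAt, List.getD_append _ _ _ _ h]

theorem bitAt_append_right {l l' : List Bool} (j : ℕ) :
    bitAt (l ++ l') (l.length + j) = bitAt l' j := by
  rw [bitAt, bitAt, List.getD_append_right _ _ _ _ (by omega), Nat.add_sub_cancel_left]

theorem eq_map_range_bitAt (l : List Bool) :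
    l = (List.range l.length).map fun k => decide (bitAt l k ≠ 0) := by
  refine List.ext_getElem (by simp) fun j h1 h2 => ?_
  simp only [List.getElem_map, List.getElem_range, bitAt, List.getD_eq_getElem _ _ h1]
  cases l[j] <;> simp

theorem bitAt_bits (n j : ℕ) : bitAt n.bits j = dig 2 n j := by
  rw [← toNat_testBit, Nat.testBit_eq_inth, bitAt]
  rfl

/-! ### Bits of encoded states, automata and pairs -/

section Encodings

variable {w : ℕ}

@[simp] theorem length_encState (q : Fin w) : (encState q).length = w.size := by simp [encState]

theorem bitAt_encState (q : Fin w) {j : ℕ} (hj : j < w.size) :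
    bitAt (encState q) j = dig 2 q j := by
  rw [encState, bitAt_ofFn _ hj, toNat_testBit]

theorem val_lt_two_pow_size (q : Fin w) : q.val < 2 ^ w.size := q.2.trans (Nat.lt_size_self w)

theorem getElem?_flatMap_const {α : Type} {f : α → List Bool} {n : ℕ} (hf : ∀ a, (f a).length = n)
    (l : List α) (i : ℕ) {j : ℕ} (hj : j < n) :
    (l.flatMap f)[i * n + j]? = l[i]?.bind fun a => (f a)[j]? := by
  induction l generalizing i with
  | nil => simp
  | cons a l ih =>
    rw [List.flatMap_cons]
    rcases i with _ | i
    · rw [zero_mul, zero_add, List.getElem?_append_left (by rw [hf]; exact hj)]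
      rfl
    · rw [List.getElem?_append_right (by rw [hf, add_mul]; omega), hf,
        show (i + 1) * n + j - n = i * n + j by rw [add_mul]; omega, ih]
      rfl

theorem length_encAutomaton (Q : Automaton w) : (encAutomaton Q).length = 2 * w * w.size := by
  rw [encAutomaton, List.length_flatMap]
  simp
  ring

theorem bitAt_encAutomaton (Q : Automaton w) (i : Fin w) (b : Bool) {j : ℕ} (hj : j < w.size) :
    bitAt (encAutomaton Q) ((2 * i + b.toNat) * w.size + j) = dig 2 (Q i b) j := by
  have e : (2 * i.val + b.toNat) * w.size + j = i * (w.size + w.size) + (b.toNat * w.size + j) := by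
    ring
  rw [bitAt, List.getD_eq_getElem?_getD, e, encAutomaton,
    getElem?_flatMap_const (n := w.size + w.size) (by simp)]
  · rw [List.getElem?_eq_getElem (by simp), List.getElem_finRange]
    simp only [Option.bind_some, Fin.cast_mk, Fin.eta]
    rw [← bitAt_encState _ hj, bitAt, List.getD_eq_getElem?_getD]
    cases b
    · simp only [Bool.toNat_false, zero_mul, zero_add]
      rw [List.getElem?_append_left (by simpa using hj)]
    · simp only [Bool.toNat_true, one_mul]
      rw [List.getElem?_append_right (by simp), length_encState, Nat.add_sub_cancel_left]
  · cases b <;> simp <;> omega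

/-- The next state according to a transition table given by its bits. -/
def nextAt (rb : ℕ → ℕ) (n q b : ℕ) : ℕ := numAt rb ((2 * q + b) * n) n

theorem nextAt_eq {rb : ℕ → ℕ} {Q : Automaton w}
    (h : ∀ j < 2 * w * w.size, rb j = bitAt (encAutomaton Q) j) (q : Fin w) (b : Bool) :
    nextAt rb w.size q b.toNat = Q q b := by
  refine numAt_eq (val_lt_two_pow_size _) fun j hj => ?_
  rw [h, bitAt_encAutomaton _ _ _ hj]
  have h1 : 2 * q.val + b.toNat + 1 ≤ 2 * w := by
    have := q.2
    have := Bool.toNat_le b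
    omega
  have h2 := Nat.mul_le_mul_right w.size h1
  rw [add_mul _ 1] at h2
  omega

theorem foldl_nextAt {rb : ℕ → ℕ} {Q : Automaton w}
    (h : ∀ j < 2 * w * w.size, rb j = bitAt (encAutomaton Q) j) (q : Fin w) (l : List Bool) :
    l.foldl (fun a b => nextAt rb w.size a b.toNat) q = l.foldl Q q := by
  induction l generalizing q with
  | nil => rfl
  | cons b l ih => rw [List.foldl_cons, List.foldl_cons, nextAt_eq h, ih]

/-- The encoding of a pair. -/
def pairBits (p : Pointed w) : List Bool := encAutomaton p.1 ++ encState p.2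

theorem length_pairBits (p : Pointed w) : (pairBits p).length = (2 * w + 1) * w.size := by
  rw [pairBits, List.length_append, length_encAutomaton, length_encState]
  ring

theorem bitAt_pairBits_left (p : Pointed w) {j : ℕ} (hj : j < 2 * w * w.size) :
    bitAt (pairBits p) j = bitAt (encAutomaton p.1) j :=
  bitAt_append_left (by rwa [length_encAutomaton])

theorem bitAt_pairBits_right (p : Pointed w) (j : ℕ) :
    bitAt (pairBits p) (2 * w * w.size + j) = bitAt (encState p.2) j := by
  rw [pairBits, ← length_encAutomaton p.1]
  exact bitAt_append_right j

end Encodings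

/-! #### Selecting a bit of the output -/

/-- A fold step that counts up to `j` and then records the next bit. -/
def pickStep (j a b : ℕ) : ℕ :=
  if a < j then a + 1 else if a = j then j + 1 + min b 1 else min a (j + 2)

theorem pickStep_le (j a b : ℕ) : pickStep j a b ≤ j + 2 := by
  rw [pickStep]
  split_ifs <;> omega

/-- The values `j + 1` and `j + 2` record the picked bit and absorb everything that follows. -/
theorem foldl_pickStep_done (j : ℕ) (l : List Bool) {a : ℕ} (ha : j < a) (ha' : a ≤ j + 2) :
    l.foldl (fun a b => pickStep j a b.toNat) a = a := by
  induction l with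
  | nil => rfl
  | cons b l ih =>
    rw [List.foldl_cons, pickStep, if_neg (by omega), if_neg (by omega), min_eq_left ha', ih]

theorem foldl_pickStep (j : ℕ) (l : List Bool) (a : ℕ) (ha : a ≤ j) (hl : j - a < l.length) :
    l.foldl (fun a b => pickStep j a b.toNat) a = j + 1 + bitAt l (j - a) := by
  induction l generalizing a with
  | nil => simp at hl
  | cons b l ih =>
    rw [List.length_cons] at hl
    rw [List.foldl_cons, pickStep]
    have hb := Bool.toNat_le b
    rcases Nat.lt_or_ge a j with h | h
    · rw [if_pos h, ih (a + 1) h (by omega)]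
      obtain ⟨m, hm⟩ : ∃ m, j - a = m + 1 := ⟨j - a - 1, by omega⟩
      rw [hm, show j - (a + 1) = m by omega]
      rfl
    · obtain rfl : a = j := by omega
      rw [if_neg (by omega), if_pos rfl, min_eq_left hb, foldl_pickStep_done _ _ (by omega)
        (by omega), Nat.sub_self]
      rfl

/-- The bit of the output of a simulation at position `j`. -/
def Sim.outBit (S : Sim) (t j : ℕ) : ℕ := min (S.fold t (pickStep j) 0 - (j + 1)) 1

theorem Sim.outBit_le (S : Sim) (t j : ℕ) : S.outBit t j ≤ 1 := min_le_right _ _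

/-- A single bit costs a whole run, but no output is ever stored. This is how one machine can read
the output of another in small space. -/
theorem OfflineTM.OutputsInSpace.outBit_eq {t : ℕ} {M : OfflineTM t} {inp : Fin t → List Bool}
    {L : ℕ} {S : Sim} {o : List Bool} (h : M.OutputsInSpace inp o L) (hS : M.Fits inp L S) {j : ℕ}
    (hj : j < o.length) : S.outBit t j = bitAt o j := by
  have := bitAt_le o j
  rw [Sim.outBit, h.fold_eq hS, foldl_pickStep j o 0 (Nat.zero_le _) (by omega), Nat.sub_zero,
    Nat.add_sub_cancel_left, min_eq_left this]

/-! #### Implementations -/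

section

variable {t n : ℕ} {Γ : Type} {c : Ctx t Γ} {f g : Γ → ℕ}

theorem Impl.sizeAndValue (j : Fin t) {w : Γ → ℕ} (hin : ∀ γ, c.inp γ j = (w γ).bits)
    (hB : Bdd c fun γ => 2 ^ (w γ).size) : (Impl c fun γ => (w γ).size) ∧ Impl c w := by
  have h1 : Impl c fun γ => (w γ).size := by
    refine (Impl.inputLength j ?_).congr fun γ => ?_
    · refine hB.mono fun γ => ?_
      rw [hin, Nat.size_eq_bits_len]
      exact Nat.lt_two_pow_self.le
    · rw [hin, Nat.size_eq_bits_len]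
  refine ⟨h1, (Impl.undig (.const 2) h1 (F := fun γ k =>
    symNum (OfflineTM.readInput (c.inp γ j) (k + 1)) - 1) (fun _ c' π k e hk _ => ?_)
    (fun γ k _ => ?_) hB).congr fun γ => ?_⟩
  · exact (hk.succ.read j).pred.congr fun x => by rw [e.inp]
  · have := symNum_le (OfflineTM.readInput (c.inp γ j) (k + 1))
    omega
  · rw [hin]
    simp only [symNum_readInput_succ_sub, bitAt_bits]
    rw [undig_dig_two, Nat.mod_eq_of_lt (Nat.lt_size_self _)]

theorem Impl.bitAt (j : Fin t) (hf : Impl c f) : Impl c fun γ => bitAt (c.inp γ j) (f γ) :=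
  (hf.succ.read j).pred.congr fun _ => (symNum_readInput_succ_sub _ _).symm

/-- A family of bits indexed by all numbers. -/
abbrev BitFam (c : Ctx t Γ) (rb : Γ → ℕ → ℕ) : Prop := Fam c (fun _ _ => True) rb

theorem Fam.ext {P : Γ → ℕ → Prop} {F : Γ → ℕ → ℕ} (h : Fam c P F) {Γ' : Type} {c' : Ctx t Γ'}
    {π : Γ' → Γ} (e : c'.Ext c π) : Fam c' (fun x => P (π x)) fun x => F (π x) :=
  fun _ c'' π' k e' hk hP => h c'' (fun x => π (π' x)) k (e'.trans e) hk hP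

theorem Fam.apply {F : Γ → ℕ → ℕ} (h : BitFam c F) (hf : Impl c f) : Impl c fun γ => F γ (f γ) :=
  h c id f (.refl c) hf fun _ => trivial

theorem Impl.virtualTape {rb : Γ → ℕ → ℕ} (hn : Impl c f) (hrb : BitFam c rb) (hp : Impl c g) :
    Impl c fun γ => virtualTape (f γ) (rb γ) (g γ) :=
  .if (((Impl.const 0).lt hp).and (hp.le hn)) (hrb.apply hp.pred).succ .zero

theorem Impl.numAt {rb : Γ → ℕ → ℕ} (hrb : BitFam c rb) (hle : ∀ γ j, rb γ j ≤ 1) (hf : Impl c f)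
    (hg : Impl c g) (hB : Bdd c fun γ => 2 ^ g γ) :
    Impl c fun γ => numAt (rb γ) (f γ) (g γ) :=
  Impl.undig (.const 2) hg (fun _ _ _ _ e hk _ => (hrb.ext e).apply ((hf.ext e).add hk))
    (fun γ _ _ => Nat.lt_succ_of_le (hle γ _)) hB

theorem Fam₂.nextAt {rb : Γ → ℕ → ℕ} (hrb : BitFam c rb) (hle : ∀ γ j, rb γ j ≤ 1)
    (hg : Impl c g) (hB : Bdd c fun γ => 2 ^ g γ) : Fam₂ c fun γ => nextAt (rb γ) (g γ) :=
  fun _ _ _ _ _ e hk hl => Impl.numAt (hrb.ext e) (fun _ => hle _)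
    ((((Impl.const 2).mul hk).add hl).mul (hg.ext e)) (hg.ext e) (hB.ext e)

theorem Sim.Good.implOutBit {S : Γ → Sim} (hS : Sim.Good c n S) (hf : Impl c f) :
    Impl c fun γ => (S γ).outBit n (f γ) := by
  refine Impl.min ((hS.implFold (g := fun γ => pickStep (f γ)) (Z := fun γ => f γ + 2)
    (fun _ c' π k l e hk hl => ?_) .zero (hf.bdd.add (bdd_const c 2))
    (fun γ => pickStep_le _)).sub hf.succ) (.const 1)
  have hf' := hf.ext e
  exact .if (hk.lt hf') hk.succ (.if (hk.eq hf') (hf'.succ.add (Impl.min hl (.const 1)))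
    (Impl.min hk (hf'.add (.const 2))))

end

/-! ### The automaton that counts trailing ones -/

/-- The automaton that counts the ones at the end of its input, up to `w - 1`. -/
def onesAutomaton (w : ℕ+) : Pointed w :=
  (fun q b => if b then ⟨min (q.val + 1) ((w : ℕ) - 1), by have := w.pos; omega⟩ else ⟨0, w.pos⟩,
    ⟨0, w.pos⟩)

/-- The bits of the encoding of `onesAutomaton w`. -/
def onesBit (w n j : ℕ) : ℕ :=
  if j < 2 * w * n ∧ j / n % 2 = 1 then dig 2 (min (j / n / 2 + 1) (w - 1)) (j % n) else 0

theorem onesBit_le (w n j : ℕ) : onesBit w n j ≤ 1 := by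
  rw [onesBit]
  split_ifs
  · exact Nat.le_of_lt_succ (Nat.mod_lt _ (by norm_num))
  · omega

theorem dig_zero (B j : ℕ) : dig B 0 j = 0 := by simp [dig]

/-- The start state and all successors on `false` are `0`, so nonzero bits occur only in the blocks
of odd index of the transition table. -/
theorem onesBit_eq (w : ℕ+) {j : ℕ} (hj : j < (2 * (w : ℕ) + 1) * (w : ℕ).size) :
    onesBit w (w : ℕ).size j = bitAt (pairBits (onesAutomaton w)) j := by
  have hs : 0 < (w : ℕ).size := Nat.size_pos.2 w.pos
  by_cases h : j < 2 * (w : ℕ) * (w : ℕ).size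
  · rw [bitAt_pairBits_left _ h]
    have h1 : j / (w : ℕ).size < 2 * w := (Nat.div_lt_iff_lt_mul hs).2 h
    have hm := Nat.mod_lt j hs
    have h2 := Nat.div_add_mod j (w : ℕ).size
    have e : ∀ b : Bool, j / (w : ℕ).size % 2 = b.toNat →
        bitAt (encAutomaton (onesAutomaton w).1) j =
          dig 2 ((onesAutomaton w).1 ⟨j / (w : ℕ).size / 2, by omega⟩ b) (j % (w : ℕ).size) := by
      intro b hb
      rw [← bitAt_encAutomaton _ _ _ hm]
      congr 1
      have : 2 * (j / (w : ℕ).size / 2) + b.toNat = j / (w : ℕ).size := by omega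
      simp only
      rw [this, mul_comm]
      exact h2.symm
    rw [onesBit]
    rcases Nat.mod_two_eq_zero_or_one (j / (w : ℕ).size) with hb | hb
    · rw [if_neg (by omega), e false hb]
      simp [onesAutomaton, dig_zero]
    · rw [if_pos ⟨h, hb⟩, e true hb]
      simp [onesAutomaton]
  · rw [onesBit, if_neg (by omega)]
    obtain ⟨k, rfl⟩ : ∃ k, j = 2 * (w : ℕ) * (w : ℕ).size + k := ⟨j - 2 * w * (w : ℕ).size, by omega⟩
    rw [add_mul, one_mul] at hj
    rw [bitAt_pairBits_right, bitAt_encState _ (by omega)]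
    simp [onesAutomaton, dig_zero]

theorem Impl.onesBit {t : ℕ} {Γ : Type} {c : Ctx t Γ} {w n j : Γ → ℕ} (hw : Impl c w)
    (hn : Impl c n) (hj : Impl c j) : Impl c fun γ => onesBit (w γ) (n γ) (j γ) :=
  .if ((hj.lt (((Impl.const 2).mul hw).mul hn)).and (((hj.div hn).mod (.const 2)).eq (.const 1)))
    ((Impl.const 2).dig (Impl.min (((hj.div hn).div (.const 2)).succ) hw.pred) (hj.mod hn)) .zero

/-- Puts `onesAutomaton w` into `A w` for large `w`. It is used twice: for the lower bound on the
seed length, and as an argument on which the generator reveals its output length. -/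
theorem isUniformSequence_ones : IsUniformSequence onesAutomaton := by
  let c : Ctx 1 ℕ+ := ⟨fun w => ![Nat.bits w], fun w => Nat.log 2 w, ∅⟩
  obtain ⟨hs, hw⟩ := Impl.sizeAndValue (c := c) 0 (w := fun w => (w : ℕ)) (fun _ => rfl)
    ⟨1, fun w => by
      rw [one_mul]
      exact Nat.pow_le_pow_right (by norm_num)
        (Nat.size_le.2 (Nat.lt_pow_succ_log_self (by norm_num) _))⟩
  refine Impl.computable (len := fun w : ℕ+ => (2 * (w : ℕ) + 1) * (w : ℕ).size)
    (bit := fun w j => onesBit w (w : ℕ).size j) ((((Impl.const 2).mul hw).succ).mul hs)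
    (fun c' π k e hk _ => .onesBit (hw.ext e) (hs.ext e) hk) fun w => ?_
  rw [← pairBits]
  conv_lhs => rw [eq_map_range_bitAt (pairBits (onesAutomaton w)), length_pairBits]
  refine List.map_congr_left fun k hk => ?_
  rw [onesBit_eq w (List.mem_range.1 hk)]

/-! ### Probabilities -/

theorem law_apply {n : ℕ} {α : Type} (f : Bits n → α) (E : Set α) [DecidablePred fun x => f x ∈ E] :
    ((law f).toOuterMeasure E).toReal =
      (Finset.univ.filter fun x => f x ∈ E).card / (2 : ℝ) ^ n := by
  classical
  rw [law, PMF.toOuterMeasure_map_apply, PMF.toOuterMeasure_uniformOfFintype_apply,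
    ENNReal.toReal_div]
  congr 1
  · rw [ENNReal.toReal_natCast, Fintype.card_subtype]
    congr 1
    exact congrArg _ (Finset.filter_congr fun _ _ => Iff.rfl)
  · simp

theorem foldl_ofFn_snoc {n : ℕ} {α : Type} (f : α → Bool → α) (a : α) (x : Bits (n + 1)) :
    (List.ofFn x).foldl f a = f ((List.ofFn fun i : Fin n => x i.castSucc).foldl f a)
      (x (Fin.last n)) := by
  rw [List.ofFn_succ', List.concat_eq_append, List.foldl_append]
  rfl

/-- Below the cap, the final state is at least `r` exactly when the last `r` bits are ones. The
induction removes the last bit. -/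
theorem card_ones (w : ℕ+) (m r : ℕ) (hr : r < w) (hm : r ≤ m) :
    (Finset.univ.filter fun x : Bits m => r ≤ ((onesAutomaton w).fn m x).val).card =
      2 ^ (m - r) := by
  induction m generalizing r with
  | zero =>
    obtain rfl : r = 0 := by omega
    simp
  | succ m ih =>
    rcases r with _ | r
    · simp
    · rw [Nat.add_sub_add_right, ← ih r (by omega) (by omega)]
      have key : ∀ x : Bits (m + 1), r + 1 ≤ ((onesAutomaton w).fn (m + 1) x).val ↔
          x (Fin.last m) = true ∧
            r ≤ ((onesAutomaton w).fn m fun i => x i.castSucc).val := by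
        intro x
        rw [Pointed.fn, foldl_ofFn_snoc, ← Pointed.fn]
        cases x (Fin.last m) with
        | false => simp [onesAutomaton]
        | true =>
          simp only [onesAutomaton, if_true, true_and]
          rw [← onesAutomaton]
          omega
      refine Finset.card_bij' (fun x _ => fun i => x i.castSucc)
        (fun y _ => Fin.snoc (α := fun _ => Bool) y true) ?_ ?_ ?_ ?_
      · intro x hx
        simp only [Finset.mem_filter, Finset.mem_univ, true_and, key] at hx ⊢
        exact hx.2
      · intro y hy
        simp only [Finset.mem_filter, Finset.mem_univ, true_and, key, Fin.snoc_last,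
          Fin.snoc_castSucc] at hy ⊢
        exact hy
      · intro x hx
        simp only [Finset.mem_filter, Finset.mem_univ, true_and, key] at hx
        rw [← hx.1]
        exact Fin.snoc_init_self x
      · intro y _
        funext i
        simp

/-- A short seed cannot give a small error. -/
theorem half_pow_le_of_tvClose {w : ℕ+} {s m : ℕ} {ε : ℝ} (f : Bits s → Fin w)
    (hw : s + 1 < w) (hm : s < m)
    (h : TVClose ε (law f) (law ((onesAutomaton w).fn m))) : ((2 : ℝ) ^ (s + 1))⁻¹ ≤ ε := by
  classical
  -- On uniform input this event has probability `2 ^ (-(s + 1))`; on an `s`-bit seed its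
  -- probability is a multiple of `2 ^ (-s)`. Such numbers differ by at least `2 ^ (-(s + 1))`.
  have h1 := h {q | s + 1 ≤ q.val}
  rw [law_apply, law_apply] at h1
  have h2 := card_ones w m (s + 1) hw hm
  simp only [Set.mem_ofPred_eq] at h1
  rw [h2] at h1
  set a := (Finset.univ.filter fun x : Bits s => s + 1 ≤ (f x).val).card
  have e : ((2 ^ (m - (s + 1)) : ℕ) : ℝ) / 2 ^ m = ((2 : ℝ) ^ (s + 1))⁻¹ := by
    obtain ⟨d, rfl⟩ := Nat.exists_eq_add_of_le hm
    rw [Nat.succ_eq_add_one, Nat.add_sub_cancel_left, pow_add]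
    push_cast
    field_simp
  rw [e] at h1
  refine le_trans ?_ h1
  have e2 : (a : ℝ) / 2 ^ s - ((2 : ℝ) ^ (s + 1))⁻¹ = (2 * a - 1) * ((2 : ℝ) ^ (s + 1))⁻¹ := by
    rw [pow_succ]
    field_simp
  rw [e2, abs_mul, abs_of_pos (a := ((2 : ℝ) ^ (s + 1))⁻¹) (by positivity)]
  refine le_mul_of_one_le_left (by positivity) ?_
  -- An odd integer is not zero.
  have : (1 : ℤ) ≤ |2 * (a : ℤ) - 1| := Int.one_le_abs (by omega)
  exact_mod_cast this

theorem card_init {n : ℕ} (P : Bits n → Prop) [DecidablePred P] :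
    (Finset.univ.filter fun x : Bits (n + 1) => P fun i => x i.castSucc).card =
      2 * (Finset.univ.filter P).card := by
  rw [← Fintype.card_bool, ← Finset.card_univ (α := Bool), ← Finset.card_product]
  refine Finset.card_bij' (fun x _ => (x (Fin.last n), fun i => x i.castSucc))
    (fun y _ => Fin.snoc (α := fun _ => Bool) y.2 y.1) ?_ ?_ ?_ ?_
  · intro x hx
    simpa using hx
  · intro y hy
    simpa using hy
  · intro x _
    exact Fin.snoc_init_self x
  · intro y _
    refine Prod.ext (by simp) ?_
    funext i
    simp

/-- A prefix of a uniform string is uniform. -/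
theorem tvClose_prefix {m n : ℕ} (h : m ≤ n) {α : Type} (f : Bits m → α) {ε : ℝ} (hε : 0 ≤ ε) :
    TVClose ε (law fun x : Bits n => f fun i => x (Fin.castLE h i)) (law f) := by
  classical
  obtain ⟨k, rfl⟩ := Nat.exists_eq_add_of_le h
  intro E
  suffices e : ((law fun x : Bits (m + k) => f fun i => x (Fin.castLE h i)).toOuterMeasure E).toReal
      = ((law f).toOuterMeasure E).toReal by
    rwa [e, sub_self, abs_zero]
  induction k with
  | zero => rfl
  | succ k ih =>
    rw [← ih (Nat.le_add_right _ _), law_apply, law_apply]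
    have := card_init fun x : Bits (m + k) =>
      (f fun i => x (Fin.castLE (Nat.le_add_right _ _) i)) ∈ E
    have e : (Finset.univ.filter fun x : Bits (m + (k + 1)) =>
        (f fun i => x (Fin.castLE h i)) ∈ E).card = _ := this
    rw [e, ← add_assoc, pow_succ]
    push_cast
    field_simp

/-! ### Simulating the given generator -/

/-- Four virtual input tapes holding a number, an automaton, a state and a string. -/
def genTape (w s : ℕ) (rb xb : ℕ → ℕ) (j p : ℕ) : ℕ :=
  if j = 0 then virtualTape w.size (dig 2 w) p
  else if j = 1 then virtualTape (2 * w * w.size) rb p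
  else if j = 2 then virtualTape w.size (fun i => rb (2 * w * w.size + i)) p
  else virtualTape s xb p

/-- The simulation of `M` in space `C * (s + 1)` on the inputs `w`, the pair with bits `rb`, and
the string of length `s` with bits `xb`. -/
noncomputable def genSim (M : OfflineTM 4) (C w s : ℕ) (rb xb : ℕ → ℕ) : Sim where
  k := M.k
  d := M.numStates + 3
  i := M.code
  W := 2 * (C * (s + 1)) + 1
  P := (2 * w + 1) * w.size + s + 2 * (C * (s + 1)) + 2
  rd := genTape w s rb xb

theorem genSim_fits (M : OfflineTM 4) (C : ℕ) {w s : ℕ} {p : Pointed w} {x : List Bool}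
    {rb xb : ℕ → ℕ} (hx : x.length = s)
    (hrb : ∀ j < (2 * w + 1) * w.size, rb j = bitAt (pairBits p) j)
    (hxb : ∀ j < s, xb j = bitAt x j) :
    M.Fits ![Nat.bits w, encAutomaton p.1, encState p.2, x] (C * (s + 1))
      (genSim M C w s rb xb) := by
  have e : (2 * w + 1) * w.size = 2 * w * w.size + w.size := by ring
  refine ⟨rfl, rfl, rfl, rfl, fun j => ?_, ?_, fun j q => ?_⟩
  · fin_cases j <;> simp [genSim, length_encAutomaton, hx, Nat.size_eq_bits_len] <;> omega
  · simp only [genSim]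
    omega
  · fin_cases j
    · exact virtualTape_eq (Nat.size_eq_bits_len w) (fun j _ => (bitAt_bits w j).symm) q
    · exact virtualTape_eq (length_encAutomaton _) (fun j hj => by
        rw [hrb j (by omega), bitAt_pairBits_left _ hj]) q
    · exact virtualTape_eq (rb := fun i => rb (2 * w * w.size + i)) (length_encState p.2)
        (fun j hj => by rw [hrb _ (by omega), bitAt_pairBits_right]) q
    · exact virtualTape_eq hx hxb q

/-- The state reached on the output of the simulated machine by the automaton with bits `rb`. -/
noncomputable def endState (M : OfflineTM 4) (C w s : ℕ) (rb xb : ℕ → ℕ) : ℕ :=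
  (genSim M C w s rb xb).fold 4 (nextAt rb w.size) (numAt rb (2 * w * w.size) w.size)

theorem numAt_start {w : ℕ} {p : Pointed w} {rb : ℕ → ℕ}
    (hrb : ∀ j < (2 * w + 1) * w.size, rb j = bitAt (pairBits p) j) :
    numAt rb (2 * w * w.size) w.size = p.2 := by
  refine numAt_eq (val_lt_two_pow_size _) fun j hj => ?_
  rw [hrb _ (by rw [add_mul, one_mul]; omega), bitAt_pairBits_right, bitAt_encState _ hj]

theorem endState_eq {M : OfflineTM 4} {C w s m : ℕ} {p : Pointed w} {x : List Bool} {y : Bits m}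
    {rb xb : ℕ → ℕ}
    (hM : M.OutputsInSpace ![Nat.bits w, encAutomaton p.1, encState p.2, x] (List.ofFn y)
      (C * (s + 1))) (hx : x.length = s)
    (hrb : ∀ j < (2 * w + 1) * w.size, rb j = bitAt (pairBits p) j)
    (hxb : ∀ j < s, xb j = bitAt x j) :
    endState M C w s rb xb = p.fn m y := by
  rw [endState, hM.fold_eq (genSim_fits M C hx hrb hxb), numAt_start hrb, Pointed.fn]
  refine foldl_nextAt (fun j hj => ?_) _ _
  rw [hrb j (by rw [add_mul]; omega), bitAt_pairBits_left _ hj]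

section

variable {t : ℕ} {Γ : Type} {c : Ctx t Γ} {w s f g : Γ → ℕ} {rb xb : Γ → ℕ → ℕ}

theorem Bdd.pow_const (hf : Bdd c f) (n : ℕ) : Bdd c fun γ => f γ ^ n := by
  induction n with
  | zero => exact (bdd_const c 1).mono fun γ => by simp
  | succ n ih => exact (ih.mul hf).mono fun γ => (pow_succ _ _).le

theorem virtualTape_le {n : ℕ} {rb : ℕ → ℕ} (h : ∀ j, rb j ≤ 1) (p : ℕ) :
    virtualTape n rb p ≤ 2 := by
  rw [virtualTape]
  have := h (p - 1)
  split_ifs <;> omega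

theorem dig_two_le (n j : ℕ) : dig 2 n j ≤ 1 := Nat.le_of_lt_succ (Nat.mod_lt _ (by norm_num))

theorem two_pow_size_le (n : ℕ) : 2 ^ n.size ≤ 2 * n + 1 := by
  rcases h : n.size with _ | k
  · simp
  · have := Nat.lt_size.1 (show k < n.size by omega)
    rw [pow_succ]
    omega

theorem bdd_two_pow_size (hw : Impl c w) : Bdd c fun γ => 2 ^ (w γ).size :=
  (((Impl.const 2).mul hw).succ).bdd.mono fun _ => two_pow_size_le _

/-- The hypothesis `hB` says that `s` is within the space bound up to a constant. The simulated work
tapes have `O(s)` cells in all, so their contents form a number `2 ^ O(s)`. -/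
theorem genSim_good (M : OfflineTM 4) (C : ℕ) (hw : Impl c w) (hsz : Impl c fun γ => (w γ).size)
    (hs : Impl c s) (hB : Bdd c fun γ => 2 ^ s γ) (hrb : BitFam c rb) (hrb1 : ∀ γ j, rb γ j ≤ 1)
    (hxb : BitFam c xb) (hxb1 : ∀ γ j, xb γ j ≤ 1) :
    Sim.Good c 4 fun γ => genSim M C (w γ) (s γ) (rb γ) (xb γ) := by
  have hL : Impl c fun γ => 2 * (C * (s γ + 1)) := (Impl.const 2).mul ((Impl.const C).mul hs.succ)
  have hP : Impl c fun γ => (2 * w γ + 1) * (w γ).size + s γ + 2 * (C * (s γ + 1)) + 2 :=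
    ((((((Impl.const 2).mul hw).succ.mul hsz).add hs).add hL).succ).succ
  refine ⟨.const M.k, .const (M.numStates + 3), .const M.code, hL.succ, hP, ?_, ?_, ?_,
    bdd_const c (3 ^ (4 + M.k)), ?_,
    hP.bdd.pow_const (4 + M.k)⟩
  · intro Γ' c' π k l e hk hl
    have hw' := hw.ext e
    have hsz' := hsz.ext e
    have h2 : Impl c' fun x => 2 * w (π x) * (w (π x)).size :=
      ((Impl.const 2).mul hw').mul hsz'
    exact .if (hk.eq (.const 0)) (.virtualTape hsz' (fun _ _ _ _ e' hk' _ =>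
        (Impl.const 2).dig (hw'.ext e') hk') hl)
      (.if (hk.eq (.const 1)) (.virtualTape h2 (hrb.ext e) hl)
      (.if (hk.eq (.const 2)) (.virtualTape hsz' (fun _ _ _ _ e' hk' _ =>
        ((hrb.ext e).ext e').apply ((h2.ext e').add hk')) hl)
      (.virtualTape (hs.ext e) (hxb.ext e) hl)))
  · intro γ j p
    simp only [genSim, genTape]
    split_ifs
    · exact virtualTape_le (dig_two_le _) _
    · exact virtualTape_le (hrb1 γ) _
    · exact virtualTape_le (fun _ => hrb1 γ _) _
    · exact virtualTape_le (hxb1 γ) _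
  · intro γ
    simp only [genSim]
    omega
  -- With `3 ≤ 2 ^ 2`, the exponent is at most `2 * M.k * (2 * C + 1)` times `s + 1`.
  · refine ((hB.mul (bdd_const c 2)).pow_const (2 * (M.k * (2 * C + 1)))).mono fun γ => ?_
    simp only [genSim]
    rw [← pow_succ, ← pow_mul]
    calc 3 ^ (M.k * (2 * (C * (s γ + 1)) + 1)) ≤ (2 ^ 2) ^ (M.k * (2 * (C * (s γ + 1)) + 1)) :=
          Nat.pow_le_pow_left (by norm_num) _
      _ = 2 ^ (2 * (M.k * (2 * (C * (s γ + 1)) + 1))) := (pow_mul _ _ _).symm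
      _ ≤ _ := Nat.pow_le_pow_right (by norm_num) (by nlinarith [Nat.zero_le (M.k * s γ)])

theorem Impl.endState (M : OfflineTM 4) (C : ℕ) (hw : Impl c w) (hsz : Impl c fun γ => (w γ).size)
    (hs : Impl c s) (hB : Bdd c fun γ => 2 ^ s γ) (hrb : BitFam c rb) (hrb1 : ∀ γ j, rb γ j ≤ 1)
    (hxb : BitFam c xb) (hxb1 : ∀ γ j, xb γ j ≤ 1) :
    Impl c fun γ => endState M C (w γ) (s γ) (rb γ) (xb γ) :=
  (genSim_good M C hw hsz hs hB hrb hrb1 hxb hxb1).implFold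
    (.nextAt hrb hrb1 hsz (bdd_two_pow_size hw))
    (.numAt hrb hrb1 (((Impl.const 2).mul hw).mul hsz) hsz (bdd_two_pow_size hw))
    (bdd_two_pow_size hw) fun γ _ _ => (numAt_lt (hrb1 γ) _ _).le

end

/-! ### The simulator -/

/-- The state reached from `q` after reading `n` bits. -/
def runAt (rb : ℕ → ℕ) (sz : ℕ) (xb : ℕ → ℕ) (q : ℕ) : ℕ → ℕ
  | 0 => q
  | n + 1 => nextAt rb sz (runAt rb sz xb q n) (xb n)

theorem runAt_eq {w m : ℕ} {p : Pointed w} {rb xb : ℕ → ℕ} (x : Bits m)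
    (hrb : ∀ j < (2 * w + 1) * w.size, rb j = bitAt (pairBits p) j)
    (hxb : ∀ j : Fin m, xb j = (x j).toNat) :
    runAt rb w.size xb (numAt rb (2 * w * w.size) w.size) m = p.fn m x := by
  rw [numAt_start hrb]
  induction m with
  | zero => rfl
  | succ m ih =>
    rw [runAt, ih (fun i => x i.castSucc) fun j => hxb j.castSucc, Pointed.fn, Pointed.fn,
      foldl_ofFn_snoc, ← nextAt_eq (rb := rb) fun j hj => ?_]
    · congr 1
      exact hxb (Fin.last m)
    · rw [hrb j (by rw [add_mul]; omega), bitAt_pairBits_left _ hj]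

/-- Whether an entry of the table of answers with bits `yb` and length `n` belongs to the pair
with bits `rb`. -/
def Matches (w n : ℕ) (rb yb : ℕ → ℕ) (e : ℕ) : Prop :=
  2 + (e + 1) * ((2 * w + 2) * w.size) ≤ n ∧
    ∀ j < (2 * w + 1) * w.size, yb (2 + e * ((2 * w + 2) * w.size) + j) = rb j

open Classical in
/-- The last of the matching answers among the first `e` entries. -/
noncomputable def lookup (w n : ℕ) (rb yb : ℕ → ℕ) : ℕ → ℕ
  | 0 => 0
  | e + 1 => if Matches w n rb yb e then
      numAt yb (2 + e * ((2 * w + 2) * w.size) + (2 * w + 1) * w.size) w.size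
    else lookup w n rb yb e

/-- Different candidates may print the same pair, so several entries can match; it suffices that all
of them carry the same answer. -/
theorem lookup_eq {w n v E : ℕ} {rb yb : ℕ → ℕ}
    (h : ∀ e < E, Matches w n rb yb e →
      numAt yb (2 + e * ((2 * w + 2) * w.size) + (2 * w + 1) * w.size) w.size = v)
    {e : ℕ} (he : e < E) (hm : Matches w n rb yb e) : lookup w n rb yb E = v := by
  induction E with
  | zero => omega
  | succ E ih =>
    rw [lookup]
    split_ifs with hE
    · exact h E (by omega) hE
    · refine ih (fun e he => h e (by omega)) (Nat.lt_of_le_of_ne (by omega) ?_)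
      rintro rfl
      exact hE hm

/-- The number of the state output by the simulator. -/
noncomputable def simVal (M : OfflineTM 4) (C w n : ℕ) (rb yb : ℕ → ℕ) : ℕ :=
  -- Two leading bits give the form of the advice: `0` in front for the seed itself, `10` for a
  -- prefix of the seed that the automaton reads directly, `11` for the table of answers. The test
  -- `n - 2 < w.size` keeps the first form within logarithmic space for every string, and in the
  -- last form entries beyond the end of the string never match.
  if yb 0 = 0 then if n - 2 < w.size then endState M C w (n - 2) rb fun j => yb (j + 2) else 0
  else if yb 1 = 0 then
    runAt rb w.size (fun j => yb (j + 2)) (numAt rb (2 * w * w.size) w.size) (n - 2)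
  else lookup w n rb yb n

/-- The simulator. -/
noncomputable def simulator (M : OfflineTM 4) (C : ℕ) (w : ℕ+) (p : Pointed w) (y : List Bool) :
    Fin w :=
  -- The reduction modulo `w` only yields a state on malformed advice; it does not change a correct
  -- answer.
  ⟨simVal M C w y.length (bitAt (pairBits p)) (bitAt y) % w, Nat.mod_lt _ w.pos⟩

/-! ### The simulator in bounded space -/

section

variable {t : ℕ} {Γ : Type} {c : Ctx t Γ} {w n q τ : Γ → ℕ} {rb yb : Γ → ℕ → ℕ}

theorem Impl.runAt (hw : Impl c w) (hsz : Impl c fun γ => (w γ).size) (hrb : BitFam c rb)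
    (hrb1 : ∀ γ j, rb γ j ≤ 1) (hyb : BitFam c yb) (hq : Impl c q) (hτ : Impl c τ) :
    Impl c fun γ => runAt (rb γ) (w γ).size (yb γ) (q γ) (τ γ) := by
  refine Impl.rec hτ hq (fun c' π k e hk _ h => ?_) ?_
  · exact (Fam₂.nextAt (hrb.ext e) (fun _ => hrb1 _) (hsz.ext e)
      (bdd_two_pow_size (hw.ext e))).apply h ((hyb.ext e).apply hk)
  · obtain ⟨C, hC⟩ := (bdd_two_pow_size hw).add hq.bdd
    refine ⟨C, fun γ k _ => le_trans ?_ (hC γ)⟩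
    rcases k with _ | k
    · exact Nat.le_add_left _ _
    · exact (numAt_lt (hrb1 γ) _ _).le.trans (Nat.le_add_right _ _)

theorem Impl.lookup (hw : Impl c w) (hsz : Impl c fun γ => (w γ).size) (hn : Impl c n)
    (hrb : BitFam c rb) (hyb : BitFam c yb) (hyb1 : ∀ γ j, yb γ j ≤ 1) (hτ : Impl c τ) :
    Impl c fun γ => lookup (w γ) (n γ) (rb γ) (yb γ) (τ γ) := by
  classical
  refine Impl.rec hτ .zero (fun c' π k e hk _ h => ?_) ?_
  · have hw' := hw.ext e
    have hsz' := hsz.ext e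
    have h1 : Impl c' fun x => (2 * w (π x) + 1) * (w (π x)).size :=
      ((Impl.const 2).mul hw').succ.mul hsz'
    have h2 : Impl c' fun x => (2 * w (π x) + 2) * (w (π x)).size :=
      ((Impl.const 2).mul hw').succ.succ.mul hsz'
    have h3 : Impl c' fun x => 2 + k x * ((2 * w (π x) + 2) * (w (π x)).size) :=
      (Impl.const 2).add (hk.mul h2)
    refine .if (.and (((Impl.const 2).add (hk.succ.mul h2)).le (hn.ext e)) (.ball h1 ?_))
      (.numAt (hyb.ext e) (fun _ => hyb1 _) (h3.add h1) hsz' (bdd_two_pow_size hw')) h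
    intro Γ'' c'' π' j e' hj _
    exact (((hyb.ext e).ext e').apply ((h3.ext e').add hj)).eq (((hrb.ext e).ext e').apply hj)
  · obtain ⟨C, hC⟩ := bdd_two_pow_size hw
    refine ⟨C, fun γ k _ => le_trans ?_ (hC γ)⟩
    induction k with
    | zero => exact Nat.zero_le _
    | succ k ih =>
      rw [SpaceDerand.lookup]
      split_ifs
      · exact (numAt_lt (hyb1 γ) _ _).le
      · exact ih (by omega)

theorem Impl.simVal (M : OfflineTM 4) (C : ℕ) (hw : Impl c w) (hsz : Impl c fun γ => (w γ).size)
    (hn : Impl c n) (hrb : BitFam c rb) (hrb1 : ∀ γ j, rb γ j ≤ 1) (hyb : BitFam c yb)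
    (hyb1 : ∀ γ j, yb γ j ≤ 1) : Impl c fun γ => simVal M C (w γ) (n γ) (rb γ) (yb γ) := by
  have hn2 : Impl c fun γ => n γ - 2 := hn.sub (.const 2)
  have hyb2 : BitFam c fun γ j => yb γ (j + 2) := fun _ _ _ _ e hk _ =>
    (hyb.ext e).apply hk.succ.succ
  refine .if ((hyb.apply (.const 0)).eq (.const 0)) (.ifRestrict (hn2.lt hsz) ?_ fun _ _ _ _ => .zero)
    (.if ((hyb.apply (.const 1)).eq (.const 0))
      (.runAt hw hsz hrb hrb1 hyb2 (.numAt hrb hrb1 (((Impl.const 2).mul hw).mul hsz) hsz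
        (bdd_two_pow_size hw)) hn2)
      (.lookup hw hsz hn hrb hyb hyb1 hn))
  intro Γ' c' π e hlt
  exact .endState M C (hw.ext e) (hsz.ext e) (hn2.ext e)
    ((bdd_two_pow_size (hw.ext e)).mono fun x => Nat.pow_le_pow_right (by norm_num) (hlt x).le)
    (hrb.ext e) (fun _ => hrb1 _) (hyb2.ext e) fun _ _ => hyb1 _ _

end

theorem isLogspaceAlgorithm_simulator (M : OfflineTM 4) (C : ℕ) :
    IsLogspaceAlgorithm (simulator M C) := by
  let c : Ctx 4 ((w : ℕ+) × Pointed w × List Bool) :=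
    ⟨fun ⟨w, p, y⟩ => ![Nat.bits w, encAutomaton p.1, encState p.2, y],
      fun ⟨w, p, y⟩ => Nat.log 2 ((Nat.bits w).length + (encAutomaton p.1).length
        + (encState p.2).length + y.length), ∅⟩
  -- The input contains the whole transition table, so `w` and all positions in the advice are of
  -- size `2 ^ O(b)`.
  have key : ∀ γ, γ.2.2.length + 2 * (γ.1 : ℕ) * (γ.1 : ℕ).size + (γ.1 : ℕ).size ≤
      2 ^ (1 * (c.b γ + 1)) := by
    rintro ⟨w, p, y⟩
    rw [one_mul]
    refine le_trans ?_ (Nat.lt_pow_succ_log_self (b := 2) (by norm_num) _).le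
    simp only [length_encAutomaton, length_encState]
    omega
  have hB : Bdd c fun γ => 2 * (γ.1 : ℕ) * (γ.1 : ℕ).size + 1 :=
    (Bdd.add ⟨1, key⟩ (bdd_const c 1)).mono fun γ => by omega
  obtain ⟨hsz, hw⟩ := Impl.sizeAndValue (c := c) 0 (w := fun γ => (γ.1 : ℕ)) (fun _ => rfl)
    (hB.mono fun γ => by
      have h1 := two_pow_size_le (γ.1 : ℕ)
      have h2 : 0 < (γ.1 : ℕ).size := Nat.size_pos.2 γ.1.pos
      nlinarith)
  have hn : Impl c fun γ => γ.2.2.length :=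
    (Impl.inputLength 3 ((Bdd.mono ⟨1, key⟩ fun γ => by
      show γ.2.2.length ≤ _
      omega))).congr fun _ => rfl
  have hrb : BitFam c fun γ => bitAt (pairBits γ.2.1) := by
    intro Γ' c' π k e hk _
    have h2 : Impl c' fun x => 2 * ((π x).1 : ℕ) * ((π x).1 : ℕ).size :=
      ((Impl.const 2).mul (hw.ext e)).mul (hsz.ext e)
    refine (Impl.if (hk.lt h2) (hk.bitAt 1) ((hk.sub h2).bitAt 2)).congr fun x => ?_
    rw [e.inp]
    split_ifs with h
    · exact bitAt_pairBits_left _ h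
    · obtain ⟨r, hr⟩ := Nat.exists_eq_add_of_le (Nat.le_of_not_lt h)
      rw [hr, Nat.add_sub_cancel_left]
      exact bitAt_pairBits_right _ r
  have hyb : BitFam c fun γ => bitAt γ.2.2 := fun _ c' π k e hk _ =>
    (hk.bitAt 3).congr fun x => by rw [e.inp]; rfl
  have hv := Impl.mod (Impl.simVal M C hw hsz hn hrb (fun γ => bitAt_le _) hyb fun γ => bitAt_le _) hw
  refine Impl.computable (len := fun γ : (w : ℕ+) × Pointed w × List Bool => (γ.1 : ℕ).size)
    (bit := fun γ j => dig 2 (simulator M C γ.1 γ.2.1 γ.2.2) j) hsz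
    (fun c' π k e hk _ => (Impl.const 2).dig (hv.ext e) hk) fun γ => ?_
  obtain ⟨w, p, y⟩ := γ
  refine (eq_map_range_bitAt (encState (simulator M C w p y))).trans ?_
  rw [length_encState]
  refine List.map_congr_left fun k hk => ?_
  rw [bitAt_encState _ (List.mem_range.1 hk)]

/-! ### The advice -/

/-- The simulation, on input `w`, of the machine described by the three base-`G` digits of `e`,
where `G` is the length of the length of `w`, in space `s / G`. -/
def rawSim (w s e : ℕ) : Sim where
  -- The minimum acts only for `e ≥ w.size.size ^ 3`; it bounds the number of tapes for every `e`.
  k := min (e / (w.size.size * w.size.size)) w.size.size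
  d := e / w.size.size % w.size.size
  i := e % w.size.size
  W := 2 * (s / w.size.size) + 1
  -- When `w.size ≤ s`, this exceeds the last position `w.size + 1` of the input head as well as the
  -- last cell number of a work tape.
  P := 2 * s + 3
  rd := fun _ => virtualTape w.size (dig 2 w)

/-- The bits output by that machine. -/
def rawBit (w s e j : ℕ) : ℕ := (rawSim w s e).outBit 1 j

theorem rawBit_le (w s e j : ℕ) : rawBit w s e j ≤ 1 := Sim.outBit_le _ _ _

/-- The output length of the simulated generator, up to `s + 1`. -/
noncomputable def outCount (M : OfflineTM 4) (C w s : ℕ) : ℕ :=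
  -- The run is on `onesAutomaton w` and the zero seed. The cap `s + 1` keeps the count small and
  -- still tells whether it is at most `s`.
  (genSim M C w s (onesBit w w.size) fun _ => 0).fold 4 (fun a _ => min (a + 1) (s + 1)) 0

/-- The length of the advice. -/
noncomputable def adviceLen (M : OfflineTM 4) (C w s : ℕ) : ℕ :=
  if s < w.size then s + 2
  else if outCount M C w s ≤ s then outCount M C w s + 2
  else w.size.size ^ 3 * ((2 * w + 2) * w.size) + 2

/-- The bits of the table of answers. -/
noncomputable def tableBit (M : OfflineTM 4) (C w s : ℕ) (xb : ℕ → ℕ) (e r : ℕ) : ℕ :=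
  if r < (2 * w + 1) * w.size then rawBit w s e r
  else dig 2 (endState M C w s (rawBit w s e) xb) (r - (2 * w + 1) * w.size)

/-- The bits of the advice. -/
noncomputable def adviceBit (M : OfflineTM 4) (C w s : ℕ) (xb : ℕ → ℕ) (j : ℕ) : ℕ :=
  if s < w.size then if j < 2 then 0 else xb (j - 2)
  else if outCount M C w s ≤ s then if j = 0 then 1 else if j = 1 then 0 else xb (j - 2)
  else if j < 2 then 1
  else tableBit M C w s xb ((j - 2) / ((2 * w + 2) * w.size)) ((j - 2) % ((2 * w + 2) * w.size))

/-- The advice generator. -/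
noncomputable def advice (M : OfflineTM 4) (C : ℕ) (s : ℕ+ → ℕ) (w : ℕ+) (x : Bits (s w)) :
    Bits (adviceLen M C w (s w)) :=
  fun j => decide (adviceBit M C w (s w) (bitAt (List.ofFn x)) j ≠ 0)

theorem size_le_self (n : ℕ) : n.size ≤ n := Nat.size_le.2 n.lt_two_pow_self

theorem sq_le_two_pow (n : ℕ) : n ^ 2 ≤ 2 * 2 ^ n := by
  induction n using Nat.strong_induction_on with
  | _ n ih =>
    rcases Nat.lt_or_ge n 4 with h | h
    · interval_cases n <;> norm_num
    · obtain ⟨k, rfl⟩ := Nat.exists_eq_add_of_le' (show 1 ≤ n by omega)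
      have := ih k (by omega)
      rw [pow_succ 2 k]
      nlinarith

theorem size_sq_le (n : ℕ) : n.size ^ 2 ≤ 4 * n + 2 := by
  have h1 := sq_le_two_pow n.size
  have h2 := two_pow_size_le n
  omega

/-- Bounds the head positions of a candidate. Its number of tapes is not constant, but there are
`O(log s)` positions of `O(log s)` bits each, and `(log s) ^ 2` is `O(s)`. -/
theorem pow_size_le (s : ℕ) : (2 * s + 3) ^ (s.size + 1) ≤ 2 ^ (10 * (s + 1)) := by
  have h1 : 2 * s + 3 ≤ 2 ^ (s.size + 2) := by
    have := Nat.lt_size_self s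
    rw [pow_add]
    omega
  have h2 := size_sq_le s
  have h3 := size_le_self s
  refine (Nat.pow_le_pow_left h1 _).trans ?_
  rw [← pow_mul]
  exact Nat.pow_le_pow_right (by norm_num) (by nlinarith)

/-! ### The parts of the advice in space `O(s)` -/

section

variable {t : ℕ} {Γ : Type} {c : Ctx t Γ} {w s e r : Γ → ℕ} {xb : Γ → ℕ → ℕ}

/-- The number of tapes varies with the candidate, which is why the space is divided by
`w.size.size`: at most that many tapes, of `2 * (s / w.size.size) + 1` cells each, have at most `3 *
s` cells together. -/
theorem rawSim_good (hw : Impl c w) (hsz : Impl c fun γ => (w γ).size) (hs : Impl c s)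
    (he : Impl c e) (hb : ∀ γ, c.b γ = s γ) (hle : ∀ γ, (w γ).size ≤ s γ)
    (hG : Impl c fun γ => (w γ).size.size) :
    Sim.Good c 1 fun γ => rawSim (w γ) (s γ) (e γ) where
  k := Impl.min (he.div (hG.mul hG)) hG
  d := (he.div hG).mod hG
  i := he.mod hG
  W := ((Impl.const 2).mul (hs.div hG)).succ
  P := ((Impl.const 2).mul hs).succ.succ.succ
  rd := fun _ _ _ _ _ ex _ hl => Impl.virtualTape (hsz.ext ex)
    (fun _ _ _ _ ex' hk _ => (Impl.const 2).dig ((hw.ext ex).ext ex') hk) hl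
  rd_le := fun γ _ _ => virtualTape_le (dig_two_le _) _
  pos_P := fun γ => by
    have := Nat.div_le_self (s γ) (w γ).size.size
    simp only [rawSim]
    omega
  bdd_sym := ⟨2, fun γ => by
    have h1 := size_le_self (w γ).size
    have h2 := hle γ
    rw [hb, pow_mul]
    refine (Nat.pow_le_pow_left (by norm_num : 3 ≤ 2 ^ 2) _).trans
      (Nat.pow_le_pow_right (by norm_num) ?_)
    simp only [rawSim]
    omega⟩
  bdd_T := ⟨2 * 3, fun γ => by
    have h1 := size_le_self (w γ).size
    have h2 := hle γ
    have h3 := Nat.div_mul_le_self (s γ) (w γ).size.size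
    rw [hb, mul_assoc, pow_mul]
    refine (Nat.pow_le_pow_left (by norm_num : 3 ≤ 2 ^ 2) _).trans
      (Nat.pow_le_pow_right (by norm_num) ?_)
    simp only [rawSim]
    refine (Nat.mul_le_mul_right _ (min_le_right _ _)).trans ?_
    nlinarith⟩
  bdd_X := ⟨10, fun γ => by
    rw [hb]
    refine le_trans (Nat.pow_le_pow_right (Nat.succ_pos _) ?_) (pow_size_le (s γ))
    have h1 := Nat.size_le_size ((size_le_self _).trans (hle γ))
    have h2 := Nat.size_le_size (hle γ)
    simp only [rawSim]
    omega⟩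

theorem size_succ_eq (n : ℕ) :
    (n + 1).size = if 2 ^ n.size ≤ n + 1 then n.size + 1 else n.size := by
  have h1 := Nat.lt_size_self n
  have h2 := Nat.size_le_size (Nat.le_succ n)
  split_ifs with h
  · refine le_antisymm (Nat.size_le.2 ?_) (Nat.lt_size.2 h)
    rw [pow_succ]
    omega
  · exact le_antisymm (Nat.size_le.2 (by omega)) h2

theorem Impl.size (hw : Impl c w) : Impl c fun γ => (w γ).size := by
  refine Impl.rec (F := fun _ k => k.size) hw (.const 0) (fun c' π k ex hk _ h => ?_) ?_
  · exact (Impl.if (((Impl.const 2).pow h ((((Impl.const 2).mul hk).succ).bdd.mono fun _ =>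
      two_pow_size_le _)).le hk.succ) h.succ h).congr fun x => size_succ_eq _
  · obtain ⟨C, hC⟩ := hw.bdd
    exact ⟨C, fun γ k hk => (size_le_self k).trans (hk.trans (hC γ))⟩

theorem Impl.rawBit (hw : Impl c w) (hs : Impl c s) (he : Impl c e) (hr : Impl c r)
    (hb : ∀ γ, c.b γ = s γ) (hle : ∀ γ, (w γ).size ≤ s γ) :
    Impl c fun γ => rawBit (w γ) (s γ) (e γ) (r γ) :=
  (rawSim_good hw hw.size hs he hb hle hw.size.size).implOutBit hr

theorem bdd_two_pow (hb : ∀ γ, c.b γ = s γ) : Bdd c fun γ => 2 ^ s γ :=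
  ⟨1, fun γ => by
    rw [hb, one_mul]
    exact Nat.pow_le_pow_right (by norm_num) (Nat.le_succ _)⟩

theorem Impl.outCount (M : OfflineTM 4) (C : ℕ) (hw : Impl c w) (hs : Impl c s)
    (hb : ∀ γ, c.b γ = s γ) : Impl c fun γ => outCount M C (w γ) (s γ) :=
  (genSim_good M C hw hw.size hs (bdd_two_pow hb)
    (fun _ _ _ _ ex hk _ => .onesBit (hw.ext ex) (hw.size.ext ex) hk) (fun _ _ => onesBit_le _ _ _)
    (fun _ _ _ _ _ _ _ => .zero) fun _ _ => Nat.zero_le _).implFold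
    (fun _ _ _ _ _ ex hk _ => Impl.min hk.succ (hs.succ.ext ex)) .zero hs.succ.bdd
    fun _ _ _ => min_le_right _ _

/-- Simulations are nested here: the pair handed to the generator is not written down, its bits
being recomputed by `rawBit` whenever the outer simulation reads them. -/
theorem Impl.tableBit (M : OfflineTM 4) (C : ℕ) (hw : Impl c w) (hs : Impl c s)
    (hb : ∀ γ, c.b γ = s γ) (hle : ∀ γ, (w γ).size ≤ s γ) (hxb : BitFam c xb)
    (hxb1 : ∀ γ j, xb γ j ≤ 1) (he : Impl c e) (hr : Impl c r) :
    Impl c fun γ => tableBit M C (w γ) (s γ) (xb γ) (e γ) (r γ) := by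
  have h1 : Impl c fun γ => (2 * w γ + 1) * (w γ).size := ((Impl.const 2).mul hw).succ.mul hw.size
  exact .if (hr.lt h1) (.rawBit hw hs he hr hb hle) ((Impl.const 2).dig
    (.endState M C hw hw.size hs (bdd_two_pow hb) (fun _ _ _ _ ex hk _ =>
      .rawBit (hw.ext ex) (hs.ext ex) (he.ext ex) hk (fun _ => by rw [ex.b, hb]) fun _ => hle _)
      (fun _ _ => rawBit_le _ _ _ _) hxb hxb1) (hr.sub h1))

end

/-! ### The advice from the actual inputs -/

section

variable {Γ : Type} {c : Ctx 2 Γ} {w s : Γ → ℕ}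

theorem Impl.seedLength (hx : ∀ γ, (c.inp γ 1).length = s γ) (hb : ∀ γ, c.b γ = s γ) :
    Impl c s :=
  (Impl.inputLength 1 ((bdd_two_pow hb).mono fun γ => by
    rw [hx]
    exact Nat.lt_two_pow_self.le)).congr fun γ => (hx γ).symm

/-- The length of `w` may itself be too large a number for space `O(s)`. Looking at cell `s + 1` of
the tape decides the comparison without computing that length. -/
theorem ImplP.seedLength_lt (hin : ∀ γ, c.inp γ 0 = (w γ).bits) (hs : Impl c s) :
    ImplP c fun γ => s γ < (w γ).size :=
  ⟨_, hs.succ.read 0, fun γ => by rw [symNum_readInput_ne_zero, hin, Nat.size_eq_bits_len]⟩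

theorem Impl.value (hin : ∀ γ, c.inp γ 0 = (w γ).bits) (hb : ∀ γ, c.b γ = s γ)
    (hle : ∀ γ, (w γ).size ≤ s γ) : Impl c w :=
  (Impl.sizeAndValue 0 hin ((bdd_two_pow hb).mono fun γ =>
    Nat.pow_le_pow_right (by norm_num) (hle γ))).2

theorem Impl.adviceLen (M : OfflineTM 4) (C : ℕ) (hin : ∀ γ, c.inp γ 0 = (w γ).bits)
    (hx : ∀ γ, (c.inp γ 1).length = s γ) (hb : ∀ γ, c.b γ = s γ) :
    Impl c fun γ => adviceLen M C (w γ) (s γ) := by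
  have hs := Impl.seedLength hx hb
  refine .ifRestrict (.seedLength_lt hin hs) (fun _ _ ex _ => (hs.ext ex).succ.succ) ?_
  intro Γ' c' π ex hlt
  have hb' : ∀ x, c'.b x = s (π x) := fun x => by rw [ex.b, hb]
  have hw : Impl c' fun x => w (π x) := .value (fun x => by rw [ex.inp, hin]) hb'
    fun x => Nat.le_of_not_lt (hlt x)
  have hs' := hs.ext ex
  have hc := Impl.outCount M C hw hs' hb'
  exact .if (hc.le hs') hc.succ.succ ((hw.size.size.pow (.const 3)
    (hw.size.size.bdd.pow_const 3)).mul (((Impl.const 2).mul hw).succ.succ.mul hw.size)).succ.succ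

theorem Impl.adviceBit (M : OfflineTM 4) (C : ℕ) (hin : ∀ γ, c.inp γ 0 = (w γ).bits)
    (hx : ∀ γ, (c.inp γ 1).length = s γ) (hb : ∀ γ, c.b γ = s γ) {j : Γ → ℕ} (hj : Impl c j) :
    Impl c fun γ => adviceBit M C (w γ) (s γ) (SpaceDerand.bitAt (c.inp γ 1)) (j γ) := by
  have hs := Impl.seedLength hx hb
  have hxb : BitFam c fun γ => SpaceDerand.bitAt (c.inp γ 1) := fun _ _ _ _ ex hk _ =>
    (hk.bitAt 1).congr fun _ => by rw [ex.inp]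
  have hj2 : Impl c fun γ => j γ - 2 := hj.sub (.const 2)
  have hx2 := hxb.apply hj2
  refine .ifRestrict (.seedLength_lt hin hs) (fun _ _ ex _ =>
    (Impl.if (hj.lt (.const 2)) .zero hx2).ext ex) ?_
  intro Γ' c' π ex hlt
  have hb' : ∀ x, c'.b x = s (π x) := fun x => by rw [ex.b, hb]
  have hle : ∀ x, (w (π x)).size ≤ s (π x) := fun x => Nat.le_of_not_lt (hlt x)
  have hw : Impl c' fun x => w (π x) := .value (fun x => by rw [ex.inp, hin]) hb' hle
  have hs' := hs.ext ex
  have hj' := hj.ext ex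
  have hj2' := hj2.ext ex
  have hB : Impl c' fun x => (2 * w (π x) + 2) * (w (π x)).size :=
    ((Impl.const 2).mul hw).succ.succ.mul hw.size
  exact .if ((Impl.outCount M C hw hs' hb').le hs')
    (.if (hj'.eq (.const 0)) (.const 1) (.if (hj'.eq (.const 1)) .zero (hx2.ext ex)))
    (.if (hj'.lt (.const 2)) (.const 1) (.tableBit M C hw hs' hb' hle (hxb.ext ex)
      (fun _ => bitAt_le _) (hj2'.div hB) (hj2'.mod hB)))

end

theorem computable_advice (M : OfflineTM 4) (C : ℕ) (s : ℕ+ → ℕ) :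
    ComputableInSpace (ι := (w : ℕ+) × Bits (s w))
      (fun ⟨w, x⟩ => ![Nat.bits w, List.ofFn x])
      (fun ⟨w, x⟩ => List.ofFn (advice M C s w x)) (fun ⟨w, _⟩ => s w) := by
  refine Impl.computable (len := fun γ : (w : ℕ+) × Bits (s w) => adviceLen M C γ.1 (s γ.1))
    (bit := fun γ j => adviceBit M C γ.1 (s γ.1) (bitAt (List.ofFn γ.2)) j)
    (.adviceLen M C (fun _ => rfl) (fun _ => List.length_ofFn) fun _ => rfl)
    (fun c' π k ex hk _ => ?_) fun γ => ?_
  · exact (Impl.adviceBit M C (w := fun x => ((π x).1 : ℕ)) (s := fun x => s (π x).1)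
      (fun x => by rw [ex.inp]; rfl) (fun x => by rw [ex.inp]; exact List.length_ofFn)
      (fun x => by rw [ex.b]) hk).congr fun x => by rw [ex.inp]; rfl
  · exact List.ext_getElem (by simp) fun j h1 h2 => by simp [advice]

/-! ### Correctness of the simulation -/

section

variable {M : OfflineTM 4} {C : ℕ} {s : ℕ+ → ℕ} {w : ℕ+} {m : ℕ} {p : Pointed w}

theorem adviceBit_le (M : OfflineTM 4) (C w s : ℕ) {xb : ℕ → ℕ} (h : ∀ j, xb j ≤ 1) (j : ℕ) :
    adviceBit M C w s xb j ≤ 1 := by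
  rw [adviceBit, tableBit]
  split_ifs <;> first | exact h _ | exact rawBit_le _ _ _ _ | exact dig_two_le _ _ | omega

theorem bitAt_advice (x : Bits (s w)) {j : ℕ} (hj : j < adviceLen M C w (s w)) :
    bitAt (List.ofFn (advice M C s w x)) j =
      adviceBit M C w (s w) (bitAt (List.ofFn x)) j := by
  have := adviceBit_le M C w (s w) (bitAt_le (List.ofFn x)) j
  rw [bitAt_ofFn _ hj, advice]
  rcases Nat.le_one_iff_eq_zero_or_eq_one.1 this with h | h <;> simp [h]

theorem simulator_eq {y : List Bool} {n : ℕ} {q : Fin w} (hn : y.length = n)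
    (h : simVal M C w n (bitAt (pairBits p)) (bitAt y) = q) : simulator M C w p y = q := by
  subst hn
  exact Fin.ext ((congrArg (· % (w : ℕ)) h).trans (Nat.mod_eq_of_lt q.2))

/-- The space of `M` is here logarithmic in `w`, so the simulator can run the generator on its
actual pair, with the seed as advice. -/
theorem simulator_short (h : s w < (w : ℕ).size) (x : Bits (s w)) {y : Bits m}
    (hM : M.OutputsInSpace ![Nat.bits w, encAutomaton p.1, encState p.2, List.ofFn x]
      (List.ofFn y) (C * (s w + 1))) :
    simulator M C w p (List.ofFn (advice M C s w x)) = p.fn m y := by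
  have hlen : adviceLen M C w (s w) = s w + 2 := if_pos h
  refine simulator_eq (List.length_ofFn.trans hlen) ?_
  have h0 : bitAt (List.ofFn (advice M C s w x)) 0 = 0 := by
    rw [bitAt_advice x (by omega), adviceBit, if_pos h, if_pos (by omega)]
  rw [simVal, if_pos h0, Nat.add_sub_cancel, if_pos h]
  refine endState_eq hM List.length_ofFn (fun _ _ => rfl) fun j hj => ?_
  rw [bitAt_advice x (by omega), adviceBit, if_pos h, if_neg (by omega), Nat.add_sub_cancel]

/-- The automaton reads the first `m` bits of the seed directly; the generator is not needed, as
these bits are uniform. -/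
theorem simulator_prefix (h : ¬ s w < (w : ℕ).size) (hc : outCount M C w (s w) = m)
    (hm : m ≤ s w) (x : Bits (s w)) :
    simulator M C w p (List.ofFn (advice M C s w x)) = p.fn m fun i => x (Fin.castLE hm i) := by
  have hm' : outCount M C w (s w) ≤ s w := by omega
  have hlen : adviceLen M C w (s w) = m + 2 := by rw [adviceLen, if_neg h, if_pos hm', hc]
  have hbit : ∀ j, adviceBit M C w (s w) (bitAt (List.ofFn x)) j =
      if j = 0 then 1 else if j = 1 then 0 else bitAt (List.ofFn x) (j - 2) := fun j => by
    rw [adviceBit, if_neg h, if_pos hm']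
  refine simulator_eq (List.length_ofFn.trans hlen) ?_
  have h0 : bitAt (List.ofFn (advice M C s w x)) 0 = 1 := by
    rw [bitAt_advice x (by omega), hbit, if_pos rfl]
  have h1 : bitAt (List.ofFn (advice M C s w x)) 1 = 0 := by
    rw [bitAt_advice x (by omega), hbit, if_neg (by omega), if_pos rfl]
  rw [simVal, if_neg (by omega), if_pos h1, Nat.add_sub_cancel]
  refine runAt_eq _ (fun _ _ => rfl) fun j => ?_
  rw [bitAt_advice x (by omega), hbit, if_neg (by omega), if_neg (by omega), Nat.add_sub_cancel,
    bitAt_ofFn x (by omega)]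
  rfl

/-- The entry `e₀` matches. Any entry that matches contains the bits of `p`, so its answer was
computed from `p`, and the correctness of `M` on `p` alone suffices. -/
theorem simulator_table (h : ¬ s w < (w : ℕ).size) (hc : ¬ outCount M C w (s w) ≤ s w)
    (x : Bits (s w)) {y : Bits m}
    (hM : M.OutputsInSpace ![Nat.bits w, encAutomaton p.1, encState p.2, List.ofFn x]
      (List.ofFn y) (C * (s w + 1)))
    {e₀ : ℕ} (he₀ : e₀ < (w : ℕ).size.size ^ 3)
    (hraw : ∀ j < (2 * (w : ℕ) + 1) * (w : ℕ).size, rawBit w (s w) e₀ j = bitAt (pairBits p) j) :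
    simulator M C w p (List.ofFn (advice M C s w x)) = p.fn m y := by
  set sz := (w : ℕ).size with hsz
  have hsz0 : 0 < sz := Nat.size_pos.2 w.pos
  set B := (2 * (w : ℕ) + 2) * sz with hB
  have hB1 : B = (2 * (w : ℕ) + 1) * sz + sz := by rw [hB]; ring
  have hlen : adviceLen M C w (s w) = sz.size ^ 3 * B + 2 := by
    rw [adviceLen, if_neg h, if_neg hc]
  have hbit0 : ∀ j < 2, adviceBit M C w (s w) (bitAt (List.ofFn x)) j = 1 := fun j hj => by
    rw [adviceBit, if_neg h, if_neg hc, if_pos hj]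
  have hin : ∀ e < sz.size ^ 3, ∀ j < B, 2 + e * B + j < adviceLen M C w (s w) := by
    intro e he j hj
    have := Nat.mul_le_mul_right B (Nat.succ_le_of_lt he)
    rw [Nat.succ_mul] at this
    omega
  have hbit : ∀ e < sz.size ^ 3, ∀ j < B, bitAt (List.ofFn (advice M C s w x)) (2 + e * B + j) =
      tableBit M C w (s w) (bitAt (List.ofFn x)) e j := by
    intro e he j hj
    have h1 : 2 + e * B + j - 2 = j + e * B := by omega
    rw [bitAt_advice x (hin e he j hj), adviceBit, if_neg h, if_neg hc, if_neg (by omega), h1,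
      ← hsz, ← hB, Nat.add_mul_div_right _ _ (by omega), Nat.add_mul_mod_self_right,
      Nat.div_eq_of_lt hj, Nat.mod_eq_of_lt hj, zero_add]
  have hraw' : ∀ e < sz.size ^ 3, ∀ j < (2 * (w : ℕ) + 1) * sz,
      bitAt (List.ofFn (advice M C s w x)) (2 + e * B + j) = rawBit w (s w) e j := by
    intro e he j hj
    rw [hbit e he j (by omega), tableBit, if_pos hj]
  refine simulator_eq (List.length_ofFn.trans hlen) ?_
  have hbit1 : ∀ j < 2, bitAt (List.ofFn (advice M C s w x)) j ≠ 0 := fun j hj => by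
    rw [bitAt_advice x (by omega), hbit0 j hj]
    exact one_ne_zero
  rw [simVal, if_neg (hbit1 0 (by omega)), if_neg (hbit1 1 (by omega))]
  have hfit : ∀ e, 2 + (e + 1) * B ≤ sz.size ^ 3 * B + 2 ↔ e < sz.size ^ 3 := fun e => by
    rw [add_comm 2, Nat.add_le_add_iff_right, Nat.mul_le_mul_right_iff (by omega)]
    rfl
  refine lookup_eq (e := e₀) ?_ ?_ ?_
  · rintro e - ⟨h1, h2⟩
    have he := (hfit e).1 h1
    have hr : ∀ j < (2 * (w : ℕ) + 1) * (w : ℕ).size,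
        rawBit w (s w) e j = bitAt (pairBits p) j := fun j hj => by
      rw [← hraw' e he j hj]
      exact h2 j hj
    have hend := endState_eq hM List.length_ofFn hr fun j _ => rfl
    refine numAt_eq (val_lt_two_pow_size _) fun j hj => ?_
    rw [← hsz, ← hB, add_assoc, hbit e he _ (by omega), tableBit, ← hsz, if_neg (by omega), hend,
      Nat.add_sub_cancel_left]
  · have := Nat.le_mul_of_pos_right (sz.size ^ 3) (show 0 < B by omega)
    omega
  · exact ⟨(hfit e₀).2 he₀, fun j hj => (hraw' e₀ he₀ j hj).trans (hraw j hj)⟩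

theorem foldl_clip (b : ℕ) (l : List Bool) (a : ℕ) :
    l.foldl (fun a _ => min (a + 1) b) (min a b) = min (a + l.length) b := by
  induction l generalizing a with
  | nil => rfl
  | cons x l ih =>
    rw [List.foldl_cons, show min (min a b + 1) b = min (a + 1) b by omega, ih, List.length_cons]
    congr 1
    omega

/-- All outputs of the generator for `w` have the same length, so one run on a pair known to lie in
`A w` compares `m` with `s`. -/
theorem outCount_eq {y : Bits m}
    (hM : M.OutputsInSpace ![Nat.bits w, encAutomaton (onesAutomaton w).1,
      encState (onesAutomaton w).2, List.ofFn fun _ : Fin (s w) => false]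
      (List.ofFn y) (C * (s w + 1))) : outCount M C w (s w) = min m (s w + 1) := by
  have hfit := genSim_fits M C (w := w) (s := s w) (p := onesAutomaton w) (xb := fun _ => 0)
    (x := List.ofFn fun _ : Fin (s w) => false) List.length_ofFn (fun j hj => onesBit_eq w hj)
    fun j hj => by rw [bitAt_ofFn _ hj]; rfl
  rw [outCount, hM.fold_eq hfit]
  simpa using foldl_clip (s w + 1) (List.ofFn y) 0

/-- The number of tapes, the base and the code of the printing machine are the three digits of the
candidate number; `hL` says that the space allotted to a candidate suffices for it. -/
theorem exists_rawBit_eq {M : OfflineTM 1} {L s : ℕ}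
    (hM : M.OutputsInSpace ![Nat.bits w] (encAutomaton p.1 ++ encState p.2) L)
    (hs : (w : ℕ).size ≤ s) (hL : L ≤ s / (w : ℕ).size.size) (hk : M.k < (w : ℕ).size.size)
    (hd : M.numStates + 3 < (w : ℕ).size.size) (hi : M.code < (w : ℕ).size.size) :
    ∃ e < (w : ℕ).size.size ^ 3, ∀ j < (2 * (w : ℕ) + 1) * (w : ℕ).size,
      rawBit w s e j = bitAt (pairBits p) j := by
  set G := (w : ℕ).size.size with hG
  have hG0 : 0 < G := by omega
  have e1 : (M.k * G + (M.numStates + 3)) * G + M.code < G ^ 3 := by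
    have h1 : M.k * G + (M.numStates + 3) < G * G := by nlinarith
    nlinarith
  have e2 : ((M.k * G + (M.numStates + 3)) * G + M.code) / G = M.k * G + (M.numStates + 3) := by
    rw [add_comm, Nat.add_mul_div_right _ _ hG0, Nat.div_eq_of_lt hi, zero_add]
  refine ⟨_, e1, fun j hj => (hM.mono hL).outBit_eq ⟨?_, ?_, ?_, rfl, fun i => ?_, ?_, fun i q => ?_⟩
    (by rwa [← pairBits, length_pairBits])⟩
  · simp only [rawSim, ← hG]
    rw [← Nat.div_div_eq_div_mul, e2, add_comm, Nat.add_mul_div_right _ _ hG0,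
      Nat.div_eq_of_lt hd, zero_add, min_eq_left hk.le]
  · simp only [rawSim, ← hG]
    rw [e2, add_comm, Nat.add_mul_mod_self_right, Nat.mod_eq_of_lt hd]
  · simp only [rawSim, ← hG]
    rw [add_comm, Nat.add_mul_mod_self_right, Nat.mod_eq_of_lt hi]
  · fin_cases i
    simp [rawSim, Nat.size_eq_bits_len]
    omega
  · have := Nat.div_le_self s G
    simp only [rawSim]
    omega
  · fin_cases i
    exact virtualTape_eq (Nat.size_eq_bits_len _) (fun j _ => (bitAt_bits w j).symm) q

end

/-! ### Growth -/

/-- To be used with `y = log w`: the space `O(log w)` of a uniform machine, multiplied by `log log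
w`, stays below `log ^ (1 + η) w`. The outer `+ 1` makes up for the one in the lower bound on `s +
1`. -/
theorem eventually_mul_log_le (C : ℝ) (hC : 0 ≤ C) {η : ℝ} (hη : 0 < η) :
    ∀ᶠ y : ℝ in atTop, C * (y + 1) * (Real.logb 2 (y + 1) + 1) + 1 ≤ y ^ (1 + η) := by
  have hl : 0 < Real.log 2 := Real.log_pos (by norm_num)
  -- Collects the constants of the final estimate; the power of `2` pays for passing from `y` to `(y
  -- + 1) / 2 ≤ y`.
  set K : ℝ := (C / Real.log 2 + C + 1) * 2 ^ (1 + η) with hK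
  have hK0 : 0 < K := by positivity
  have h1 : ∀ᶠ z : ℝ in atTop, Real.log z ≤ K⁻¹ * z ^ η := by
    filter_upwards [(isLittleO_log_rpow_atTop hη).bound (inv_pos.2 hK0), eventually_ge_atTop 1]
      with z hz hz1
    rw [Real.norm_eq_abs, Real.norm_eq_abs, abs_of_nonneg (a := z ^ η) (by positivity)] at hz
    exact (le_abs_self _).trans hz
  have h2 : ∀ᶠ z : ℝ in atTop, 1 ≤ K⁻¹ * z ^ η := by
    filter_upwards [(tendsto_rpow_atTop hη).eventually_ge_atTop K] with z hz
    rw [inv_mul_eq_div, le_div_iff₀ hK0, one_mul]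
    exact hz
  have ht : Tendsto (fun y : ℝ => y + 1) atTop atTop := tendsto_atTop_add_const_right _ _ tendsto_id
  filter_upwards [ht.eventually h1, ht.eventually h2, eventually_ge_atTop 1] with y hy1 hy2 hy3
  set z := y + 1 with hz
  set u := K⁻¹ * z ^ η with hu
  have hz1 : 1 ≤ z := by linarith
  have hlog : Real.logb 2 z ≤ u / Real.log 2 := div_le_div_of_nonneg_right hy1 hl.le
  calc C * z * (Real.logb 2 z + 1) + 1 ≤ C * z * (u / Real.log 2 + u) + z * u := by
        have : C * z * (Real.logb 2 z + 1) ≤ C * z * (u / Real.log 2 + u) :=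
          mul_le_mul_of_nonneg_left (by linarith) (by positivity)
        nlinarith
    _ = (C / Real.log 2 + C + 1) * (z * u) := by ring
    _ = (z / 2) ^ (1 + η) := by
        rw [Real.div_rpow (by positivity) (by norm_num), Real.rpow_add (by positivity),
          Real.rpow_one, hu, hK]
        field_simp
    _ ≤ y ^ (1 + η) := Real.rpow_le_rpow (by positivity) (by linarith) (by linarith)

theorem tendsto_logb_pnat : Tendsto (fun w : ℕ+ => Real.logb 2 (w : ℕ)) atTop atTop :=
  (Real.tendsto_logb_atTop (by norm_num)).comp
    (tendsto_natCast_atTop_atTop.comp tendsto_PNat_val_atTop_atTop)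

theorem size_le_log (n : ℕ) : n.size ≤ Nat.log 2 n + 1 :=
  Nat.size_le.2 (Nat.lt_pow_succ_log_self (by norm_num) n)

/-- The lower bound on the seed length leaves each candidate enough space for any uniform machine
with space constant `C`. -/
theorem eventually_space_le (C : ℕ) {η : ℝ} (hη : 0 < η) :
    ∀ᶠ w : ℕ+ in atTop, ∀ s : ℕ, Real.logb 2 (w : ℕ) ^ (1 + η) ≤ s + 1 →
      C * (Nat.log 2 w + 1) ≤ s / (w : ℕ).size.size := by
  filter_upwards [tendsto_logb_pnat.eventually (eventually_mul_log_le C C.cast_nonneg hη)]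
    with w hw s hs
  have hG0 : 0 < (w : ℕ).size.size := Nat.size_pos.2 (Nat.size_pos.2 w.pos)
  rw [Nat.le_div_iff_mul_le hG0]
  have h1 : (Nat.log 2 w : ℝ) ≤ Real.logb 2 (w : ℕ) := by exact_mod_cast Real.natLog_le_logb w 2
  have h2 : ((w : ℕ).size.size : ℝ) ≤ Real.logb 2 (Real.logb 2 (w : ℕ) + 1) + 1 := by
    have h3 : ((w : ℕ).size : ℝ) ≤ Real.logb 2 (w : ℕ) + 1 := by
      have : ((w : ℕ).size : ℝ) ≤ Nat.log 2 w + 1 := by exact_mod_cast size_le_log w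
      linarith
    have h4 : ((w : ℕ).size.size : ℝ) ≤ Nat.log 2 (w : ℕ).size + 1 := by
      exact_mod_cast size_le_log _
    have h5 : (Nat.log 2 (w : ℕ).size : ℝ) ≤ Real.logb 2 (w : ℕ).size := by
      exact_mod_cast Real.natLog_le_logb _ 2
    have h6 : Real.logb 2 (w : ℕ).size ≤ Real.logb 2 (Real.logb 2 (w : ℕ) + 1) :=
      Real.logb_le_logb_of_le (by norm_num) (by exact_mod_cast Nat.size_pos.2 w.pos) h3
    linarith
  have h7 : ((C * (Nat.log 2 w + 1) * (w : ℕ).size.size : ℕ) : ℝ) ≤ s := by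
    push_cast
    refine le_trans (mul_le_mul (mul_le_mul_of_nonneg_left (add_le_add_left h1 1) C.cast_nonneg)
      h2 (Nat.cast_nonneg _) ?_) (by linarith)
    have : (0 : ℝ) ≤ Nat.log 2 w := Nat.cast_nonneg _
    exact mul_nonneg C.cast_nonneg (by linarith)
  exact_mod_cast h7

theorem eventually_lt_size_size (n : ℕ) : ∀ᶠ w : ℕ+ in atTop, n < (w : ℕ).size.size := by
  filter_upwards [tendsto_PNat_val_atTop_atTop.eventually_ge_atTop (2 ^ 2 ^ n)] with w hw
  exact Nat.lt_size.2 (Nat.lt_size.2 hw).le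

/-- An automaton with `w` states has to be able to count `s + 1` trailing ones. The same bound makes
the advice polynomially long. -/
theorem eventually_add_one_lt {s : ℕ+ → ℕ} {r : ℝ}
    (hs : (fun w : ℕ+ => (s w : ℝ)) =O[atTop] fun w : ℕ+ => Real.logb 2 (w : ℕ) ^ r) :
    ∀ᶠ w : ℕ+ in atTop, s w + 1 < w := by
  have hcast : Tendsto (fun w : ℕ+ => ((w : ℕ) : ℝ)) atTop atTop :=
    tendsto_natCast_atTop_atTop.comp tendsto_PNat_val_atTop_atTop
  have h1 : (fun w : ℕ+ => Real.logb 2 (w : ℕ) ^ r) =O[atTop]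
      fun w : ℕ+ => Real.log (w : ℕ) ^ r := by
    refine IsBigO.of_bound ‖(Real.log 2 ^ r)⁻¹‖ (Eventually.of_forall fun w => le_of_eq ?_)
    have : (0 : ℝ) ≤ Real.log (w : ℕ) := Real.log_natCast_nonneg _
    rw [Real.logb, Real.div_rpow this (Real.log_nonneg (by norm_num)), div_eq_inv_mul, norm_mul]
  have h2 := (hs.trans h1).trans_isLittleO
    ((isLittleO_log_rpow_rpow_atTop r one_pos).comp_tendsto hcast)
  filter_upwards [h2.bound (show (0 : ℝ) < 1 / 2 by norm_num), hcast.eventually_gt_atTop 2]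
    with w hw hw2
  simp only [Function.comp, Real.rpow_one, Real.norm_natCast] at hw
  have : (s w : ℝ) + 1 < (w : ℕ) := by linarith
  exact_mod_cast this

theorem adviceLen_le (M : OfflineTM 4) (C : ℕ) {s : ℕ+ → ℕ}
    (hs : ∀ᶠ w : ℕ+ in atTop, s w + 1 < w) :
    ∃ c : ℕ, ∀ w : ℕ+, adviceLen M C w (s w) ≤ c * (w : ℕ) ^ c := by
  obtain ⟨N, hN⟩ := eventually_atTop.1 hs
  -- Bounds the seed length at the finitely many `w` before the asymptotic bound holds.
  obtain ⟨K, hK⟩ := ((Set.finite_Iio N).image s).bddAbove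
  have hle : ∀ w, s w ≤ K + w := fun w => by
    rcases lt_or_ge w N with h | h
    · exact (hK ⟨w, h, rfl⟩).trans (Nat.le_add_right _ _)
    · have := hN w h
      omega
  refine ⟨K + 6, fun w => ?_⟩
  have hw : 1 ≤ (w : ℕ) := w.pos
  have h1 := size_le_self w
  have h2 := (size_le_self (w : ℕ).size).trans h1
  have h3 : (w : ℕ) ≤ (w : ℕ) ^ (K + 6) := Nat.le_self_pow (by omega) _
  have h5 : (w : ℕ) ^ 5 ≤ (w : ℕ) ^ (K + 6) := Nat.pow_le_pow_right hw (by omega)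
  have hsmall : s w + 2 ≤ (K + 6) * (w : ℕ) ^ (K + 6) := by
    have := hle w
    nlinarith
  rw [adviceLen]
  split_ifs
  · exact hsmall
  · omega
  · calc (w : ℕ).size.size ^ 3 * ((2 * w + 2) * (w : ℕ).size) + 2
        ≤ (w : ℕ) ^ 3 * ((2 * w + 2 * w) * w) + 2 * (w : ℕ) ^ 5 := by
          gcongr
          · omega
          · exact le_mul_of_one_le_right (by norm_num) (Nat.one_le_pow _ _ hw)
      _ = 6 * (w : ℕ) ^ 5 := by ring
      _ ≤ _ := Nat.mul_le_mul (by omega) h5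

end SpaceDerand

/-! ### The main theorem -/

open SpaceDerand Filter Asymptotics in
theorem mainTheorem4 (μ σ η : ℝ) (hμ₀ : 0 ≤ μ) (hμ₁ : μ ≤ 1) (hη : 0 < η) (hση : η < σ)
    (s m : ℕ+ → ℕ) (ε : ℕ+ → ℝ)
    (hs : (fun w : ℕ+ => (s w : ℝ)) =O[atTop] fun w : ℕ+ => Real.logb 2 (w : ℕ) ^ (1 + σ))
    (hε : ∀ w : ℕ+, 0 < ε w ∧ Real.logb 2 (1 / ε w) = Real.logb 2 (w : ℕ) ^ (1 + η))
    (hm : ∀ w : ℕ+, 2 ≤ w → Real.logb 2 (w : ℕ) ^ μ ≤ Real.logb 2 (m w))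
    (A : (w : ℕ+) → Set (Pointed w)) (hA : CoversUniform A)
    (Gen : (w : ℕ+) → A w → Bits (s w) → Bits (m w))
    (hprg : ∀ w, IsTargetedPRG (ε w) (A w) (Gen w))
    (heff : EfficientTargeted A Gen) :
    ∃ (a : ℕ+ → ℕ) (Gen' : (w : ℕ+) → Bits (s w) → Bits (a w))
      (A' : (w : ℕ+) → Set (Pointed w)),
      (∃ c : ℕ, ∀ w : ℕ+, a w ≤ c * (w : ℕ) ^ c) ∧
      EfficientAdvice Gen' ∧
      CoversUniform A' ∧
      IsSimulationAdviceGenerator ε m A' Gen' := by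
  obtain ⟨M, C, hM⟩ := heff.2
  have hsmall := eventually_add_one_lt hs
  -- These are the pairs on which the simulation succeeds, so the simulation property holds by
  -- definition and the content lies in covering the uniform sequences.
  let A' : (w : ℕ+) → Set (Pointed w) := fun w =>
    {p | TVClose (ε w) (law fun x => simulator M C w p (List.ofFn (advice M C s w x)))
      (law (p.fn (m w)))}
  refine ⟨_, advice M C s, A', adviceLen_le M C hsmall, ⟨heff.1, computable_advice M C s⟩, ?_,
    simulator M C, isLogspaceAlgorithm_simulator M C, fun w f => f.2⟩
  intro p hp
  obtain ⟨N, D, hN⟩ := id hp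
  filter_upwards [hA p hp, hA onesAutomaton isUniformSequence_ones, hsmall,
    eventually_space_le D hη, eventually_lt_size_size N.k, eventually_lt_size_size (N.numStates + 3),
    eventually_lt_size_size N.code] with w hpA hones hsw hspace hk hd hi
  have hMp : ∀ x, M.OutputsInSpace ![Nat.bits w, encAutomaton (p w).1, encState (p w).2,
      List.ofFn x] (List.ofFn (Gen w ⟨p w, hpA⟩ x)) (C * (s w + 1)) := fun x =>
    hM ⟨w, ⟨p w, hpA⟩, x⟩
  have hsim := hprg w ⟨p w, hpA⟩
  show TVClose (ε w) _ _
  by_cases h : s w < (w : ℕ).size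
  · simp only [simulator_short h _ (hMp _)]
    exact hsim
  -- The count equals `min m (s + 1)`, so the case distinction on it is the one between `m ≤ s` and
  -- `s < m`.
  have hcount := outCount_eq (hM ⟨w, ⟨onesAutomaton w, hones⟩, fun _ => false⟩)
  by_cases hc : outCount M C w (s w) ≤ s w
  · have hms : m w ≤ s w := by omega
    have hc' : outCount M C w (s w) = m w := by omega
    simp only [simulator_prefix h hc' hms]
    exact tvClose_prefix hms _ (hε w).1.le
  -- For `s < m` the error forces a long seed, which gives the candidates enough space for the
  -- machine `N` behind the sequence `p`.
  · have hlow := half_pow_le_of_tvClose _ hsw (by omega) (hprg w ⟨onesAutomaton w, hones⟩)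
    have hlog : Real.logb 2 (w : ℕ) ^ (1 + η) ≤ s w + 1 := by
      rw [← (hε w).2, Real.logb_le_iff_le_rpow (by norm_num) (one_div_pos.2 (hε w).1), one_div]
      exact_mod_cast inv_le_of_inv_le₀ (by positivity) hlow
    obtain ⟨e, he, hraw⟩ := exists_rawBit_eq (hN w) (Nat.le_of_not_lt h) (hspace _ hlog) hk hd hi
    simp only [simulator_table h hc _ (hMp _) he hraw]
    exact hsim
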